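/- **Energy bubbling.** For $v\in H^1(\mathbb{R};\mathbb{C})$ let $$E(v)=\frac12\int_{\mathbb{R}}\Big|\partial_x v+\tfrac12\mathcal{H}(|v|^2)v\Big|^2dx,$$ where $\mathcal{H}$ is the Hilbert transform, $\widehat{\mathcal{H}f}(\xi)=-i\,\mathrm{sgn}(\xi)\widehat f(\xi)$. Let $Q(x)=\frac{\sqrt2}{\sqrt{1+x^2}}$, $\Lambda Q=\frac12Q+x\,\partial_xQ$, $\langle x\rangle=(1+x^2)^{1/2}$ and $(f,g)_r=\int_{\mathbb{R}}\mathrm{Re}(\overline f g)\,dx$. Fix a cut-off function $\chi\in C^\infty(\mathbb{R};[0,1])$ with $\chi=1$ on $[-1,1]$ and $\mathrm{supp}\,\chi\subset[-2,2]$; for $R>0$ put $\chi_R(x)=\chi(x/R)$ and $\varphi_R=1-\chi_R$, and define $$\|f\|_{\dot{\mathcal{H}}^1}^2=\|\partial_xf\|_{L^2}^2+\|\langle x\rangle^{-1}f\|_{L^2}^2,\qquad \|f\|_{\dot{\mathcal{H}}^1_R}^2=\|\partial_x(\chi_Rf)\|_{L^2}^2+\|\langle x\rangle^{-1}f\|_{L^2}^2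 .$$ Then for every $M>0$ there exist $R>1$, $\eta>0$ and $c>0$, depending only on $M$ and $\chi$, such that every $\varepsilon\in H^1(\mathbb{R};\mathbb{C})$ with $\|\varepsilon\|_{L^2}\le M$, with $$(\varepsilon,\chi\Lambda Q)_r=(\varepsilon,i\chi Q)_r=(\varepsilon,\chi\,\partial_xQ)_r=0,$$ and with $\|\varepsilon\|_{\dot{\mathcal{H}}^1}\le\eta$ satisfies $$E(Q+\varepsilon)\;\ge\;c\,\Big(\|\varepsilon\|_{\dot{\mathcal{H}}^1_R}^2+E(\varphi_R\varepsilon)\Big).$$ -/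

import Mathlib

open MeasureTheory
open scoped FourierTransform ContDiff

namespace CMDNLS

noncomputable section

/-- `g` is the weak derivative of `f` on the real line (tested against `C_c^∞` functions). -/
def HasWeakDeriv (f g : ℝ → ℂ) : Prop :=
  LocallyIntegrable f ∧ LocallyIntegrable g ∧
    ∀ φ : ℝ → ℝ, ContDiff ℝ ∞ φ → HasCompactSupport φ →
      ∫ x, ((deriv φ x : ℝ) : ℂ) * f x = -∫ x, ((φ x : ℝ) : ℂ) * g x

open Classical in
/-- The weak derivative `∂ₓ f` (unique up to a null set); the value is `0` if there is none. -/
def weakDeriv (f : ℝ → ℂ) : ℝ → ℂ :=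
  if h : ∃ g, HasWeakDeriv f g then h.choose else 0

/-- The Sobolev space `H¹(ℝ)` of complex-valued functions. -/
def MemH1 (f : ℝ → ℂ) : Prop :=
  MemLp f 2 ∧ ∃ g, MemLp g 2 ∧ HasWeakDeriv f g

/-- The `L²(ℝ)` norm. -/
def normL2 (f : ℝ → ℂ) : ℝ := (eLpNorm f 2 volume).toReal

/-- The symbol `-i sgn ξ` of the Hilbert transform. It is homogeneous of degree zero, so it does not
depend on whether frequencies are normalized by `e^{-ixξ}` or `e^{-2πixξ}`. -/
def hilbertSymbol (ξ : ℝ) : ℂ := -Complex.I * ((Real.sign ξ : ℝ) : ℂ)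

theorem measurable_hilbertSymbol : Measurable hilbertSymbol := by
  have h : Measurable Real.sign := by
    unfold Real.sign
    exact Measurable.ite measurableSet_Iio measurable_const
      (Measurable.ite measurableSet_Ioi measurable_const measurable_const)
  exact measurable_const.mul (Complex.measurable_ofReal.comp h)

theorem norm_hilbertSymbol_le (ξ : ℝ) : ‖hilbertSymbol ξ‖ ≤ 1 := by
  rcases Real.sign_apply_eq ξ with h | h | h <;> simp [hilbertSymbol, h]

theorem memLp_hilbertSymbol_mul (F : Lp ℂ 2 (volume : Measure ℝ)) :
    MemLp (fun ξ => hilbertSymbol ξ * F ξ) 2 volume := by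
  refine (Lp.memLp F).of_le
    (measurable_hilbertSymbol.aestronglyMeasurable.mul (Lp.memLp F).1) ?_
  filter_upwards with ξ
  rw [norm_mul]
  exact mul_le_of_le_one_left (norm_nonneg _) (norm_hilbertSymbol_le ξ)

open Classical in
/-- The Hilbert transform `ℋ f = 𝓕⁻¹ (-i sgn ξ) 𝓕 f` on `L²(ℝ)`, where `𝓕` is the unitary Fourier
transform of `L²`; the value is `0` if `f` is not in `L²`. -/
def hilbert (f : ℝ → ℂ) : ℝ → ℂ :=
  if h : MemLp f 2 volume then
    ((𝓕⁻ ((memLp_hilbertSymbol_mul (𝓕 (h.toLp f))).toLp _) : Lp ℂ 2 (volume : Measure ℝ)) : ℝ → ℂ)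
  else 0

/-- `𝐃_v v = ∂ₓ v + ½ ℋ(|v|²) v`. -/
def bogomolnyi (v : ℝ → ℂ) : ℝ → ℂ := fun x =>
  weakDeriv v x + (1 / 2 : ℂ) * hilbert (fun y => ((‖v y‖ ^ 2 : ℝ) : ℂ)) x * v x

/-- The energy `E(v) = ½ ∫ |∂ₓ v + ½ ℋ(|v|²) v|² dx`. -/
def energy (v : ℝ → ℂ) : ℝ := (1 / 2) * ∫ x, ‖bogomolnyi v x‖ ^ 2

/-- The soliton `Q(x) = √2 / √(1 + x²)`. -/
def Q (x : ℝ) : ℂ := ((√2 / √(1 + x ^ 2) : ℝ) : ℂ)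

/-- The generator of `L²` scaling applied to the soliton: `Λ Q = Q / 2 + x Q'`. -/
def LambdaQ (x : ℝ) : ℂ := Q x / 2 + (x : ℂ) * deriv Q x

/-- The real inner product `(f, g)_r = ∫ Re (conj f · g) dx`. -/
def innerR (f g : ℝ → ℂ) : ℝ := ∫ x, (starRingEnd ℂ (f x) * g x).re

/-- Smooth cut-off functions: values in `[0, 1]`, equal to `1` on `[-1, 1]`, supported in
`[-2, 2]`. -/
structure IsCutoff (χ : ℝ → ℝ) : Prop where
  contDiff : ContDiff ℝ ∞ χ
  nonneg : ∀ x, 0 ≤ χ x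
  le_one : ∀ x, χ x ≤ 1
  eq_one : ∀ x ∈ Set.Icc (-1 : ℝ) 1, χ x = 1
  tsupport_subset : tsupport χ ⊆ Set.Icc (-2) 2

/-- The truncated kernel element `𝒵₁ = χ Λ Q`. -/
def Z1 (χ : ℝ → ℝ) (x : ℝ) : ℂ := LambdaQ x * (χ x : ℂ)

/-- The truncated kernel element `𝒵₂ = i χ Q`. -/
def Z2 (χ : ℝ → ℝ) (x : ℝ) : ℂ := Complex.I * Q x * (χ x : ℂ)

/-- The truncated kernel element `𝒵₃ = χ Q'`. -/
def Z3 (χ : ℝ → ℝ) (x : ℝ) : ℂ := deriv Q x * (χ x : ℂ)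

/-- `χ_R f`, where `χ_R(x) = χ(x / R)`. -/
def innerPart (χ : ℝ → ℝ) (R : ℝ) (f : ℝ → ℂ) : ℝ → ℂ := fun x => (χ (x / R) : ℂ) * f x

/-- `φ_R f`, where `φ_R = 1 - χ_R`. -/
def outerPart (χ : ℝ → ℝ) (R : ℝ) (f : ℝ → ℂ) : ℝ → ℂ := fun x => (1 - (χ (x / R) : ℂ)) * f x

/-- `⟨x⟩⁻¹ f`, where `⟨x⟩ = (1 + x²)^{1/2}`. -/
def weighted (f : ℝ → ℂ) : ℝ → ℂ := fun x => (((√(1 + x ^ 2))⁻¹ : ℝ) : ℂ) * f x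

/-- The norm of the adapted space: `‖f‖² = ‖∂ₓ f‖²_{L²} + ‖⟨x⟩⁻¹ f‖²_{L²}`. -/
def normAdapted (f : ℝ → ℂ) : ℝ :=
  √(normL2 (weakDeriv f) ^ 2 + normL2 (weighted f) ^ 2)

/-- The norm of the truncated adapted space:
`‖f‖² = ‖∂ₓ (χ_R f)‖²_{L²} + ‖⟨x⟩⁻¹ f‖²_{L²}`. -/
def normAdaptedTrunc (χ : ℝ → ℝ) (R : ℝ) (f : ℝ → ℂ) : ℝ :=
  √(normL2 (weakDeriv (innerPart χ R f)) ^ 2 + normL2 (weighted f) ^ 2)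

end

end CMDNLS

/-! Write ε = a + ib, w = ⟨x⟩⁻¹a, l = ‖⟨x⟩⁻¹ε‖, and let k be the L² norm of the Bogomol'nyi residual
of Q + ε. Since ½ℋ(Q²) = x/(1+x²) and Q' = -x/(1+x²) Q, the residual has no term of order zero, and
E(Q+ε) = k²/2 (`IsPert.energy_Q_add`). The theorem reduces to l ≲ k (`IsPert.l_le`): given this,
multiplying the residual by χ_R or φ_R recovers ∂ₓ(χ_R ε) and the residual of φ_R ε up to O(l + k).
No largeness of R is needed, and R = 2 serves.

The bound on l comes from pairing the residual with x/(1+x²) ε. Integration by parts produces 3l²/2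
- 2Z, where Z = ∫⟨x⟩⁻⁴|ε|² is concentrated near the origin (`IsPert.integral_cpk_mul_residual`). The
nonlocal terms are tractable because the commutator of ℋ with the Cauchy kernel 1/(x+i) has rank one
(`cauchy_bilinear`): ∫ x/(1+x²) f ℋf, for instance, is a combination of squares of two scalar
moments of f.

Orthogonality enters only in the bound for Z, through the linearized residual, which is integrated
explicitly. In the imaginary part ⟨x⟩ is an integrating factor and the kernel is iQ. In the real
part put F = w + iℋw: the equation becomes F' + 2F/(x+i) = (x+i)⁻²((x+i)²F)', and its kernel
corresponds to ΛQ and Q'. Orthogonality to the truncated kernel elements fixes the constants of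
integration (`abs_le_of_imag_orthogonal`, `abs_le_of_real_orthogonal`).

The quadratic terms are delicate because ε is small in weighted norms only. The weighted isometry of
ℋ fails by scalar moments, and the harmful one is α = ∫ x/(1+x²)|ε|². Pairing the residual with Q,
where the linear terms cancel, gives |α| ≤ 6k + (small) l (`IsPert.abs_integral_cpk_dens_le`). The
mass bound M is compensated there, and in the smallness of ‖ε‖_∞ and ∫⟨x⟩⁻¹|a|, by the choice of η.
-/

namespace CMDNLS

/-- The space `L²(ℝ; ℂ)`. -/
abbrev ComplexL2 : Type := Lp ℂ 2 (volume : Measure ℝ)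

/-! ### Square-integrable real functions -/

/-- The `L²` norm of a real function. -/
noncomputable def nrm (f : ℝ → ℝ) : ℝ := √(∫ x, f x ^ 2)

theorem nrm_nonneg (f : ℝ → ℝ) : 0 ≤ nrm f := Real.sqrt_nonneg _

theorem nrm_sq (f : ℝ → ℝ) : nrm f ^ 2 = ∫ x, f x ^ 2 :=
  Real.sq_sqrt (integral_nonneg fun _ => sq_nonneg _)

theorem nrm_eq_toReal {f : ℝ → ℝ} (hf : MemLp f 2) : nrm f = (eLpNorm f 2 volume).toReal := by
  rw [hf.eLpNorm_eq_integral_rpow_norm (by norm_num) (by norm_num), nrm, Real.sqrt_eq_rpow,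
    ENNReal.toReal_ofReal (by positivity)]
  norm_num

theorem integrable_sq {f : ℝ → ℝ} (hf : MemLp f 2) : Integrable fun x => f x ^ 2 :=
  (memLp_two_iff_integrable_sq hf.1).1 hf

theorem nrm_add_le {f g : ℝ → ℝ} (hf : MemLp f 2) (hg : MemLp g 2) :
    nrm (fun x => f x + g x) ≤ nrm f + nrm g := by
  rw [show (fun x => f x + g x) = f + g from rfl, nrm_eq_toReal hf, nrm_eq_toReal hg,
    nrm_eq_toReal (hf.add hg), ← ENNReal.toReal_add hf.2.ne hg.2.ne]
  exact ENNReal.toReal_mono (ENNReal.add_ne_top.2 ⟨hf.2.ne, hg.2.ne⟩)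
    (eLpNorm_add_le hf.1 hg.1 (by norm_num))

theorem nrm_const_mul (c : ℝ) (f : ℝ → ℝ) : nrm (fun x => c * f x) = |c| * nrm f := by
  unfold nrm
  simp_rw [mul_pow]
  rw [integral_const_mul, Real.sqrt_mul (sq_nonneg c), Real.sqrt_sq_eq_abs]

/-- No measurability of `f` is required: a Bochner integral is 0 when the integrand is not
integrable, so the bound persists. -/
theorem nrm_mono {f g : ℝ → ℝ} {c : ℝ} (hc : 0 ≤ c) (hg : MemLp g 2)
    (h : ∀ᵐ x, |f x| ≤ c * |g x|) : nrm f ≤ c * nrm g := by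
  rw [show c * nrm g = nrm (fun x => c * g x) by rw [nrm_const_mul, abs_of_nonneg hc]]
  refine Real.sqrt_le_sqrt (integral_mono_of_nonneg (.of_forall fun _ => sq_nonneg _)
    (integrable_sq (hg.const_mul c)) ?_)
  filter_upwards [h] with x hx
  refine sq_le_sq.2 (hx.trans_eq ?_)
  rw [abs_mul, abs_of_nonneg hc]

theorem memLp_mono {f g : ℝ → ℝ} {c : ℝ} (hf : AEStronglyMeasurable f volume) (hg : MemLp g 2)
    (h : ∀ᵐ x, |f x| ≤ c * |g x|) : MemLp f 2 :=
  hg.of_le_mul hf h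

theorem integrable_mul {f g : ℝ → ℝ} (hf : MemLp f 2) (hg : MemLp g 2) :
    Integrable fun x => f x * g x := hf.integrable_mul hg

theorem integral_mul_le {f g : ℝ → ℝ} (hf : MemLp f 2) (hg : MemLp g 2) :
    ∫ x, |f x * g x| ≤ nrm f * nrm g := by
  have h := integral_mul_norm_le_Lp_mul_Lq (μ := volume) (f := f) (g := g)
    Real.HolderConjugate.two_two (by simpa using hf) (by simpa using hg)
  simp only [Real.norm_eq_abs, Real.rpow_two, sq_abs] at h
  simpa [abs_mul, nrm, Real.sqrt_eq_rpow] using h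

theorem abs_integral_mul_le {f g : ℝ → ℝ} (hf : MemLp f 2) (hg : MemLp g 2) :
    |∫ x, f x * g x| ≤ nrm f * nrm g :=
  (abs_integral_le_integral_abs).trans (integral_mul_le hf hg)

/-! ### The weights -/

/-- The weight `⟨x⟩⁻¹`. -/
noncomputable def wt (x : ℝ) : ℝ := (√(1 + x ^ 2))⁻¹

/-- The conjugate Poisson kernel `x / (1 + x²)` (without the factor `1 / π`). -/
noncomputable def cpk (x : ℝ) : ℝ := x / (1 + x ^ 2)

/-- The Poisson kernel `1 / (1 + x²)` (without the factor `1 / π`). -/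
noncomputable def pk (x : ℝ) : ℝ := 1 / (1 + x ^ 2)

theorem wt_pos (x : ℝ) : 0 < wt x := by unfold wt; positivity

theorem wt_sq (x : ℝ) : wt x ^ 2 = pk x := by
  unfold wt pk
  rw [inv_pow, Real.sq_sqrt (by positivity), one_div]

theorem pk_pos (x : ℝ) : 0 < pk x := by unfold pk; positivity

theorem pk_le_one (x : ℝ) : pk x ≤ 1 := by
  unfold pk
  rw [div_le_one (by positivity)]
  nlinarith [sq_nonneg x]

theorem wt_le_one (x : ℝ) : wt x ≤ 1 := by
  have h := pk_le_one x
  rw [← wt_sq] at h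
  nlinarith [wt_pos x]

theorem continuous_wt : Continuous wt := by
  unfold wt
  exact Continuous.inv₀ (by fun_prop) fun x => by positivity

theorem continuous_pk : Continuous pk := by
  unfold pk
  exact continuous_const.div (by fun_prop) fun x => by positivity

theorem continuous_cpk : Continuous cpk := by
  unfold cpk
  exact continuous_id.div (by fun_prop) fun x => by positivity

theorem abs_cpk_le_wt (x : ℝ) : |cpk x| ≤ wt x := by
  refine abs_le_of_sq_le_sq ?_ (wt_pos x).le
  rw [wt_sq]
  unfold cpk pk
  rw [div_pow, div_le_div_iff₀ (by positivity) (by positivity)]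
  nlinarith [sq_nonneg x]

theorem pk_le_wt (x : ℝ) : pk x ≤ wt x := by
  rw [← wt_sq]
  nlinarith [wt_pos x, wt_le_one x]

theorem integrable_pk : Integrable pk := by
  have : pk = fun x => (1 + x ^ 2)⁻¹ := funext fun x => one_div _
  rw [this]
  exact integrable_inv_one_add_sq

theorem integral_pk : ∫ x, pk x = Real.pi := by
  simp [pk, one_div]

theorem memLp_wt : MemLp wt 2 := by
  rw [memLp_two_iff_integrable_sq continuous_wt.aestronglyMeasurable]
  simpa only [wt_sq] using integrable_pk

theorem nrm_wt : nrm wt = √Real.pi := by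
  unfold nrm
  simp_rw [wt_sq, integral_pk]

theorem memLp_pk : MemLp pk 2 :=
  memLp_mono (c := 1) continuous_pk.aestronglyMeasurable memLp_wt <| .of_forall fun x => by
    rw [abs_of_pos (pk_pos x), abs_of_pos (wt_pos x), one_mul]; exact pk_le_wt x

theorem memLp_cpk : MemLp cpk 2 :=
  memLp_mono (c := 1) continuous_cpk.aestronglyMeasurable memLp_wt <| .of_forall fun x => by
    rw [abs_of_pos (wt_pos x), one_mul]; exact abs_cpk_le_wt x

/-- Multiplication of an `L²` function by a bounded measurable one. -/
theorem memLp_bdd_mul {f g : ℝ → ℝ} {c : ℝ} (hf : AEStronglyMeasurable f volume)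
    (hc : ∀ x, |f x| ≤ c) (hg : MemLp g 2) : MemLp (fun x => f x * g x) 2 :=
  memLp_mono (c := c) (hf.mul hg.1) hg <| .of_forall fun x => by
    rw [abs_mul]; exact mul_le_mul_of_nonneg_right (hc x) (abs_nonneg _)

theorem memLp_wt_mul {f : ℝ → ℝ} (hf : MemLp f 2) : MemLp (fun x => wt x * f x) 2 :=
  memLp_bdd_mul (c := 1) continuous_wt.aestronglyMeasurable
    (fun x => by rw [abs_of_pos (wt_pos x)]; exact wt_le_one x) hf

/-- Interpolation of a weighted `L¹` norm between two weighted `L²` norms. -/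
theorem integral_wt_mul_sq_le {f : ℝ → ℝ} (hf : MemLp f 2) {τ : ℝ} (hτ : 0 < τ) :
    (∫ x, wt x * |f x|) ^ 2 ≤
      Real.pi * (τ * nrm f ^ 2 + τ⁻¹ * nrm (fun x => wt x * f x) ^ 2) := by
  -- Cauchy–Schwarz with the intermediate weight √(τ² + ⟨x⟩⁻²): the complementary factor satisfies
  -- ⟨x⟩⁻²/(τ² + ⟨x⟩⁻²) ≤ 1/(1 + τ²x²), whose integral is π/τ.
  set θ : ℝ → ℝ := fun x => √(τ ^ 2 + wt x ^ 2) with hθ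
  have hθpos : ∀ x, 0 < θ x := fun x => by simp only [hθ]; positivity
  have hθc : Continuous θ := by
    have := continuous_wt
    simp only [hθ]; fun_prop
  have hθsq : ∀ x, θ x ^ 2 = τ ^ 2 + wt x ^ 2 := fun x => Real.sq_sqrt (by positivity)
  have hg : MemLp (fun x => θ x * f x) 2 := by
    refine memLp_bdd_mul (c := √(τ ^ 2 + 1)) hθc.aestronglyMeasurable (fun x => ?_) hf
    rw [abs_of_pos (hθpos x)]
    refine Real.sqrt_le_sqrt ?_
    nlinarith [wt_pos x, wt_le_one x]
  have hv_sq : ∀ x, (wt x / θ x) ^ 2 ≤ (1 + (τ * x) ^ 2)⁻¹ := fun x => by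
    rw [div_pow, hθsq, wt_sq, pk, ← one_div, div_le_div_iff₀ (by positivity) (by positivity)]
    have : (0:ℝ) < 1 + x ^ 2 := by positivity
    field_simp
    nlinarith [sq_nonneg τ]
  have hint : Integrable fun x : ℝ => (1 + (τ * x) ^ 2)⁻¹ :=
    integrable_inv_one_add_sq.comp_mul_left' hτ.ne'
  have hvm : AEStronglyMeasurable (fun x => wt x / θ x) volume :=
    (continuous_wt.div hθc fun x => (hθpos x).ne').aestronglyMeasurable
  have hv : MemLp (fun x => wt x / θ x) 2 := by
    rw [memLp_two_iff_integrable_sq hvm]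
    refine hint.mono' (hvm.pow 2) (.of_forall fun x => ?_)
    rw [Real.norm_of_nonneg (sq_nonneg _)]
    exact hv_sq x
  have h1 := integral_mul_le hv hg
  have h2 : ∀ x, |wt x / θ x * (θ x * f x)| = wt x * |f x| := fun x => by
    rw [← mul_assoc, div_mul_cancel₀ _ (hθpos x).ne', abs_mul, abs_of_pos (wt_pos x)]
  simp_rw [h2] at h1
  have h3 : nrm (fun x => wt x / θ x) ^ 2 ≤ τ⁻¹ * Real.pi := by
    rw [nrm_sq]
    refine (integral_mono_of_nonneg (.of_forall fun _ => sq_nonneg _) hint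
      (.of_forall hv_sq)).trans_eq ?_
    have := Measure.integral_comp_mul_left (fun y : ℝ => (1 + y ^ 2)⁻¹) τ
    rw [this, integral_univ_inv_one_add_sq, abs_of_pos (by positivity), smul_eq_mul]
  have h4 : nrm (fun x => θ x * f x) ^ 2 = τ ^ 2 * nrm f ^ 2 + nrm (fun x => wt x * f x) ^ 2 := by
    simp_rw [nrm_sq]
    rw [← integral_const_mul, ← integral_add ((integrable_sq hf).const_mul _)
      (integrable_sq (memLp_wt_mul hf))]
    refine integral_congr_ae (.of_forall fun x => ?_)
    simp only [mul_pow, hθsq]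
    ring
  have h5 : 0 ≤ ∫ x, wt x * |f x| :=
    integral_nonneg fun x => mul_nonneg (wt_pos x).le (abs_nonneg _)
  calc (∫ x, wt x * |f x|) ^ 2 ≤ (nrm (fun x => wt x / θ x) * nrm (fun x => θ x * f x)) ^ 2 :=
        pow_le_pow_left₀ h5 h1 2
    _ = nrm (fun x => wt x / θ x) ^ 2 * nrm (fun x => θ x * f x) ^ 2 := by ring
    _ ≤ τ⁻¹ * Real.pi * nrm (fun x => θ x * f x) ^ 2 := by gcongr
    _ = _ := by rw [h4]; field_simp

/-! ### Locally absolutely continuous functions -/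

/-- `f` is a primitive of the locally integrable function `g`. -/
structure IsPrim (f g : ℝ → ℝ) : Prop where
  locInt : LocallyIntegrable g
  sub_eq : ∀ x y, f y - f x = ∫ t in x..y, g t

theorem _root_.MeasureTheory.LocallyIntegrable.intervalIntegrable' {g : ℝ → ℝ}
    (hg : LocallyIntegrable g) (x y : ℝ) : IntervalIntegrable g volume x y :=
  intervalIntegrable_iff.mpr <|
    (hg.integrableOn_isCompact isCompact_uIcc).mono_set Set.uIoc_subset_uIcc

namespace IsPrim

variable {f g f₁ g₁ : ℝ → ℝ}

theorem eq_add (h : IsPrim f g) (x y : ℝ) : f y = f x + ∫ t in x..y, g t := by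
  rw [← h.sub_eq]; ring

/-- Gives access to the product rule and integration by parts when the derivative exists only almost
everywhere. -/
theorem absolutelyContinuousOnInterval (h : IsPrim f g) (x y : ℝ) :
    AbsolutelyContinuousOnInterval f x y := by
  have h1 := (h.locInt.intervalIntegrable' x y).absolutelyContinuousOnInterval_intervalIntegral
    (c := x) (by simp)
  have h2 : AbsolutelyContinuousOnInterval (fun _ : ℝ => f x) x y :=
    (contDiff_const (n := 1)).contDiffOn.absolutelyContinuousOnInterval
  have h3 : f = (fun z => ∫ t in x..z, g t) + fun _ => f x := by
    ext z
    rw [h.eq_add x z, Pi.add_apply, add_comm]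
  rw [h3]
  simpa using h1.add h2

theorem continuous (h : IsPrim f g) : Continuous f := by
  have : f = fun y => f 0 + ∫ t in (0:ℝ)..y, g t := funext (h.eq_add 0)
  rw [this]
  exact continuous_const.add
    (intervalIntegral.continuous_primitive h.locInt.intervalIntegrable' 0)

theorem ae_hasDerivAt (h : IsPrim f g) : ∀ᵐ x, HasDerivAt f (g x) x := by
  filter_upwards [LocallyIntegrable.ae_hasDerivAt_integral h.locInt] with x hx
  have : f = fun y => f 0 + ∫ t in (0:ℝ)..y, g t := funext (h.eq_add 0)
  rw [this]
  exact (hx 0).const_add _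

theorem of_hasDerivAt (h : ∀ x, HasDerivAt f (g x) x) (hg : Continuous g) : IsPrim f g :=
  ⟨hg.locallyIntegrable, fun x y =>
    (intervalIntegral.integral_eq_sub_of_hasDerivAt (fun z _ => h z)
      (hg.intervalIntegrable x y)).symm⟩

theorem congr_deriv (h : IsPrim f g) (hg : g =ᵐ[volume] g₁) : IsPrim f g₁ :=
  ⟨h.locInt.congr hg, fun x y => by
    rw [h.sub_eq]; exact intervalIntegral.integral_congr_ae (by
      filter_upwards [hg] with t ht _ using ht)⟩

theorem mul (h : IsPrim f g) (h₁ : IsPrim f₁ g₁) :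
    IsPrim (fun x => f x * f₁ x) (fun x => g x * f₁ x + f x * g₁ x) := by
  constructor
  · exact (h.locInt.mul_continuous h₁.continuous).add
      (h₁.locInt.continuous_mul h.continuous) 
  · intro x y
    rw [← (h.absolutelyContinuousOnInterval x y).integral_deriv_mul_eq_sub
      (h₁.absolutelyContinuousOnInterval x y)]
    refine intervalIntegral.integral_congr_ae ?_
    filter_upwards [h.ae_hasDerivAt, h₁.ae_hasDerivAt] with t ht ht₁ _
    rw [ht.deriv, ht₁.deriv]

theorem add (h : IsPrim f g) (h₁ : IsPrim f₁ g₁) :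
    IsPrim (fun x => f x + f₁ x) (fun x => g x + g₁ x) :=
  ⟨h.locInt.add h₁.locInt, fun x y => by
    rw [intervalIntegral.integral_add (h.locInt.intervalIntegrable' x y)
      (h₁.locInt.intervalIntegrable' x y), ← h.sub_eq, ← h₁.sub_eq]; ring⟩

theorem sub (h : IsPrim f g) (h₁ : IsPrim f₁ g₁) :
    IsPrim (fun x => f x - f₁ x) (fun x => g x - g₁ x) :=
  ⟨h.locInt.sub h₁.locInt, fun x y => by
    rw [intervalIntegral.integral_sub (h.locInt.intervalIntegrable' x y)
      (h₁.locInt.intervalIntegrable' x y), ← h.sub_eq, ← h₁.sub_eq]; ring⟩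

theorem tendsto_atTop (h : IsPrim f g) (hf : Integrable f) (hg : Integrable g) :
    Filter.Tendsto f Filter.atTop (nhds 0) := by
  have h1 : Filter.Tendsto f Filter.atTop (nhds (f 0 + ∫ t in Set.Ioi (0:ℝ), g t)) := by
    have : f = fun y => f 0 + ∫ t in (0:ℝ)..y, g t := funext (h.eq_add 0)
    rw [this]
    simpa using (intervalIntegral_tendsto_integral_Ioi 0 hg.integrableOn
      Filter.tendsto_id).const_add (f 0)
  -- An integrable function that converges at infinity has limit 0, because every neighbourhood of
  -- infinity has infinite measure.
  have h2 := (IntegrableAtFilter.eq_zero_of_tendsto (l := Filter.atTop)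
    (hf.integrableAtFilter _) (fun s hs => ?_) h1)
  · rwa [h2] at h1
  · obtain ⟨a, ha⟩ := Filter.mem_atTop_sets.1 hs
    exact top_le_iff.1 ((Real.volume_Ici (a := a)).ge.trans (measure_mono ha))

theorem tendsto_atBot (h : IsPrim f g) (hf : Integrable f) (hg : Integrable g) :
    Filter.Tendsto f Filter.atBot (nhds 0) := by
  have h1 : Filter.Tendsto f Filter.atBot (nhds (f 0 - ∫ t in Set.Iic (0:ℝ), g t)) := by
    have : f = fun y => f 0 - ∫ t in y..(0:ℝ), g t := funext fun y => by
      rw [← h.sub_eq]; ring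
    rw [this]
    simpa using (intervalIntegral_tendsto_integral_Iic 0 hg.integrableOn
      Filter.tendsto_id).const_sub (f 0)
  have h2 := (IntegrableAtFilter.eq_zero_of_tendsto (l := Filter.atBot)
    (hf.integrableAtFilter _) (fun s hs => ?_) h1)
  · rwa [h2] at h1
  · obtain ⟨a, ha⟩ := Filter.mem_atBot_sets.1 hs
    exact top_le_iff.1 ((Real.volume_Iic (a := a)).ge.trans (measure_mono ha))

/-- Integrability of `f` and `g` makes the boundary terms vanish. This replaces compact support in
every later integration by parts over the line. -/
theorem integral_eq_zero (h : IsPrim f g) (hf : Integrable f) (hg : Integrable g) :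
    ∫ x, g x = 0 := by
  have h1 := intervalIntegral_tendsto_integral hg Filter.tendsto_neg_atTop_atBot Filter.tendsto_id
  have h2 : Filter.Tendsto (fun T : ℝ => f T - f (-T)) Filter.atTop (nhds (0 - 0)) :=
    (h.tendsto_atTop hf hg).sub ((h.tendsto_atBot hf hg).comp Filter.tendsto_neg_atTop_atBot)
  simp_rw [h.sub_eq] at h2
  rw [sub_zero] at h2
  exact tendsto_nhds_unique h1 h2

theorem abs_le_integral (h : IsPrim f g) (hf : Integrable f) (hg : Integrable g) (x : ℝ) :
    |f x| ≤ ∫ t, |g t| := by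
  have h1 := intervalIntegral_tendsto_integral_Ioi x hg.integrableOn Filter.tendsto_id
  have h2 := (h.tendsto_atTop hf hg).sub_const (f x)
  simp_rw [h.sub_eq x] at h2
  have h3 := tendsto_nhds_unique h1 h2
  have h4 : f x = -∫ t in Set.Ioi x, g t := by rw [h3]; ring
  rw [h4, abs_neg]
  exact abs_integral_le_integral_abs.trans
    (setIntegral_le_integral hg.abs (.of_forall fun _ => abs_nonneg _))

end IsPrim

theorem isPrim_const (c : ℝ) : IsPrim (fun _ => c) (fun _ => 0) :=
  .of_hasDerivAt (fun x => hasDerivAt_const x c) continuous_const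

theorem isPrim_primitive {g : ℝ → ℝ} (hg : LocallyIntegrable g) :
    IsPrim (fun x => ∫ t in (0:ℝ)..x, g t) g :=
  ⟨hg, fun x y => intervalIntegral.integral_interval_sub_left
    (hg.intervalIntegrable' 0 y) (hg.intervalIntegrable' 0 x)⟩

theorem isPrim_of_contDiff {φ : ℝ → ℝ} (hφ : ContDiff ℝ ∞ φ) : IsPrim φ (deriv φ) :=
  .of_hasDerivAt (fun x => ((hφ.differentiable (by simp)) x).hasDerivAt)
    (hφ.continuous_deriv (by simp))

/-- Integration by parts against a test function. -/
theorem IsPrim.integral_deriv_test_mul {f g φ : ℝ → ℝ} (h : IsPrim f g) (hφ : ContDiff ℝ ∞ φ)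
    (hc : HasCompactSupport φ) : ∫ x, deriv φ x * f x = -∫ x, φ x * g x := by
  have hp := (isPrim_of_contDiff hφ).mul h
  have hd : Continuous (deriv φ) := hφ.continuous_deriv (by simp)
  have i1 : Integrable fun x => deriv φ x * f x :=
    (hd.mul h.continuous).integrable_of_hasCompactSupport hc.deriv.mul_right
  have i2 : Integrable fun x => φ x * g x := by
    simpa only [smul_eq_mul] using
      h.locInt.integrable_smul_left_of_hasCompactSupport hφ.continuous hc
  have i3 : Integrable fun x => φ x * f x :=
    (hφ.continuous.mul h.continuous).integrable_of_hasCompactSupport hc.mul_right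
  have h0 := hp.integral_eq_zero i3 (i1.add i2)
  rw [integral_add i1 i2] at h0
  linarith

/-- A test function of zero mean is the derivative of a test function. -/
theorem exists_test_primitive {φ : ℝ → ℝ} (hφ : ContDiff ℝ ∞ φ) (hc : HasCompactSupport φ)
    (h0 : ∫ x, φ x = 0) :
    ∃ ψ : ℝ → ℝ, ContDiff ℝ ∞ ψ ∧ HasCompactSupport ψ ∧ deriv ψ = φ := by
  obtain ⟨K, hK⟩ : ∃ K : ℝ, ∀ x, K ≤ |x| → φ x = 0 := by
    obtain ⟨K, hK⟩ := hc.isCompact.isBounded.exists_norm_le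
    refine ⟨K + 1, fun x hx => ?_⟩
    by_contra hne
    have := hK x (subset_tsupport _ hne)
    rw [Real.norm_eq_abs] at this
    linarith
  have hd : ∀ x, HasDerivAt (fun x => ∫ t in (-K)..x, φ t) (φ x) x := fun x =>
    intervalIntegral.integral_hasDerivAt_right (hφ.continuous.intervalIntegrable _ _)
      (hφ.continuous.stronglyMeasurableAtFilter _ _) hφ.continuous.continuousAt
  have hde : deriv (fun x => ∫ t in (-K)..x, φ t) = φ := funext fun x => (hd x).deriv
  refine ⟨fun x => ∫ t in (-K)..x, φ t, ?_, ?_, hde⟩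
  · rw [contDiff_infty_iff_deriv]
    rw [hde]
    exact ⟨fun x => (hd x).differentiableAt, hφ⟩
  · have hi : Integrable φ := hφ.continuous.integrable_of_hasCompactSupport hc
    -- `K` may be negative when `φ` has empty support, hence the absolute values. To the right of
    -- the support the primitive equals the full integral, which is 0.
    refine HasCompactSupport.of_support_subset_isCompact (isCompact_Icc (a := -|K|) (b := |K|)) ?_
    intro x hx
    by_contra hne
    rw [Set.mem_Icc, not_and_or, not_le, not_le] at hne
    refine hx ?_
    rcases hne with hlt | hlt
    · refine intervalIntegral.integral_zero_ae (.of_forall fun t ht => hK t ?_)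
      have h1 : t ≤ -K := by
        rcases Set.mem_uIoc.1 ht with ⟨_, h⟩ | ⟨_, h⟩
        · have := neg_abs_le K
          have := le_abs_self K
          linarith
        · exact h
      have := neg_le_abs t
      linarith
    · have h1 : ∫ t in Set.Iic (-K), φ t = 0 := by
        refine setIntegral_eq_zero_of_forall_eq_zero fun t ht => hK t ?_
        have := neg_le_abs t
        have := Set.mem_Iic.1 ht
        linarith
      have h2 : ∫ t in Set.Ioi x, φ t = 0 := by
        refine setIntegral_eq_zero_of_forall_eq_zero fun t ht => hK t ?_
        have := le_abs_self t
        have := Set.mem_Ioi.1 ht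
        have := le_abs_self K
        linarith
      have h3 := intervalIntegral.integral_Iic_sub_Iic hi.integrableOn hi.integrableOn
        (a := -K) (b := x)
      have h4 := intervalIntegral.integral_Iic_add_Ioi (b := x) hi.integrableOn hi.integrableOn
      linarith

/-- A function with a weak derivative agrees almost everywhere with a primitive of it. -/
theorem exists_isPrim_of_weak {f g : ℝ → ℝ} (hf : LocallyIntegrable f) (hg : LocallyIntegrable g)
    (h : ∀ φ : ℝ → ℝ, ContDiff ℝ ∞ φ → HasCompactSupport φ →
      ∫ x, deriv φ x * f x = -∫ x, φ x * g x) :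
    ∃ F, IsPrim F g ∧ f =ᵐ[volume] F := by
  set G : ℝ → ℝ := fun x => ∫ t in (0:ℝ)..x, g t with hG
  have hGp : IsPrim G g := isPrim_primitive hg
  have hD : LocallyIntegrable (fun x => f x - G x) := hf.sub hGp.continuous.locallyIntegrable
  have hint : ∀ {φ u : ℝ → ℝ}, Continuous φ → HasCompactSupport φ → LocallyIntegrable u →
      Integrable fun x => φ x * u x := fun h1 h2 h3 => by
    simpa only [smul_eq_mul] using h3.integrable_smul_left_of_hasCompactSupport h1 h2
  have hD0 : ∀ φ : ℝ → ℝ, ContDiff ℝ ∞ φ → HasCompactSupport φ →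
      ∫ x, deriv φ x * (f x - G x) = 0 := fun φ h1 h2 => by
    have hd : Continuous (deriv φ) := h1.continuous_deriv (by simp)
    simp_rw [mul_sub]
    rw [integral_sub (hint hd h2.deriv hf)
      (hint hd h2.deriv hGp.continuous.locallyIntegrable), h φ h1 h2,
      hGp.integral_deriv_test_mul h1 h2, sub_self]
  -- `f - G` has zero weak derivative. Subtracting from a test function its mean times a normalized
  -- bump leaves a derivative of a test function, so `f - G` is a.e. the constant `c`, its average
  -- against the bump.
  let b : ContDiffBump (0 : ℝ) := ⟨1, 2, one_pos, one_lt_two⟩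
  have hb1 : ContDiff ℝ ∞ (b.normed volume) := b.contDiff_normed
  have hb2 : HasCompactSupport (b.normed volume) := b.hasCompactSupport_normed
  have hb3 : ∫ x, b.normed volume x = 1 := b.integral_normed
  set c := ∫ x, b.normed volume x * (f x - G x) with hc
  have key : ∀ᵐ x, f x - G x - c = 0 := by
    refine ae_eq_zero_of_integral_contDiff_smul_eq_zero
      (hD.sub (continuous_const (y := c)).locallyIntegrable) fun φ h1 h2 => ?_
    set m := ∫ x, φ x with hm
    have e1 : ContDiff ℝ ∞ fun x => φ x - m * b.normed volume x := h1.sub (contDiff_const.mul hb1)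
    have e2 : HasCompactSupport fun x => φ x - m * b.normed volume x :=
      h2.sub (hb2.mul_left)
    have i1 := h1.continuous.integrable_of_hasCompactSupport (μ := volume) h2
    have i2 := hb1.continuous.integrable_of_hasCompactSupport (μ := volume) hb2
    obtain ⟨ψ, p1, p2, p3⟩ := exists_test_primitive e1 e2 (by
      rw [integral_sub i1 (i2.const_mul m), integral_const_mul, hb3, ← hm, mul_one, sub_self])
    have h3 := hD0 ψ p1 p2
    rw [p3] at h3
    have j1 := hint h1.continuous h2 hD
    have j2 := hint hb1.continuous hb2 hD
    have h4 : ∫ x, φ x * (f x - G x) = m * c := by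
      have : ∀ x, (φ x - m * b.normed volume x) * (f x - G x) =
          φ x * (f x - G x) - m * (b.normed volume x * (f x - G x)) := fun x => by ring
      simp_rw [this] at h3
      rw [integral_sub j1 (j2.const_mul m), integral_const_mul] at h3
      linarith
    simp only [smul_eq_mul]
    have : ∀ x, φ x * (f x - G x - c) = φ x * (f x - G x) - φ x * c := fun x => by ring
    simp_rw [this]
    rw [integral_sub j1 (i1.mul_const c), integral_mul_const, h4, sub_self]
  refine ⟨fun x => G x + c, ?_, ?_⟩
  · simpa using hGp.add (isPrim_const c)
  · filter_upwards [key] with x hx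
    linarith

/-! ### The Fourier transform on `L²(ℝ)` -/

theorem continuous_integral_mul {g : ℝ → ℂ} (hg : MemLp g 2) :
    Continuous fun f : ComplexL2 => ∫ x, g x * f x := by
  have h : (fun f : ComplexL2 => ∫ x, g x * f x) = fun f => inner ℂ (star (hg.toLp g)) f := by
    funext f
    rw [L2.inner_def]
    refine integral_congr_ae ?_
    filter_upwards [hg.coeFn_toLp, Lp.coeFn_star (hg.toLp g)] with x h1 h2
    rw [h2, Pi.star_apply, h1]
    simp [mul_comm]
  rw [h]
  exact continuous_const.inner continuous_id

theorem integrable_mulC {f g : ℝ → ℂ} (hf : MemLp f 2) (hg : MemLp g 2) :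
    Integrable fun x => f x * g x := hf.integrable_mul hg

theorem Lp_ext_of_integral {f g : ComplexL2} (h : ∀ k : ComplexL2, ∫ x, k x * f x = ∫ x, k x * g x) :
    f = g := by
  refine ext_inner_left ℂ fun v => ?_
  have e : ∀ w : ComplexL2, inner ℂ v w = ∫ x, (star v : ComplexL2) x * w x := fun w => by
    rw [L2.inner_def]
    refine integral_congr_ae ?_
    filter_upwards [Lp.coeFn_star v] with x h2
    rw [h2, Pi.star_apply]
    simp [mul_comm]
  rw [e, e, h]

theorem integral_fourierInv_mul_schwartz (f : ComplexL2) (ψ : SchwartzMap ℝ ℂ) :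
    ∫ x, ψ x * (𝓕⁻ f : ComplexL2) x = ∫ x, (𝓕⁻ ψ) x * f x := by
  have h := Lp.fourierInv_toTemperedDistribution_eq f
  have h2 := congrArg (fun T => T ψ) h
  simp only [TemperedDistribution.fourierInv_apply, Lp.toTemperedDistribution_apply,
    smul_eq_mul] at h2
  exact h2.symm

/-- Extends the bilinear self-adjointness of `𝓕⁻` from Schwartz functions by density and L²
continuity. The pairing carries no conjugate. -/
theorem integral_fourierInv_mul (f g : ComplexL2) :
    ∫ x, (𝓕⁻ f : ComplexL2) x * g x = ∫ x, f x * (𝓕⁻ g : ComplexL2) x := by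
  refine DenseRange.induction_on
    (p := fun g : ComplexL2 => ∫ x, (𝓕⁻ f : ComplexL2) x * g x = ∫ x, f x * (𝓕⁻ g : ComplexL2) x)
    (SchwartzMap.denseRange_toLpCLM (p := 2) ENNReal.ofNat_ne_top) g ?_ ?_
  · exact isClosed_eq (continuous_integral_mul (Lp.memLp _))
      ((continuous_integral_mul (Lp.memLp f)).comp
        (Lp.fourierTransformₗᵢ ℝ ℂ).symm.continuous)
  · intro ψ
    have h := integral_fourierInv_mul_schwartz f ψ
    simp only [SchwartzMap.toLpCLM_apply, SchwartzMap.toLp_fourierInv_eq]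
    calc ∫ x, (𝓕⁻ f : ComplexL2) x * (ψ.toLp 2 : ComplexL2) x = ∫ x, ψ x * (𝓕⁻ f : ComplexL2) x := by
          refine integral_congr_ae ?_
          filter_upwards [ψ.coeFn_toLp 2 volume] with x hx
          rw [hx, mul_comm]
      _ = ∫ x, (𝓕⁻ ψ) x * f x := h
      _ = ∫ x, f x * ((𝓕⁻ ψ : SchwartzMap ℝ ℂ).toLp 2 : ComplexL2) x := by
          refine integral_congr_ae ?_
          filter_upwards [(𝓕⁻ ψ).coeFn_toLp 2 volume] with x hx
          rw [hx, mul_comm]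

theorem measurePreserving_neg : MeasurePreserving (fun x : ℝ => -x) volume volume :=
  Measure.measurePreserving_neg volume

/-- Two inverse transforms reflect the variable. This is Fourier inversion on Schwartz functions,
carried to L² by density. -/
theorem fourierInv_fourierInv (f : ComplexL2) :
    (𝓕⁻ (𝓕⁻ f : ComplexL2) : ComplexL2) = Lp.compMeasurePreserving _ measurePreserving_neg f := by
  refine DenseRange.induction_on
    (p := fun f : ComplexL2 => (𝓕⁻ (𝓕⁻ f : ComplexL2) : ComplexL2) =
      Lp.compMeasurePreserving _ measurePreserving_neg f)
    (SchwartzMap.denseRange_toLpCLM (p := 2) ENNReal.ofNat_ne_top) f ?_ ?_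
  · have hc := (Lp.fourierTransformₗᵢ ℝ ℂ).symm.continuous
    exact isClosed_eq (hc.comp hc) (Lp.isometry_compMeasurePreserving _).continuous
  · intro ψ
    simp only [SchwartzMap.toLpCLM_apply, SchwartzMap.toLp_fourierInv_eq]
    refine Lp.ext ?_
    have h2 := measurePreserving_neg.quasiMeasurePreserving.ae_eq_comp (ψ.coeFn_toLp 2 volume)
    filter_upwards [(𝓕⁻ (𝓕⁻ ψ)).coeFn_toLp 2 volume,
      Lp.coeFn_compMeasurePreserving (ψ.toLp 2 : ComplexL2) measurePreserving_neg, h2] with x h1 h3 h4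
    rw [h1, h3, h4, SchwartzMap.fourierInv_coe, Real.fourierInv_eq_fourier_neg,
      ← SchwartzMap.fourier_coe, FourierTransform.fourier_fourierInv_eq]
    rfl

theorem integral_fourierInv_mul_fourierInv (f g : ComplexL2) :
    ∫ x, (𝓕⁻ f : ComplexL2) x * (𝓕⁻ g : ComplexL2) x = ∫ x, f x * g (-x) := by
  rw [integral_fourierInv_mul, fourierInv_fourierInv]
  refine integral_congr_ae ?_
  filter_upwards [Lp.coeFn_compMeasurePreserving g measurePreserving_neg] with x hx
  rw [hx]
  rfl

/-- On `L¹ ∩ L²` the inverse Fourier transform of `L²` is given by the integral. -/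
theorem fourierInv_toLp_ae {φ : ℝ → ℂ} (h1 : Integrable φ) (h2 : MemLp φ 2) :
    ((𝓕⁻ (h2.toLp φ) : ComplexL2) : ℝ → ℂ) =ᵐ[volume] 𝓕⁻ φ := by
  have hcont : Continuous (𝓕⁻ φ) := by
    have h3 := (Real.Lp.fourierTransformInv (memLp_one_iff_integrable.2 h1).toLp).continuous
    rwa [Real.Lp.fourierTransformInv_toLp] at h3
  refine ae_eq_of_integral_contDiff_smul_eq
    ((Lp.memLp _).locallyIntegrable (by norm_num)) hcont.locallyIntegrable fun g hg hgc => ?_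
  have hc1 : HasCompactSupport (Complex.ofRealCLM ∘ g) := hgc.comp_left rfl
  have hc2 : ContDiff ℝ ∞ (Complex.ofRealCLM ∘ g) := by fun_prop
  set ψ : SchwartzMap ℝ ℂ := hc1.toSchwartzMap hc2 with hψ
  have hψg : ∀ x, ψ x = (g x : ℂ) := fun x => rfl
  have e1 := integral_fourierInv_mul_schwartz (h2.toLp φ) ψ
  have e2 : ∫ x, (𝓕⁻ ψ) x * (h2.toLp φ) x = ∫ x, 𝓕⁻ (ψ : ℝ → ℂ) x * φ x := by
    refine integral_congr_ae ?_
    filter_upwards [h2.coeFn_toLp] with x hx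
    rw [hx, SchwartzMap.fourierInv_coe]
  have hneg : Integrable fun x => φ (-x) := h1.comp_neg
  -- Fubini in the form that moves a Fourier integral across a product; the reflection x ↦ -x turns
  -- `𝓕⁻` into `𝓕`.
  have e3 : ∫ x, 𝓕⁻ (ψ : ℝ → ℂ) x * φ x = ∫ x, ψ x * 𝓕⁻ φ x := by
    rw [← integral_neg_eq_self]
    have := VectorFourier.integral_fourierIntegral_smul_eq_flip (V := ℝ) (W := ℝ) (μ := volume)
      (ν := volume) (L := innerₗ ℝ) Real.continuous_fourierChar continuous_inner ψ.integrable hneg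
    simp only [smul_eq_mul, flip_innerₗ] at this
    rw [Real.fourierInv_eq_fourier_comp_neg φ]
    simp_rw [Real.fourierInv_eq_fourier_neg, neg_neg]
    exact this
  simp only [Complex.real_smul]
  simp_rw [hψg] at e1 e3
  rw [e1, e2, e3]

/-! ### The Hilbert transform on `L²(ℝ)` -/

/-- Multiplication by the symbol of the Hilbert transform. -/
noncomputable def symbolMul (F : ComplexL2) : ComplexL2 := (memLp_hilbertSymbol_mul F).toLp _

theorem coeFn_symbolMul (F : ComplexL2) :
    symbolMul F =ᵐ[volume] fun ξ => hilbertSymbol ξ * F ξ := MemLp.coeFn_toLp _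

/-- The Hilbert transform as an operator on `L²`. -/
noncomputable def hilbertLp (f : ComplexL2) : ComplexL2 := 𝓕⁻ (symbolMul (𝓕 f))

theorem hilbert_eq {f : ℝ → ℂ} (h : MemLp f 2) : hilbert f = hilbertLp (h.toLp f) := by
  rw [hilbert, dif_pos h]
  rfl

theorem symbolMul_add (F G : ComplexL2) : symbolMul (F + G) = symbolMul F + symbolMul G := by
  refine Lp.ext ?_
  filter_upwards [coeFn_symbolMul (F + G), coeFn_symbolMul F, coeFn_symbolMul G,
    Lp.coeFn_add F G, Lp.coeFn_add (symbolMul F) (symbolMul G)] with x h1 h2 h3 h4 h5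
  rw [h1, h5, Pi.add_apply, h2, h3, h4, Pi.add_apply, mul_add]

theorem symbolMul_smul (c : ℂ) (F : ComplexL2) : symbolMul (c • F) = c • symbolMul F := by
  refine Lp.ext ?_
  filter_upwards [coeFn_symbolMul (c • F), coeFn_symbolMul F,
    Lp.coeFn_smul c F, Lp.coeFn_smul c (symbolMul F)] with x h1 h2 h4 h5
  rw [h1, h5, Pi.smul_apply, h2, h4, Pi.smul_apply, smul_eq_mul, smul_eq_mul]
  ring

theorem norm_symbolMul_le (F : ComplexL2) : ‖symbolMul F‖ ≤ ‖F‖ := by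
  refine Lp.norm_le_norm_of_ae_le ?_
  filter_upwards [coeFn_symbolMul F] with x h
  rw [h, norm_mul]
  exact mul_le_of_le_one_left (norm_nonneg _) (norm_hilbertSymbol_le x)

/-- The Hilbert transform as a continuous linear map on `L²`. -/
noncomputable def hilbertCLM : ComplexL2 →L[ℂ] ComplexL2 :=
  LinearMap.mkContinuous
    { toFun := hilbertLp
      map_add' := fun f g => by
        change (Lp.fourierTransformₗᵢ ℝ ℂ).symm (symbolMul (Lp.fourierTransformₗᵢ ℝ ℂ (f + g))) = _
        rw [map_add, symbolMul_add, map_add]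
        rfl
      map_smul' := fun c f => by
        change (Lp.fourierTransformₗᵢ ℝ ℂ).symm (symbolMul (Lp.fourierTransformₗᵢ ℝ ℂ (c • f))) = _
        rw [map_smul, symbolMul_smul, map_smul]
        rfl }
    1 fun f => by
      change ‖(Lp.fourierTransformₗᵢ ℝ ℂ).symm (symbolMul (Lp.fourierTransformₗᵢ ℝ ℂ f))‖ ≤ _
      rw [LinearIsometryEquiv.norm_map, one_mul]
      exact (norm_symbolMul_le _).trans_eq ((Lp.fourierTransformₗᵢ ℝ ℂ).norm_map f)

theorem hilbertCLM_apply (f : ComplexL2) : hilbertCLM f = hilbertLp f := rfl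

theorem hilbertCLM_fourierInv (A : ComplexL2) : hilbertCLM (𝓕⁻ A) = 𝓕⁻ (symbolMul A) := by
  rw [hilbertCLM_apply, hilbertLp, FourierTransform.fourier_fourierInv_eq]

theorem hilbertSymbol_neg (ξ : ℝ) : hilbertSymbol (-ξ) = -hilbertSymbol ξ := by
  simp [hilbertSymbol, Real.sign_neg]

theorem hilbertSymbol_pos {ξ : ℝ} (h : 0 < ξ) : hilbertSymbol ξ = -Complex.I := by
  simp [hilbertSymbol, Real.sign_of_pos h]

theorem hilbertSymbol_of_neg {ξ : ℝ} (h : ξ < 0) : hilbertSymbol ξ = Complex.I := by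
  simp [hilbertSymbol, Real.sign_of_neg h]

theorem hilbertSymbol_sq {ξ : ℝ} (h : ξ ≠ 0) : hilbertSymbol ξ * hilbertSymbol ξ = -1 := by
  rcases lt_or_gt_of_ne h with h | h
  · rw [hilbertSymbol_of_neg h, Complex.I_mul_I]
  · rw [hilbertSymbol_pos h, neg_mul_neg, Complex.I_mul_I]

theorem conj_hilbertSymbol (ξ : ℝ) : starRingEnd ℂ (hilbertSymbol ξ) = -hilbertSymbol ξ := by
  simp [hilbertSymbol]

theorem ae_ne_zero : ∀ᵐ x : ℝ, x ≠ 0 := by simp [ae_iff, measure_singleton]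

theorem hilbertCLM_hilbertCLM (f : ComplexL2) : hilbertCLM (hilbertCLM f) = -f := by
  obtain ⟨A, rfl⟩ : ∃ A : ComplexL2, 𝓕⁻ A = f := ⟨𝓕 f, FourierTransform.fourierInv_fourier_eq f⟩
  rw [hilbertCLM_fourierInv, hilbertCLM_fourierInv]
  -- The symbol vanishes at frequency 0, so its square is -1 only almost everywhere.
  have : symbolMul (symbolMul A) = -A := by
    refine Lp.ext ?_
    filter_upwards [coeFn_symbolMul (symbolMul A), coeFn_symbolMul A, Lp.coeFn_neg A,
      ae_ne_zero] with x h1 h2 h3 h4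
    rw [h1, h2, h3, Pi.neg_apply, ← mul_assoc, hilbertSymbol_sq h4, neg_one_mul]
  rw [this]
  exact map_neg (Lp.fourierTransformₗᵢ ℝ ℂ).symm A

/-- The bilinear pairing becomes ∫ A(ξ)B(-ξ) in frequency, and the symbol is odd. -/
theorem integral_mul_hilbertCLM (f g : ComplexL2) :
    ∫ x, f x * hilbertCLM g x = -∫ x, hilbertCLM f x * g x := by
  obtain ⟨A, rfl⟩ : ∃ A : ComplexL2, 𝓕⁻ A = f := ⟨𝓕 f, FourierTransform.fourierInv_fourier_eq f⟩
  obtain ⟨B, rfl⟩ : ∃ B : ComplexL2, 𝓕⁻ B = g := ⟨𝓕 g, FourierTransform.fourierInv_fourier_eq g⟩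
  rw [hilbertCLM_fourierInv, hilbertCLM_fourierInv, integral_fourierInv_mul_fourierInv,
    integral_fourierInv_mul_fourierInv, ← integral_neg]
  refine integral_congr_ae ?_
  have h2 := measurePreserving_neg.quasiMeasurePreserving.ae_eq_comp (coeFn_symbolMul B)
  filter_upwards [coeFn_symbolMul A, h2] with x h1 h3
  simp only [Function.comp_apply] at h3
  rw [h1, h3, hilbertSymbol_neg]
  ring

theorem inner_hilbertCLM (f g : ComplexL2) :
    inner ℂ (hilbertCLM f) g = -inner ℂ f (hilbertCLM g) := by
  obtain ⟨A, rfl⟩ : ∃ A : ComplexL2, 𝓕⁻ A = f := ⟨𝓕 f, FourierTransform.fourierInv_fourier_eq f⟩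
  obtain ⟨B, rfl⟩ : ∃ B : ComplexL2, 𝓕⁻ B = g := ⟨𝓕 g, FourierTransform.fourierInv_fourier_eq g⟩
  rw [hilbertCLM_fourierInv, hilbertCLM_fourierInv]
  have e : ∀ X Y : ComplexL2, inner ℂ (𝓕⁻ X : ComplexL2) (𝓕⁻ Y : ComplexL2) = inner ℂ X Y :=
    (Lp.fourierTransformₗᵢ ℝ ℂ).symm.inner_map_map
  rw [e, e, L2.inner_def, L2.inner_def, ← integral_neg]
  refine integral_congr_ae ?_
  filter_upwards [coeFn_symbolMul A, coeFn_symbolMul B] with x h1 h3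
  rw [h1, h3]
  simp only [RCLike.inner_apply, map_mul, conj_hilbertSymbol]
  ring

/-- Antisymmetry holds for the bilinear and for the Hermitian pairing; comparing the two forces
commutation with conjugation. Hence real functions have real Hilbert transforms. -/
theorem hilbertCLM_star (f : ComplexL2) : hilbertCLM (star f) = star (hilbertCLM f) := by
  have e : ∀ u w : ComplexL2, inner ℂ u w = ∫ x, (star u : ComplexL2) x * w x := fun u w => by
    rw [L2.inner_def]
    refine integral_congr_ae ?_
    filter_upwards [Lp.coeFn_star u] with x h2
    rw [h2, Pi.star_apply]
    simp [mul_comm]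
  refine Lp_ext_of_integral fun k => ?_
  have h1 := inner_hilbertCLM f k
  rw [e, e, integral_mul_hilbertCLM, neg_neg] at h1
  simp_rw [mul_comm (k _)]
  exact h1.symm

/-! ### The Cauchy kernel -/

/-- The Cauchy kernel `1 / (x + i)`. -/
noncomputable def cauchy (x : ℝ) : ℂ := ((x : ℂ) + Complex.I)⁻¹

/-- One-sided exponential, supported on the positive half-line. -/
noncomputable def expTail (t : ℝ) : ℝ := (Set.Ioi (0 : ℝ)).indicator (fun t => Real.exp (-(2 * Real.pi) * t)) t

/-- The Fourier transform of the Cauchy kernel. -/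
noncomputable def cauchyFT (t : ℝ) : ℂ := -(2 * Real.pi * Complex.I) * (expTail t : ℂ)

theorem measurable_expTail : Measurable expTail :=
  (by fun_prop : Measurable fun t => Real.exp (-(2 * Real.pi) * t)).indicator measurableSet_Ioi

theorem expTail_nonneg (t : ℝ) : 0 ≤ expTail t :=
  Set.indicator_nonneg (fun _ _ => (Real.exp_pos _).le) _

theorem expTail_le_one (t : ℝ) : expTail t ≤ 1 := by
  unfold expTail
  rw [Set.indicator_apply]
  split_ifs with h
  · rw [Real.exp_le_one_iff]
    have := Real.pi_pos
    have : 0 < t := h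
    nlinarith [mul_pos Real.pi_pos this]
  · exact zero_le_one

theorem integrable_expTail : Integrable expTail := by
  have h := integrableOn_exp_mul_Ioi (a := -(2 * Real.pi)) (by linarith [Real.pi_pos]) 0
  exact (integrable_indicator_iff measurableSet_Ioi).2 h

theorem measurable_cauchyFT : Measurable cauchyFT :=
  measurable_const.mul (Complex.measurable_ofReal.comp measurable_expTail)

theorem integrable_cauchyFT : Integrable cauchyFT := integrable_expTail.ofReal.const_mul _

theorem norm_cauchyFT_le (t : ℝ) : ‖cauchyFT t‖ ≤ 2 * Real.pi := by
  rw [cauchyFT, norm_mul]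
  simp only [norm_neg, norm_mul, Complex.norm_I, Complex.norm_real, Real.norm_eq_abs,
    Complex.norm_ofNat, mul_one, abs_of_pos Real.pi_pos, abs_of_nonneg (expTail_nonneg t)]
  exact mul_le_of_le_one_right (by positivity) (expTail_le_one t)

theorem memLp_two_of_bdd {f : ℝ → ℂ} {C : ℝ} (hf : Integrable f) (hb : ∀ x, ‖f x‖ ≤ C) :
    MemLp f 2 := by
  rw [memLp_two_iff_integrable_sq_norm hf.1]
  refine (hf.norm.const_mul C).mono' (hf.1.norm.pow 2) (.of_forall fun x => ?_)
  rw [Real.norm_of_nonneg (sq_nonneg _), sq]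
  exact mul_le_mul_of_nonneg_right (hb x) (norm_nonneg _)

theorem memLp_cauchyFT : MemLp cauchyFT 2 := memLp_two_of_bdd integrable_cauchyFT norm_cauchyFT_le

theorem add_I_ne_zero (x : ℝ) : (x : ℂ) + Complex.I ≠ 0 := fun h => by
  have := congrArg Complex.im h
  simp at this

theorem fourierInv_cauchyFT (x : ℝ) : 𝓕⁻ cauchyFT x = cauchy x := by
  rw [Real.fourierInv_eq']
  have e : ∀ v : ℝ, Complex.exp (((2 * Real.pi * inner ℝ v x : ℝ) : ℂ) * Complex.I) • cauchyFT v =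
      (Set.Ioi (0:ℝ)).indicator (fun v : ℝ => -(2 * Real.pi * Complex.I) *
        Complex.exp ((2 * Real.pi * (Complex.I * x - 1)) * v)) v := fun v => by
    unfold cauchyFT expTail
    by_cases hv : v ∈ Set.Ioi (0:ℝ)
    · rw [Set.indicator_of_mem hv, Set.indicator_of_mem hv, smul_eq_mul, Complex.ofReal_exp,
        mul_left_comm, ← Complex.exp_add]
      congr 2
      simp only [RCLike.inner_apply, conj_trivial]
      push_cast
      ring
    · rw [Set.indicator_of_notMem hv, Set.indicator_of_notMem hv]
      simp
  simp_rw [e]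
  have hpi : (Real.pi : ℂ) ≠ 0 := by exact_mod_cast Real.pi_ne_zero
  have hne := add_I_ne_zero x
  have hne2 : Complex.I * x - 1 ≠ 0 := by
    have : Complex.I * x - 1 = Complex.I * (x + Complex.I) := by
      rw [mul_add, Complex.I_mul_I]; ring
    rw [this]
    exact mul_ne_zero Complex.I_ne_zero hne
  rw [integral_indicator measurableSet_Ioi, integral_const_mul,
    integral_exp_mul_complex_Ioi (by simp [Real.pi_pos])]
  simp only [Complex.ofReal_zero, mul_zero, Complex.exp_zero, cauchy]
  field_simp
  linear_combination Complex.I_sq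

theorem norm_cauchy (x : ℝ) : ‖cauchy x‖ = wt x := by
  rw [cauchy, norm_inv, wt]
  congr 1
  rw [Complex.norm_eq_sqrt_sq_add_sq]
  congr 1
  simp
  ring

theorem cauchy_eq (x : ℝ) : cauchy x = cpk x - pk x * Complex.I := by
  have h : (1 + (x : ℂ) ^ 2) ≠ 0 := by
    have : (0:ℝ) < 1 + x ^ 2 := by positivity
    exact_mod_cast this.ne'
  have h2 : ((x : ℂ) + Complex.I) * (x - Complex.I) = 1 + (x : ℂ) ^ 2 := by
    linear_combination (-1 : ℂ) * Complex.I_sq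
  rw [cauchy, cpk, pk]
  refine inv_eq_of_mul_eq_one_right ?_
  push_cast
  field_simp
  linear_combination h2

theorem continuous_cauchy : Continuous cauchy :=
  Continuous.inv₀ (by fun_prop) add_I_ne_zero

theorem memLp_cauchy : MemLp cauchy 2 :=
  memLp_wt.of_le_mul (c := 1) continuous_cauchy.aestronglyMeasurable <| .of_forall fun x => by
    rw [norm_cauchy, Real.norm_of_nonneg (wt_pos x).le, one_mul]

theorem memLp_cauchy_mul {f : ℝ → ℂ} (hf : MemLp f 2) : MemLp (fun x => cauchy x * f x) 2 :=
  hf.of_le_mul (c := 1) (continuous_cauchy.aestronglyMeasurable.mul hf.1) <|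
    .of_forall fun x => by
      rw [norm_mul, norm_cauchy]
      exact mul_le_mul_of_nonneg_right (wt_le_one x) (norm_nonneg _)

theorem fourierInv_cauchyFT_ae :
    ((𝓕⁻ (memLp_cauchyFT.toLp _) : ComplexL2) : ℝ → ℂ) =ᵐ[volume] cauchy := by
  filter_upwards [fourierInv_toLp_ae integrable_cauchyFT memLp_cauchyFT] with x hx
  rw [hx, fourierInv_cauchyFT]

/-- 1/(x+i) contains only positive frequencies, where the symbol is -i. -/
theorem symbolMul_cauchyFT :
    symbolMul (memLp_cauchyFT.toLp _) = (-Complex.I) • memLp_cauchyFT.toLp _ := by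
  refine Lp.ext ?_
  filter_upwards [coeFn_symbolMul (memLp_cauchyFT.toLp _), memLp_cauchyFT.coeFn_toLp,
    Lp.coeFn_smul (-Complex.I) (memLp_cauchyFT.toLp cauchyFT)] with x h1 h2 h3
  rw [h1, h3, Pi.smul_apply, h2, smul_eq_mul]
  by_cases hx : x ∈ Set.Ioi (0:ℝ)
  · rw [hilbertSymbol_pos hx]
  · simp [cauchyFT, expTail, Set.indicator_of_notMem hx]

theorem hilbertCLM_cauchy :
    hilbertCLM (memLp_cauchy.toLp _) = (-Complex.I) • memLp_cauchy.toLp _ := by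
  have h : memLp_cauchy.toLp cauchy = 𝓕⁻ (memLp_cauchyFT.toLp cauchyFT) := by
    refine Lp.ext ?_
    filter_upwards [memLp_cauchy.coeFn_toLp, fourierInv_cauchyFT_ae] with x h1 h2
    rw [h1, h2]
  rw [h, hilbertCLM_fourierInv, symbolMul_cauchyFT]
  exact (Lp.fourierTransformₗᵢ ℝ ℂ).symm.map_smul _ _

/-- Multiplication by the Cauchy kernel is convolution on the Fourier side. -/
theorem integral_cauchy_mul_fourierInv {φ ψ : ℝ → ℂ} (h1 : Integrable φ) (h2 : MemLp φ 2)
    (h3 : MemLp ψ 2) :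
    ∫ x, cauchy x * (𝓕⁻ (h2.toLp φ) : ComplexL2) x * (𝓕⁻ (h3.toLp ψ) : ComplexL2) x =
      ∫ ξ, (∫ t, φ t * cauchyFT (ξ - t)) * ψ (-ξ) := by
  set c : ℝ → ℂ := convolution φ cauchyFT (ContinuousLinearMap.mul ℂ ℂ) volume with hc
  have hcx : ∀ ξ, c ξ = ∫ t, φ t * cauchyFT (ξ - t) := fun ξ => rfl
  have c1 : Integrable c := h1.integrable_convolution _ integrable_cauchyFT
  have c2 : MemLp c 2 := by
    refine memLp_two_of_bdd (C := (∫ t, ‖φ t‖) * (2 * Real.pi)) c1 fun ξ => ?_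
    rw [hcx, ← integral_mul_const]
    refine norm_integral_le_of_norm_le (h1.norm.mul_const _) (.of_forall fun t => ?_)
    rw [norm_mul]
    exact mul_le_mul_of_nonneg_left (norm_cauchyFT_le _) (norm_nonneg _)
  have e : ((𝓕⁻ (c2.toLp c) : ComplexL2) : ℝ → ℂ) =ᵐ[volume]
      fun x => cauchy x * (𝓕⁻ (h2.toLp φ) : ComplexL2) x := by
    filter_upwards [fourierInv_toLp_ae c1 c2, fourierInv_toLp_ae h1 h2] with x e1 e2
    rw [e1, e2, Real.fourierInv_eq_fourier_neg, hc,
      Real.fourier_mul_convolution_eq h1 integrable_cauchyFT, ← Real.fourierInv_eq_fourier_neg,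
      ← Real.fourierInv_eq_fourier_neg, fourierInv_cauchyFT, mul_comm]
  have h4 := integral_fourierInv_mul_fourierInv (c2.toLp c) (h3.toLp ψ)
  calc _ = ∫ x, (𝓕⁻ (c2.toLp c) : ComplexL2) x * (𝓕⁻ (h3.toLp ψ) : ComplexL2) x := by
        refine integral_congr_ae ?_
        filter_upwards [e] with x hx
        rw [hx]
    _ = ∫ ξ, (c2.toLp c) ξ * (h3.toLp ψ) (-ξ) := h4
    _ = _ := by
        refine integral_congr_ae ?_
        have h5 := measurePreserving_neg.quasiMeasurePreserving.ae_eq_comp h3.coeFn_toLp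
        filter_upwards [c2.coeFn_toLp, h5] with ξ e1 e2
        simp only [Function.comp_apply] at e2
        rw [e1, e2, hcx]

theorem integral_cauchy_mul_fourierInv_single {φ : ℝ → ℂ} (h2 : MemLp φ 2) :
    ∫ x, cauchy x * (𝓕⁻ (h2.toLp φ) : ComplexL2) x =
      -(2 * Real.pi * Complex.I) * ∫ t, (expTail t : ℂ) * φ (-t) := by
  have h := integral_fourierInv_mul_fourierInv (memLp_cauchyFT.toLp _) (h2.toLp φ)
  rw [← integral_const_mul]
  calc _ = ∫ x, (𝓕⁻ (memLp_cauchyFT.toLp _) : ComplexL2) x * (𝓕⁻ (h2.toLp φ) : ComplexL2) x := by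
        refine integral_congr_ae ?_
        filter_upwards [fourierInv_cauchyFT_ae] with x hx
        rw [hx]
    _ = ∫ ξ, (memLp_cauchyFT.toLp cauchyFT) ξ * (h2.toLp φ) (-ξ) := h
    _ = _ := by
        refine integral_congr_ae ?_
        have h5 := measurePreserving_neg.quasiMeasurePreserving.ae_eq_comp h2.coeFn_toLp
        filter_upwards [memLp_cauchyFT.coeFn_toLp, h5] with ξ e1 e2
        simp only [Function.comp_apply] at e2
        rw [e1, e2, cauchyFT, mul_assoc]

/-- The source of the rank-one commutator. The two signs cancel, or the one-sided exponential
vanishes, unless ξ > 0 > t; there e^{-2π(ξ-t)} splits into a function of ξ times a function of t. -/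
theorem cauchyFT_mul_symbol {ξ t : ℝ} (hξ : ξ ≠ 0) (ht : t ≠ 0) :
    cauchyFT (ξ - t) * (hilbertSymbol (-ξ) + hilbertSymbol t) =
      4 * Real.pi * (expTail ξ * expTail (-t)) := by
  have key : ∀ {s : ℝ}, 0 < s → expTail s = Real.exp (-(2 * Real.pi) * s) := fun h =>
    Set.indicator_of_mem (Set.mem_Ioi.2 h) _
  have key0 : ∀ {s : ℝ}, s ≤ 0 → expTail s = 0 := fun h =>
    Set.indicator_of_notMem (by simpa using h) _
  rw [hilbertSymbol_neg]
  rcases lt_or_gt_of_ne hξ with h1 | h1 <;> rcases lt_or_gt_of_ne ht with h2 | h2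
  · rw [hilbertSymbol_of_neg h1, hilbertSymbol_of_neg h2, key0 h1.le]; simp
  · rw [cauchyFT, key0 (by linarith : ξ - t ≤ 0), key0 h1.le]; simp
  · rw [cauchyFT, hilbertSymbol_pos h1, hilbertSymbol_of_neg h2, key (by linarith : 0 < ξ - t),
      key h1, key (by linarith : 0 < -t), ← Complex.ofReal_mul, ← Real.exp_add,
      show -(2 * Real.pi) * (ξ - t) = -(2 * Real.pi) * ξ + -(2 * Real.pi) * -t by ring]
    linear_combination
      (-4 * Real.pi * (Real.exp (-(2 * Real.pi) * ξ + -(2 * Real.pi) * -t) : ℂ)) * Complex.I_sq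
  · rw [hilbertSymbol_pos h1, hilbertSymbol_pos h2, key0 (by linarith : -t ≤ 0)]; simp

/-- The commutator of the Hilbert transform with the Cauchy kernel, on `L¹ ∩ L²`. -/
theorem cauchy_bilinear_fourierInv {A B : ℝ → ℂ} (hA : Integrable A) (hA2 : MemLp A 2)
    (hB : Integrable B) (hB2 : MemLp B 2) :
    (∫ x, cauchy x * (𝓕⁻ (hA2.toLp A) : ComplexL2) x * hilbertCLM (𝓕⁻ (hB2.toLp B)) x) +
      ∫ x, cauchy x * hilbertCLM (𝓕⁻ (hA2.toLp A)) x * (𝓕⁻ (hB2.toLp B) : ComplexL2) x =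
    -(1 / Real.pi : ℂ) * ((∫ x, cauchy x * (𝓕⁻ (hA2.toLp A) : ComplexL2) x) *
      ∫ x, cauchy x * (𝓕⁻ (hB2.toLp B) : ComplexL2) x) := by
  have sA2 : ∀ {C : ℝ → ℂ}, MemLp C 2 → MemLp (fun ξ => hilbertSymbol ξ * C ξ) 2 := fun h =>
    h.of_le (measurable_hilbertSymbol.aestronglyMeasurable.mul h.1) (.of_forall fun x => by
      rw [norm_mul]
      exact mul_le_of_le_one_left (norm_nonneg _) (norm_hilbertSymbol_le x))
  have sA1 : Integrable (fun ξ => hilbertSymbol ξ * A ξ) :=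
    hA.norm.mono' (measurable_hilbertSymbol.aestronglyMeasurable.mul hA.1) (.of_forall fun x => by
      rw [norm_mul]
      exact mul_le_of_le_one_left (norm_nonneg _) (norm_hilbertSymbol_le x))
  have eS : ∀ {C : ℝ → ℂ} (h : MemLp C 2),
      hilbertCLM (𝓕⁻ (h.toLp C)) = 𝓕⁻ ((sA2 h).toLp _) := fun {C} h => by
    rw [hilbertCLM_fourierInv]
    congr 1
    refine Lp.ext ?_
    filter_upwards [coeFn_symbolMul (h.toLp C), h.coeFn_toLp, (sA2 h).coeFn_toLp] with x h1 h2 h3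
    rw [h1, h2, h3]
  rw [eS, eS, integral_cauchy_mul_fourierInv hA hA2 (sA2 hB2),
    integral_cauchy_mul_fourierInv sA1 (sA2 hA2) hB2,
    integral_cauchy_mul_fourierInv_single, integral_cauchy_mul_fourierInv_single]
  have bd : ∀ {C : ℝ → ℂ}, Integrable C → ∀ ξ, Integrable fun t => C t * cauchyFT (ξ - t) :=
    fun h ξ => h.mul_bdd (c := 2 * Real.pi)
      (measurable_cauchyFT.comp (measurable_const.sub measurable_id)).aestronglyMeasurable
      (.of_forall fun t => norm_cauchyFT_le _)
  have hconv : ∀ {C D : ℝ → ℂ}, Integrable C → Integrable D →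
      Integrable fun ξ => (∫ t, C t * cauchyFT (ξ - t)) * D (-ξ) := fun {C D} h h' => by
    have c1 : Integrable (convolution C cauchyFT (ContinuousLinearMap.mul ℂ ℂ) volume) :=
      h.integrable_convolution _ integrable_cauchyFT
    refine (h'.comp_neg).bdd_mul (c := (∫ t, ‖C t‖) * (2 * Real.pi)) c1.1 (.of_forall fun ξ => ?_)
    rw [← integral_mul_const]
    refine norm_integral_le_of_norm_le (h.norm.mul_const _) (.of_forall fun t => ?_)
    rw [norm_mul]
    exact mul_le_mul_of_nonneg_left (norm_cauchyFT_le _) (norm_nonneg _)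
  have sB1 : Integrable (fun ξ => hilbertSymbol ξ * B ξ) :=
    hB.norm.mono' (measurable_hilbertSymbol.aestronglyMeasurable.mul hB.1) (.of_forall fun x => by
      rw [norm_mul]
      exact mul_le_of_le_one_left (norm_nonneg _) (norm_hilbertSymbol_le x))
  rw [← integral_add (hconv hA sB1) (hconv sA1 hB)]
  -- In frequency the two terms combine into the kernel of `cauchyFT_mul_symbol`, so the double
  -- integral becomes a product of two single ones.
  have hpt : ∀ᵐ ξ : ℝ, (∫ t, A t * cauchyFT (ξ - t)) * (hilbertSymbol (-ξ) * B (-ξ)) +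
      (∫ t, hilbertSymbol t * A t * cauchyFT (ξ - t)) * B (-ξ) =
      (4 * Real.pi * ∫ t, (expTail t : ℂ) * A (-t)) * ((expTail ξ : ℂ) * B (-ξ)) := by
    filter_upwards [ae_ne_zero] with ξ hξ
    have h1 : (∫ t, A t * cauchyFT (ξ - t)) * hilbertSymbol (-ξ) +
        (∫ t, hilbertSymbol t * A t * cauchyFT (ξ - t)) =
        (4 * Real.pi * ∫ t, (expTail t : ℂ) * A (-t)) * (expTail ξ : ℂ) := by
      rw [← integral_mul_const, ← integral_add ((bd hA ξ).mul_const _) (bd sA1 ξ),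
        ← integral_neg_eq_self (fun t => (expTail t : ℂ) * A (-t)), ← integral_const_mul,
        ← integral_mul_const]
      refine integral_congr_ae ?_
      filter_upwards [ae_ne_zero] with t ht
      have := cauchyFT_mul_symbol hξ ht
      simp only [neg_neg]
      linear_combination A t * this
    linear_combination B (-ξ) * h1
  rw [integral_congr_ae hpt, integral_const_mul]
  have hpi : (Real.pi : ℂ) ≠ 0 := by exact_mod_cast Real.pi_ne_zero
  field_simp
  linear_combination (4 * (∫ t, (expTail t : ℂ) * A (-t)) *
    ∫ t, (expTail t : ℂ) * B (-t)) * Complex.I_sq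

/-- The commutator of the Hilbert transform with the Cauchy kernel is of rank one. -/
theorem cauchy_bilinear (f k : ComplexL2) :
    (∫ x, cauchy x * f x * hilbertCLM k x) + ∫ x, cauchy x * hilbertCLM f x * k x =
    -(1 / Real.pi : ℂ) * ((∫ x, cauchy x * f x) * ∫ x, cauchy x * k x) := by
  obtain ⟨A, rfl⟩ : ∃ A : ComplexL2, 𝓕⁻ A = f := ⟨𝓕 f, FourierTransform.fourierInv_fourier_eq f⟩
  obtain ⟨B, rfl⟩ : ∃ B : ComplexL2, 𝓕⁻ B = k := ⟨𝓕 k, FourierTransform.fourierInv_fourier_eq k⟩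
  have hc : Continuous fun X : ComplexL2 => (𝓕⁻ X : ComplexL2) := (Lp.fourierTransformₗᵢ ℝ ℂ).symm.continuous
  have c0 : Continuous fun X : ComplexL2 => ∫ x, cauchy x * (𝓕⁻ X : ComplexL2) x :=
    (continuous_integral_mul memLp_cauchy).comp hc
  have c1 : ∀ g : ComplexL2, Continuous fun X : ComplexL2 => ∫ x, cauchy x * (𝓕⁻ X : ComplexL2) x * g x :=
    fun g => by
      have := (continuous_integral_mul (memLp_cauchy_mul (Lp.memLp g))).comp hc
      refine this.congr fun X => integral_congr_ae (.of_forall fun x => ?_)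
      simp only
      ring
  have c2 : ∀ g : ComplexL2, Continuous fun X : ComplexL2 =>
      ∫ x, cauchy x * hilbertCLM (𝓕⁻ X : ComplexL2) x * g x := fun g => by
      have := (continuous_integral_mul (memLp_cauchy_mul (Lp.memLp g))).comp
        (hilbertCLM.continuous.comp hc)
      refine this.congr fun X => integral_congr_ae (.of_forall fun x => ?_)
      simp only [Function.comp_apply]
      ring
  -- The convolution formula needs integrable transforms; density in each variable separately
  -- removes that restriction.
  refine DenseRange.induction_on (p := fun A : ComplexL2 =>
      (∫ x, cauchy x * (𝓕⁻ A : ComplexL2) x * hilbertCLM (𝓕⁻ B) x) +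
      ∫ x, cauchy x * hilbertCLM (𝓕⁻ A : ComplexL2) x * (𝓕⁻ B : ComplexL2) x =
      -(1 / Real.pi : ℂ) * ((∫ x, cauchy x * (𝓕⁻ A : ComplexL2) x) *
        ∫ x, cauchy x * (𝓕⁻ B : ComplexL2) x))
    (SchwartzMap.denseRange_toLpCLM (p := 2) ENNReal.ofNat_ne_top) A ?_ fun φ => ?_
  · exact isClosed_eq ((c1 _).add (c2 _)) (continuous_const.mul (c0.mul continuous_const))
  refine DenseRange.induction_on (p := fun B : ComplexL2 =>
      (∫ x, cauchy x * (𝓕⁻ (SchwartzMap.toLpCLM ℂ ℂ 2 volume φ) : ComplexL2) x * hilbertCLM (𝓕⁻ B) x) +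
      ∫ x, cauchy x * hilbertCLM (𝓕⁻ (SchwartzMap.toLpCLM ℂ ℂ 2 volume φ) : ComplexL2) x *
        (𝓕⁻ B : ComplexL2) x =
      -(1 / Real.pi : ℂ) * ((∫ x, cauchy x * (𝓕⁻ (SchwartzMap.toLpCLM ℂ ℂ 2 volume φ) : ComplexL2) x) *
        ∫ x, cauchy x * (𝓕⁻ B : ComplexL2) x))
    (SchwartzMap.denseRange_toLpCLM (p := 2) ENNReal.ofNat_ne_top) B ?_ fun ψ => ?_
  · set F : ComplexL2 := 𝓕⁻ (SchwartzMap.toLpCLM ℂ ℂ 2 volume φ) with hF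
    have e1 : Continuous fun X : ComplexL2 => ∫ x, cauchy x * F x * hilbertCLM (𝓕⁻ X) x :=
      (c2 F).congr fun X => integral_congr_ae (.of_forall fun x => mul_right_comm _ _ _)
    have e2 : Continuous fun X : ComplexL2 => ∫ x, cauchy x * hilbertCLM F x * (𝓕⁻ X : ComplexL2) x :=
      (c1 (hilbertCLM F)).congr fun X =>
        integral_congr_ae (.of_forall fun x => mul_right_comm _ _ _)
    exact isClosed_eq (e1.add e2) (continuous_const.mul (continuous_const.mul c0))
  · exact cauchy_bilinear_fourierInv φ.integrable (φ.memLp 2) ψ.integrable (ψ.memLp 2)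

/-! ### The Hilbert transform of real functions -/

/-- The Hilbert transform of a real function. -/
noncomputable def hR (f : ℝ → ℝ) (x : ℝ) : ℝ := (hilbert (fun y => (f y : ℂ)) x).re

theorem hilbert_ofReal_eq {f : ℝ → ℝ} (hf : MemLp f 2) :
    hilbert (fun y => (f y : ℂ)) = hilbertCLM (hf.ofReal.toLp _) := hilbert_eq hf.ofReal

/-- Permits calculation with the real-valued `hR`: by `hilbertCLM_star` the transform of a real
function equals its own conjugate a.e. -/
theorem hilbert_ofReal_ae {f : ℝ → ℝ} (hf : MemLp f 2) :
    hilbert (fun y => (f y : ℂ)) =ᵐ[volume] fun x => (hR f x : ℂ) := by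
  have h1 : star (hf.ofReal (K := ℂ) |>.toLp _ : ComplexL2) = hf.ofReal.toLp _ := by
    refine Lp.ext ?_
    filter_upwards [Lp.coeFn_star (hf.ofReal (K := ℂ) |>.toLp _ : ComplexL2),
      (hf.ofReal (K := ℂ)).coeFn_toLp] with x e1 e2
    rw [e1, Pi.star_apply, e2]
    simp
  have h2 := hilbertCLM_star (hf.ofReal (K := ℂ) |>.toLp _ : ComplexL2)
  rw [h1] at h2
  have h3 := Lp.coeFn_star (hilbertCLM (hf.ofReal (K := ℂ) |>.toLp _ : ComplexL2))
  rw [← h2] at h3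
  filter_upwards [h3] with x hx
  rw [Pi.star_apply] at hx
  rw [hR, hilbert_ofReal_eq hf]
  exact (Complex.conj_eq_iff_re.1 hx.symm).symm

/-- Unconditional, because the transform is 0 by convention outside L². -/
theorem memLp_hilbert {f : ℝ → ℂ} : MemLp (hilbert f) 2 := by
  by_cases h : MemLp f 2
  · rw [hilbert_eq h]; exact Lp.memLp _
  · rw [hilbert, dif_neg h]; exact MemLp.zero

theorem memLp_hR {f : ℝ → ℝ} : MemLp (hR f) 2 :=
  (memLp_hilbert (f := fun y => (f y : ℂ))).re

theorem hilbert_congr {f g : ℝ → ℂ} (h : f =ᵐ[volume] g) : hilbert f = hilbert g := by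
  by_cases hf : MemLp f 2
  · have hg : MemLp g 2 := (memLp_congr_ae h).1 hf
    rw [hilbert_eq hf, hilbert_eq hg, (MemLp.toLp_eq_toLp_iff hf hg).2 h]
  · have hg : ¬ MemLp g 2 := fun hg => hf ((memLp_congr_ae h).2 hg)
    rw [hilbert, hilbert, dif_neg hf, dif_neg hg]

theorem hR_add {f g : ℝ → ℝ} (hf : MemLp f 2) (hg : MemLp g 2) :
    hR (fun x => f x + g x) =ᵐ[volume] fun x => hR f x + hR g x := by
  have e : (hf.add hg).ofReal.toLp _ = (hf.ofReal.toLp _ + hg.ofReal.toLp _ : ComplexL2) := by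
    rw [← MemLp.toLp_add]
    refine MemLp.toLp_congr _ _ (.of_forall fun x => ?_)
    simp
  have h1 := hilbert_ofReal_eq (hf.add hg)
  rw [e, map_add] at h1
  filter_upwards [Lp.coeFn_add (hilbertCLM (hf.ofReal.toLp _)) (hilbertCLM (hg.ofReal.toLp _))]
    with x hx
  have h2 := congrFun h1 x
  rw [hx, Pi.add_apply, ← hilbert_ofReal_eq hf, ← hilbert_ofReal_eq hg] at h2
  simp only [hR, ← Complex.add_re]
  rw [← h2]
  rfl

theorem hR_const_mul {f : ℝ → ℝ} (c : ℝ) (hf : MemLp f 2) :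
    hR (fun x => c * f x) =ᵐ[volume] fun x => c * hR f x := by
  have e : (hf.const_mul c).ofReal.toLp _ = ((c : ℂ) • hf.ofReal.toLp _ : ComplexL2) := by
    rw [← MemLp.toLp_const_smul]
    refine MemLp.toLp_congr _ _ (.of_forall fun x => ?_)
    simp
  have h1 := hilbert_ofReal_eq (hf.const_mul c)
  rw [e, map_smul] at h1
  filter_upwards [Lp.coeFn_smul (c : ℂ) (hilbertCLM (hf.ofReal.toLp _))] with x hx
  have h2 := congrFun h1 x
  rw [hx, Pi.smul_apply, ← hilbert_ofReal_eq hf] at h2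
  simp only [hR]
  rw [h2, smul_eq_mul, Complex.re_ofReal_mul]

theorem integral_ofReal_mul_hilbertCLM {f g : ℝ → ℝ} (hf : MemLp f 2) (hg : MemLp g 2) :
    ∫ x, (hf.ofReal (K := ℂ) |>.toLp _ : ComplexL2) x *
      hilbertCLM (hg.ofReal (K := ℂ) |>.toLp _ : ComplexL2) x = ((∫ x, f x * hR g x : ℝ) : ℂ) := by
  rw [← integral_complex_ofReal]
  refine integral_congr_ae ?_
  filter_upwards [(hf.ofReal (K := ℂ)).coeFn_toLp, hilbert_ofReal_ae hg] with x h1 h2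
  rw [h1, ← hilbert_ofReal_eq hg, h2]
  simp

/-- The Hilbert transform is antisymmetric. -/
theorem integral_mul_hR {f g : ℝ → ℝ} (hf : MemLp f 2) (hg : MemLp g 2) :
    ∫ x, f x * hR g x = -∫ x, g x * hR f x := by
  have h := integral_mul_hilbertCLM (hf.ofReal (K := ℂ) |>.toLp _ : ComplexL2)
    (hg.ofReal (K := ℂ) |>.toLp _ : ComplexL2)
  simp_rw [mul_comm (hilbertCLM _ _)] at h
  rw [integral_ofReal_mul_hilbertCLM hf hg, integral_ofReal_mul_hilbertCLM hg hf] at h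
  exact_mod_cast h

theorem toLp_hR {f : ℝ → ℝ} (hf : MemLp f 2) :
    (memLp_hR (f := f)).ofReal.toLp _ = hilbertCLM (hf.ofReal.toLp _ : ComplexL2) := by
  refine Lp.ext ?_
  filter_upwards [((memLp_hR (f := f)).ofReal (K := ℂ)).coeFn_toLp, hilbert_ofReal_ae hf]
    with x h1 h2
  rw [h1, ← hilbert_ofReal_eq hf, h2]
  simp

theorem hR_hR {f : ℝ → ℝ} (hf : MemLp f 2) : hR (hR f) =ᵐ[volume] fun x => -f x := by
  have h1 := hilbert_ofReal_eq (memLp_hR (f := f))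
  rw [toLp_hR hf, hilbertCLM_hilbertCLM] at h1
  filter_upwards [Lp.coeFn_neg (hf.ofReal (K := ℂ) |>.toLp _ : ComplexL2),
    (hf.ofReal (K := ℂ)).coeFn_toLp] with x e1 e2
  rw [hR, h1, e1, Pi.neg_apply, e2]
  simp

theorem integral_hR_mul_hR {f g : ℝ → ℝ} (hf : MemLp f 2) (hg : MemLp g 2) :
    ∫ x, hR f x * hR g x = ∫ x, f x * g x := by
  rw [integral_mul_hR memLp_hR hg, ← integral_neg]
  refine integral_congr_ae ?_
  filter_upwards [hR_hR hf] with x hx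
  rw [hx]
  ring

theorem nrm_hR {f : ℝ → ℝ} (hf : MemLp f 2) : nrm (hR f) = nrm f := by
  unfold nrm
  simp_rw [sq]
  rw [integral_hR_mul_hR hf hf]

theorem hilbert_cauchy_ae :
    hilbertCLM (memLp_cauchy.toLp _) =ᵐ[volume] fun x => -Complex.I * cauchy x := by
  rw [hilbertCLM_cauchy]
  filter_upwards [Lp.coeFn_smul (-Complex.I) (memLp_cauchy.toLp cauchy),
    memLp_cauchy.coeFn_toLp] with x h1 h2
  rw [h1, Pi.smul_apply, h2, smul_eq_mul]

/-- Real and imaginary parts of ℋ(1/(x+i)) = -i/(x+i). -/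
theorem hR_kernels : hR cpk =ᵐ[volume] (fun x => -pk x) ∧ hR pk =ᵐ[volume] cpk := by
  have e : memLp_cauchy.toLp cauchy =
      (memLp_cpk.ofReal.toLp _ + (-Complex.I) • memLp_pk.ofReal.toLp _ : ComplexL2) := by
    rw [← MemLp.toLp_const_smul, ← MemLp.toLp_add]
    refine MemLp.toLp_congr _ _ (.of_forall fun x => ?_)
    simp [cauchy_eq]
    ring
  have h := hilbert_cauchy_ae
  rw [e, map_add, map_smul] at h
  have key : ∀ᵐ x, (hR cpk x : ℂ) + -Complex.I * (hR pk x : ℂ) = -Complex.I * cauchy x := by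
    filter_upwards [h, Lp.coeFn_add (hilbertCLM (memLp_cpk.ofReal.toLp _))
      ((-Complex.I) • hilbertCLM (memLp_pk.ofReal.toLp _)),
      Lp.coeFn_smul (-Complex.I) (hilbertCLM (memLp_pk.ofReal.toLp _)),
      hilbert_ofReal_ae memLp_cpk, hilbert_ofReal_ae memLp_pk] with x h1 h2 h3 h4 h5
    rw [← h1, h2, Pi.add_apply, h3, Pi.smul_apply, smul_eq_mul, ← h4, ← h5,
      hilbert_ofReal_eq memLp_cpk, hilbert_ofReal_eq memLp_pk]
  constructor
  · filter_upwards [key] with x hx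
    have := congrArg Complex.re hx
    simpa [cauchy_eq] using this
  · filter_upwards [key] with x hx
    have := congrArg Complex.im hx
    simpa [cauchy_eq] using this

theorem hR_cpk : hR cpk =ᵐ[volume] fun x => -pk x := hR_kernels.1

theorem hR_pk : hR pk =ᵐ[volume] cpk := hR_kernels.2

theorem integral_cauchy_mul {f : ℝ → ℝ} (hf : MemLp f 2) :
    ∫ x, cauchy x * (f x : ℂ) =
      ((∫ x, cpk x * f x : ℝ) : ℂ) - ((∫ x, pk x * f x : ℝ) : ℂ) * Complex.I := by
  rw [← integral_complex_ofReal, ← integral_complex_ofReal, ← integral_mul_const,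
    ← integral_sub (integrable_mul memLp_cpk hf).ofReal
      ((integrable_mul memLp_pk hf).ofReal.mul_const _)]
  refine integral_congr_ae (.of_forall fun x => ?_)
  simp only [cauchy_eq]
  push_cast
  ring

theorem memLp_cpk_mul {f : ℝ → ℝ} (hf : MemLp f 2) : MemLp (fun x => cpk x * f x) 2 :=
  memLp_bdd_mul (c := 1) continuous_cpk.aestronglyMeasurable
    (fun x => (abs_cpk_le_wt x).trans (wt_le_one x)) hf

theorem memLp_pk_mul {f : ℝ → ℝ} (hf : MemLp f 2) : MemLp (fun x => pk x * f x) 2 :=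
  memLp_bdd_mul (c := 1) continuous_pk.aestronglyMeasurable
    (fun x => by rw [abs_of_pos (pk_pos x)]; exact pk_le_one x) hf

/-- Real and imaginary parts of `cauchy_bilinear`: over the reals the rank-one commutator becomes
rank two. -/
theorem kernel_bilinear {f k : ℝ → ℝ} (hf : MemLp f 2) (hk : MemLp k 2) :
    (∫ x, cpk x * (f x * hR k x + hR f x * k x) = -(1 / Real.pi) *
      ((∫ x, cpk x * f x) * (∫ x, cpk x * k x) - (∫ x, pk x * f x) * (∫ x, pk x * k x))) ∧
    ∫ x, pk x * (f x * hR k x + hR f x * k x) = -(1 / Real.pi) *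
      ((∫ x, cpk x * f x) * (∫ x, pk x * k x) + (∫ x, pk x * f x) * (∫ x, cpk x * k x)) := by
  have h := cauchy_bilinear (hf.ofReal (K := ℂ) |>.toLp _) (hk.ofReal (K := ℂ) |>.toLp _)
  have e1 : ∀ {g : ℝ → ℝ} (hg : MemLp g 2), ∫ x, cauchy x * (hg.ofReal (K := ℂ) |>.toLp _ : ComplexL2) x
      = ∫ x, cauchy x * (g x : ℂ) := fun hg => by
    refine integral_congr_ae ?_
    filter_upwards [(hg.ofReal (K := ℂ)).coeFn_toLp] with x h1
    rw [h1]; simp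
  have i1 : Integrable fun x => cauchy x * ((f x * hR k x : ℝ) : ℂ) := by
    have := integrable_mulC (memLp_cauchy_mul hf.ofReal) ((memLp_hR (f := k)).ofReal (K := ℂ))
    refine this.congr (.of_forall fun x => ?_)
    push_cast; simp [mul_assoc]
  have i2 : Integrable fun x => cauchy x * ((hR f x * k x : ℝ) : ℂ) := by
    have := integrable_mulC (memLp_cauchy_mul ((memLp_hR (f := f)).ofReal)) (hk.ofReal (K := ℂ))
    refine this.congr (.of_forall fun x => ?_)
    push_cast; simp [mul_assoc]
  have e2 : (∫ x, cauchy x * (hf.ofReal (K := ℂ) |>.toLp _ : ComplexL2) x *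
      hilbertCLM (hk.ofReal (K := ℂ) |>.toLp _ : ComplexL2) x) +
      ∫ x, cauchy x * hilbertCLM (hf.ofReal (K := ℂ) |>.toLp _ : ComplexL2) x *
        (hk.ofReal (K := ℂ) |>.toLp _ : ComplexL2) x =
      ∫ x, cauchy x * ((f x * hR k x + hR f x * k x : ℝ) : ℂ) := by
    have : ∀ x, cauchy x * ((f x * hR k x + hR f x * k x : ℝ) : ℂ) =
        cauchy x * ((f x * hR k x : ℝ) : ℂ) + cauchy x * ((hR f x * k x : ℝ) : ℂ) := fun x => by
      push_cast; ring
    simp_rw [this]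
    rw [integral_add i1 i2]
    congr 1
    · refine integral_congr_ae ?_
      filter_upwards [(hf.ofReal (K := ℂ)).coeFn_toLp, hilbert_ofReal_ae hk] with x h1 h2
      rw [h1, ← hilbert_ofReal_eq hk, h2]; push_cast; simp [mul_assoc]
    · refine integral_congr_ae ?_
      filter_upwards [(hk.ofReal (K := ℂ)).coeFn_toLp, hilbert_ofReal_ae hf] with x h1 h2
      rw [h1, ← hilbert_ofReal_eq hf, h2]; push_cast; simp [mul_assoc]
  have j1 : Integrable fun x => cpk x * (f x * hR k x + hR f x * k x) := by
    have := (integrable_mul (memLp_cpk_mul hf) (memLp_hR (f := k))).add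
      (integrable_mul (memLp_cpk_mul (memLp_hR (f := f))) hk)
    refine this.congr (.of_forall fun x => ?_)
    simp only [Pi.add_apply]; ring
  have j2 : Integrable fun x => pk x * (f x * hR k x + hR f x * k x) := by
    have := (integrable_mul (memLp_pk_mul hf) (memLp_hR (f := k))).add
      (integrable_mul (memLp_pk_mul (memLp_hR (f := f))) hk)
    refine this.congr (.of_forall fun x => ?_)
    simp only [Pi.add_apply]; ring
  have e3 : ∫ x, cauchy x * ((f x * hR k x + hR f x * k x : ℝ) : ℂ) =
      ((∫ x, cpk x * (f x * hR k x + hR f x * k x) : ℝ) : ℂ) -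
        ((∫ x, pk x * (f x * hR k x + hR f x * k x) : ℝ) : ℂ) * Complex.I := by
    rw [← integral_complex_ofReal, ← integral_complex_ofReal, ← integral_mul_const,
      ← integral_sub j1.ofReal (j2.ofReal.mul_const _)]
    refine integral_congr_ae (.of_forall fun x => ?_)
    simp only [cauchy_eq]
    push_cast
    ring
  rw [e2, e3, e1 hf, e1 hk, integral_cauchy_mul hf, integral_cauchy_mul hk] at h
  constructor
  · have := congrArg Complex.re h
    simpa [← Complex.ofReal_inv] using this
  · have := congrArg Complex.im h
    simp [← Complex.ofReal_inv] at this
    linear_combination this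

/-! ### Weighted identities for the Hilbert transform -/

theorem ae_eq_of_integral_mul {f g : ℝ → ℝ} (hf : MemLp f 2) (hg : MemLp g 2)
    (h : ∀ k, MemLp k 2 → ∫ x, k x * f x = ∫ x, k x * g x) : f =ᵐ[volume] g := by
  have hd : MemLp (fun x => f x - g x) 2 := hf.sub hg
  have h1 := h _ hd
  rw [← sub_eq_zero, ← integral_sub (integrable_mul hd hf) (integrable_mul hd hg)] at h1
  have h2 : ∫ x, (f x - g x) ^ 2 = 0 := by
    rw [← h1]
    exact integral_congr_ae (.of_forall fun x => by simp only; ring)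
  rw [integral_eq_zero_iff_of_nonneg (fun x => sq_nonneg _) (integrable_sq hd)] at h2
  filter_upwards [h2] with x hx
  have := pow_eq_zero_iff (two_ne_zero) |>.1 hx
  linarith

theorem integral_cpk_mul_hR {f : ℝ → ℝ} (hf : MemLp f 2) :
    ∫ x, cpk x * hR f x = ∫ x, pk x * f x := by
  rw [integral_mul_hR memLp_cpk hf, ← integral_neg]
  refine integral_congr_ae ?_
  filter_upwards [hR_cpk] with x hx
  rw [hx]; ring

theorem integral_pk_mul_hR {f : ℝ → ℝ} (hf : MemLp f 2) :
    ∫ x, pk x * hR f x = -∫ x, cpk x * f x := by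
  rw [integral_mul_hR memLp_pk hf]
  congr 1
  refine integral_congr_ae ?_
  filter_upwards [hR_pk] with x hx
  rw [hx]; ring

theorem integral_cpk_bilinear {f k : ℝ → ℝ} (hf : MemLp f 2) (hk : MemLp k 2) :
    (∫ x, cpk x * f x * hR k x) + ∫ x, k x * (cpk x * hR f x) = -(1 / Real.pi) *
      ((∫ x, cpk x * f x) * (∫ x, cpk x * k x) - (∫ x, pk x * f x) * (∫ x, pk x * k x)) := by
  rw [← (kernel_bilinear hf hk).1, ← integral_add (integrable_mul (memLp_cpk_mul hf) memLp_hR)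
    (integrable_mul hk (memLp_cpk_mul memLp_hR))]
  exact integral_congr_ae (.of_forall fun x => by simp only; ring)

theorem integral_pk_bilinear {f k : ℝ → ℝ} (hf : MemLp f 2) (hk : MemLp k 2) :
    (∫ x, pk x * f x * hR k x) + ∫ x, k x * (pk x * hR f x) = -(1 / Real.pi) *
      ((∫ x, cpk x * f x) * (∫ x, pk x * k x) + (∫ x, pk x * f x) * (∫ x, cpk x * k x)) := by
  rw [← (kernel_bilinear hf hk).2, ← integral_add (integrable_mul (memLp_pk_mul hf) memLp_hR)
    (integrable_mul hk (memLp_pk_mul memLp_hR))]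
  exact integral_congr_ae (.of_forall fun x => by simp only; ring)

/-- Commutator of the Hilbert transform with `x / (1 + x²)`. -/
theorem hR_cpk_mul {f : ℝ → ℝ} (hf : MemLp f 2) :
    hR (fun x => cpk x * f x) =ᵐ[volume] fun x => cpk x * hR f x +
      (1 / Real.pi) * ((∫ y, cpk y * f y) * cpk x - (∫ y, pk y * f y) * pk x) := by
  set α := ∫ y, cpk y * f y
  set β := ∫ y, pk y * f y
  have m1 : MemLp (fun x => (1 / Real.pi) * (α * cpk x - β * pk x)) 2 :=
    ((memLp_cpk.const_mul α).sub (memLp_pk.const_mul β)).const_mul _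
  -- By duality: the commutator is read off from its pairings with arbitrary L² functions.
  refine ae_eq_of_integral_mul memLp_hR ((memLp_cpk_mul memLp_hR).add m1) fun k hk => ?_
  have h := integral_cpk_bilinear hf hk
  have h2 := integral_mul_hR (memLp_cpk_mul hf) hk
  simp_rw [mul_add]
  rw [integral_add (integrable_mul hk (memLp_cpk_mul memLp_hR)) (integrable_mul hk m1)]
  have h3 : ∫ x, k x * ((1 / Real.pi) * (α * cpk x - β * pk x)) =
      (1 / Real.pi) * (α * (∫ x, cpk x * k x) - β * ∫ x, pk x * k x) := by
    rw [← integral_const_mul, ← integral_const_mul, ← integral_sub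
      ((integrable_mul memLp_cpk hk).const_mul _) ((integrable_mul memLp_pk hk).const_mul _),
      ← integral_const_mul]
    exact integral_congr_ae (.of_forall fun x => by simp only; ring)
  rw [h3]
  linarith

/-- Commutator of the Hilbert transform with `1 / (1 + x²)`. -/
theorem hR_pk_mul {f : ℝ → ℝ} (hf : MemLp f 2) :
    hR (fun x => pk x * f x) =ᵐ[volume] fun x => pk x * hR f x +
      (1 / Real.pi) * ((∫ y, cpk y * f y) * pk x + (∫ y, pk y * f y) * cpk x) := by
  set α := ∫ y, cpk y * f y
  set β := ∫ y, pk y * f y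
  have m1 : MemLp (fun x => (1 / Real.pi) * (α * pk x + β * cpk x)) 2 :=
    ((memLp_pk.const_mul α).add (memLp_cpk.const_mul β)).const_mul _
  refine ae_eq_of_integral_mul memLp_hR ((memLp_pk_mul memLp_hR).add m1) fun k hk => ?_
  have h := integral_pk_bilinear hf hk
  have h2 := integral_mul_hR (memLp_pk_mul hf) hk
  simp_rw [mul_add]
  rw [integral_add (integrable_mul hk (memLp_pk_mul memLp_hR))
    (by simpa only [mul_add] using integrable_mul hk m1)]
  have h3 : ∫ x, (k x * ((1 / Real.pi) * (α * pk x)) + k x * ((1 / Real.pi) * (β * cpk x))) =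
      (1 / Real.pi) * (α * (∫ x, pk x * k x) + β * ∫ x, cpk x * k x) := by
    rw [← integral_const_mul, ← integral_const_mul, ← integral_add
      ((integrable_mul memLp_pk hk).const_mul _) ((integrable_mul memLp_cpk hk).const_mul _),
      ← integral_const_mul]
    exact integral_congr_ae (.of_forall fun x => by simp only; ring)
  rw [h3]
  linarith

/-- The boundary values of `(x + i)⁻¹ (f + i ℋ f)` are conjugate to each other. -/
theorem hR_cpk_mul_add_pk_mul_hR {f : ℝ → ℝ} (hf : MemLp f 2) :
    hR (fun x => cpk x * f x + pk x * hR f x) =ᵐ[volume]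
      fun x => cpk x * hR f x - pk x * f x := by
  filter_upwards [hR_add (memLp_cpk_mul hf) (memLp_pk_mul (memLp_hR (f := f))), hR_cpk_mul hf,
    hR_pk_mul (memLp_hR (f := f)), hR_hR hf] with x h1 h2 h3 h4
  -- The two commutator corrections cancel: the moments of `hR f` against `cpk` and `pk` are, up to
  -- sign, those of `f` interchanged.
  rw [h1, h2, h3, h4, integral_cpk_mul_hR hf, integral_pk_mul_hR hf]
  ring

/-- On the diagonal both bilinear terms coincide, so this cubic-looking expression is a difference
of squares of scalar moments. -/
theorem integral_cpk_mul_self {f : ℝ → ℝ} (hf : MemLp f 2) :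
    ∫ x, cpk x * f x * hR f x = -(1 / (2 * Real.pi)) *
      ((∫ x, cpk x * f x) ^ 2 - (∫ x, pk x * f x) ^ 2) := by
  have h := integral_cpk_bilinear hf hf
  have h2 : ∫ x, f x * (cpk x * hR f x) = ∫ x, cpk x * f x * hR f x :=
    integral_congr_ae (.of_forall fun x => by simp only; ring)
  rw [h2] at h
  have := Real.pi_pos
  field_simp at h ⊢
  linarith

theorem nrm_wt_mul_sq (f : ℝ → ℝ) : nrm (fun x => wt x * f x) ^ 2 = ∫ x, pk x * f x ^ 2 := by
  rw [nrm_sq]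
  exact integral_congr_ae (.of_forall fun x => by simp only [mul_pow, wt_sq])

/-- Weighted isometry property of the Hilbert transform. -/
theorem nrm_wt_mul_hR_sq {f : ℝ → ℝ} (hf : MemLp f 2) :
    nrm (fun x => wt x * hR f x) ^ 2 = nrm (fun x => wt x * f x) ^ 2 +
      ((∫ x, cpk x * f x) ^ 2 - (∫ x, pk x * f x) ^ 2) / Real.pi := by
  -- The pair (ℋf, f) is used, so that ℋℋf = -f turns the second term into the weighted norm of `f`.
  have h := integral_pk_bilinear (memLp_hR (f := f)) hf
  rw [integral_cpk_mul_hR hf, integral_pk_mul_hR hf] at h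
  rw [nrm_wt_mul_sq, nrm_wt_mul_sq]
  have e1 : ∫ x, pk x * hR f x * hR f x = ∫ x, pk x * hR f x ^ 2 :=
    integral_congr_ae (.of_forall fun x => by simp only; ring)
  have e2 : ∫ x, f x * (pk x * hR (hR f) x) = -∫ x, pk x * f x ^ 2 := by
    rw [← integral_neg]
    refine integral_congr_ae ?_
    filter_upwards [hR_hR hf] with x hx
    rw [hx]; ring
  rw [e1, e2] at h
  have := Real.pi_pos
  field_simp at h ⊢
  linarith

/-- In the weighted isometry the moment against `pk` has the favourable sign and is dropped; 1/π ≤ 1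
handles the other. -/
theorem nrm_wt_mul_hR_le {f : ℝ → ℝ} (hf : MemLp f 2) :
    nrm (fun x => wt x * hR f x) ≤ nrm (fun x => wt x * f x) + |∫ x, cpk x * f x| := by
  have h := nrm_wt_mul_hR_sq hf
  have h1 : ((∫ x, cpk x * f x) ^ 2 - (∫ x, pk x * f x) ^ 2) / Real.pi ≤
      |∫ x, cpk x * f x| ^ 2 := by
    rw [div_le_iff₀ Real.pi_pos, sq_abs]
    nlinarith [sq_nonneg (∫ x, cpk x * f x), sq_nonneg (∫ x, pk x * f x), Real.pi_gt_three]
  refine le_of_sq_le_sq ?_ (add_nonneg (nrm_nonneg _) (abs_nonneg _))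
  nlinarith [mul_nonneg (nrm_nonneg (fun x => wt x * f x)) (abs_nonneg (∫ x, cpk x * f x))]

/-! ### The Hilbert transform commutes with derivatives -/

theorem hasDerivAt_fourierInv {f : ℝ → ℂ} (hf : Integrable f)
    (hf' : Integrable fun x : ℝ => x • f x) (w : ℝ) :
    HasDerivAt (𝓕⁻ f) (𝓕⁻ (fun x : ℝ => (2 * Real.pi * Complex.I * x) • f x) w) w := by
  rw [Real.fourierInv_eq_fourier_comp_neg, Real.fourierInv_eq_fourier_comp_neg]
  have h := Real.hasDerivAt_fourier (f := fun x => f (-x)) hf.comp_neg (by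
    have := hf'.comp_neg.neg
    refine this.congr (.of_forall fun x => ?_)
    simp) w
  have e : (fun x : ℝ => (2 * Real.pi * Complex.I * (-x : ℝ)) • f (-x)) =
      fun x : ℝ => (-2 * Real.pi * Complex.I * x) • f (-x) := funext fun x => by
    push_cast
    congr 1
    ring
  rw [e]
  exact h

/-- A test function as a complex Schwartz function. -/
noncomputable def testSchwartz {φ : ℝ → ℝ} (hφ : ContDiff ℝ ∞ φ) (hc : HasCompactSupport φ) :
    SchwartzMap ℝ ℂ :=
  HasCompactSupport.toSchwartzMap (f := Complex.ofRealCLM ∘ φ) (hc.comp_left rfl) (by fun_prop)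

theorem integrable_hilbertSymbol_mul {f : ℝ → ℂ} (hf : Integrable f) :
    Integrable fun ξ => hilbertSymbol ξ * f ξ :=
  hf.norm.mono' (measurable_hilbertSymbol.aestronglyMeasurable.mul hf.1) (.of_forall fun x => by
    rw [norm_mul]
    exact mul_le_of_le_one_left (norm_nonneg _) (norm_hilbertSymbol_le x))

theorem hilbert_test {φ : ℝ → ℝ} (hφ : ContDiff ℝ ∞ φ) (hc : HasCompactSupport φ) :
    hilbert (fun x => (φ x : ℂ)) =ᵐ[volume]
      𝓕⁻ (fun ξ => hilbertSymbol ξ * (𝓕 (testSchwartz hφ hc) : SchwartzMap ℝ ℂ) ξ) := by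
  set Φ := testSchwartz hφ hc
  set Ψ : SchwartzMap ℝ ℂ := 𝓕 Φ
  have hm : MemLp (fun x => (φ x : ℂ)) 2 := Φ.memLp 2 volume
  have h1 : hm.toLp _ = (Φ.toLp 2 : ComplexL2) := rfl
  have i1 := integrable_hilbertSymbol_mul (Ψ.integrable (μ := volume))
  have i2 : MemLp (fun ξ => hilbertSymbol ξ * Ψ ξ) 2 :=
    (Ψ.memLp 2).of_le (measurable_hilbertSymbol.aestronglyMeasurable.mul (Ψ.memLp 2).1)
      (.of_forall fun x => by
        rw [Pi.mul_apply, norm_mul]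
        exact mul_le_of_le_one_left (norm_nonneg _) (norm_hilbertSymbol_le x))
  have h2 : symbolMul (𝓕 (Φ.toLp 2 : ComplexL2)) = i2.toLp _ := by
    rw [SchwartzMap.toLp_fourier_eq]
    refine Lp.ext ?_
    filter_upwards [coeFn_symbolMul (Ψ.toLp 2 : ComplexL2), Ψ.coeFn_toLp 2 volume,
      i2.coeFn_toLp] with x h1 h2 h3
    rw [h1, h2, h3]
  rw [hilbert_eq hm, h1, hilbertLp, h2]
  exact fourierInv_toLp_ae i1 i2

theorem continuous_fourierInv {f : ℝ → ℂ} (hf : Integrable f) : Continuous (𝓕⁻ f) := by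
  have h3 := (Real.Lp.fourierTransformInv (memLp_one_iff_integrable.2 hf).toLp).continuous
  rwa [Real.Lp.fourierTransformInv_toLp] at h3

/-- The bounded symbol commutes with multiplication by 2πiξ. The rapid decay of the transform of `φ`
allows differentiation under the Fourier integral. -/
theorem exists_isPrim_hR_test {φ : ℝ → ℝ} (hφ : ContDiff ℝ ∞ φ) (hc : HasCompactSupport φ) :
    ∃ ψ ψ', IsPrim ψ ψ' ∧ hR φ =ᵐ[volume] ψ ∧ hR (deriv φ) =ᵐ[volume] ψ' := by
  have hφ' : ContDiff ℝ ∞ (deriv φ) := (contDiff_infty_iff_deriv.1 hφ).2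
  set Ψ : SchwartzMap ℝ ℂ := 𝓕 (testSchwartz hφ hc) with hΨ
  set Ψ' : SchwartzMap ℝ ℂ := 𝓕 (testSchwartz hφ' hc.deriv) with hΨ'
  set F : ℝ → ℂ := fun ξ => hilbertSymbol ξ * Ψ ξ with hF
  set F' : ℝ → ℂ := fun ξ => hilbertSymbol ξ * Ψ' ξ with hF'
  have e : ∀ ξ : ℝ, Ψ' ξ = (2 * Real.pi * Complex.I * ξ) • Ψ ξ := fun ξ => by
    have hd : deriv (testSchwartz hφ hc) = testSchwartz hφ' hc.deriv := by
      funext x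
      have hx : HasDerivAt φ (deriv φ x) x := ((hφ.differentiable (by simp)) x).hasDerivAt
      exact hx.ofReal_comp.deriv
    have h := Real.fourier_deriv (f := testSchwartz hφ hc) (testSchwartz hφ hc).integrable
      (testSchwartz hφ hc).differentiable (by rw [hd]; exact SchwartzMap.integrable _)
    rw [hd] at h
    rw [hΨ', hΨ, SchwartzMap.fourier_coe, h, SchwartzMap.fourier_coe]
  have iF : Integrable F := integrable_hilbertSymbol_mul Ψ.integrable
  have iF' : Integrable F' := integrable_hilbertSymbol_mul Ψ'.integrable
  have e' : (fun x : ℝ => (2 * Real.pi * Complex.I * x) • F x) = F' := funext fun x => by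
    simp only [hF, hF', e, smul_eq_mul]
    ring
  have ixF : Integrable fun x : ℝ => x • F x := by
    refine (iF'.const_mul (2 * Real.pi * Complex.I)⁻¹).congr (.of_forall fun x => ?_)
    have h2 : (2 * Real.pi * Complex.I) ≠ 0 := Complex.two_pi_I_ne_zero
    simp only [← e', smul_eq_mul, Complex.real_smul]
    rw [mul_assoc (2 * (Real.pi : ℂ) * Complex.I), inv_mul_cancel_left₀ h2]
  have hder : ∀ x, HasDerivAt (𝓕⁻ F) (𝓕⁻ F' x) x := fun x => by
    have := hasDerivAt_fourierInv iF ixF x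
    rwa [e'] at this
  refine ⟨fun x => (𝓕⁻ F x).re, fun x => (𝓕⁻ F' x).re, ?_, ?_, ?_⟩
  · refine .of_hasDerivAt (fun x => ?_) (Complex.continuous_re.comp (continuous_fourierInv iF'))
    exact (Complex.reCLM.hasFDerivAt.comp_hasDerivAt x (hder x))
  · filter_upwards [hilbert_test hφ hc] with x hx
    rw [hR, hx]
  · filter_upwards [hilbert_test hφ' hc.deriv] with x hx
    rw [hR, hx]

/-- The Hilbert transform commutes with the derivative. -/
theorem IsPrim.exists_hR {f g : ℝ → ℝ} (h : IsPrim f g) (hf : MemLp f 2) (hg : MemLp g 2) :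
    ∃ F, IsPrim F (hR g) ∧ hR f =ᵐ[volume] F := by
  refine exists_isPrim_of_weak (memLp_hR.locallyIntegrable (by norm_num))
    (memLp_hR.locallyIntegrable (by norm_num)) fun φ hφ hc => ?_
  obtain ⟨ψ, ψ', hp, e1, e2⟩ := exists_isPrim_hR_test hφ hc
  have mφ : MemLp φ 2 := hφ.continuous.memLp_of_hasCompactSupport hc
  have mφ' : MemLp (deriv φ) 2 :=
    (hφ.continuous_deriv (by simp)).memLp_of_hasCompactSupport hc.deriv
  rw [integral_mul_hR mφ' hf, integral_mul_hR mφ hg]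
  have m1 : MemLp ψ 2 := (memLp_congr_ae e1).1 memLp_hR
  have m2 : MemLp ψ' 2 := (memLp_congr_ae e2).1 memLp_hR
  -- The transform of a test function is not compactly supported; square integrability of all four
  -- factors makes the boundary terms vanish instead.
  have h0 := (h.mul hp).integral_eq_zero (integrable_mul hf m1)
    ((integrable_mul hg m1).add (integrable_mul hf m2))
  rw [integral_add (integrable_mul hg m1) (integrable_mul hf m2)] at h0
  have c1 : ∫ x, f x * hR (deriv φ) x = ∫ x, f x * ψ' x := integral_congr_ae (by
    filter_upwards [e2] with x hx; rw [hx])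
  have c2 : ∫ x, g x * hR φ x = ∫ x, g x * ψ x := integral_congr_ae (by
    filter_upwards [e1] with x hx; rw [hx])
  rw [c1, c2]
  linarith

/-! ### Coercivity of the linearized operator -/

theorem one_div_wt_sq (x : ℝ) : (wt x ^ 2)⁻¹ = 1 + x ^ 2 := by
  rw [wt_sq, pk, one_div, inv_inv]

theorem pk_mul (x : ℝ) : pk x * (1 + x ^ 2) = 1 := by
  unfold pk
  exact one_div_mul_cancel (by positivity)

theorem cpk_eq (x : ℝ) : cpk x = x * pk x := by
  unfold cpk pk
  ring

theorem sqrt_abs_le_inv_wt (x : ℝ) : √|x| ≤ (wt x)⁻¹ := by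
  rw [wt, inv_inv]
  refine Real.sqrt_le_sqrt ?_
  nlinarith [sq_abs x, sq_nonneg (|x| - 1)]

theorem one_le_inv_wt (x : ℝ) : 1 ≤ (wt x)⁻¹ := (one_le_inv₀ (wt_pos x)).2 (wt_le_one x)

theorem inv_wt_le {x : ℝ} (hx : x ∈ Set.Icc (-2 : ℝ) 2) : (wt x)⁻¹ ≤ 3 := by
  rw [wt, inv_inv]
  refine Real.sqrt_le_iff.2 ⟨by norm_num, ?_⟩
  nlinarith [hx.1, hx.2]

theorem hasDerivAt_wt (x : ℝ) : HasDerivAt wt (-(cpk x * wt x)) x := by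
  have hp : (0:ℝ) < 1 + x ^ 2 := by positivity
  have h1 : HasDerivAt (fun x : ℝ => 1 + x ^ 2) (2 * x) x := by
    simpa using (hasDerivAt_pow 2 x).const_add 1
  have h2 := (h1.sqrt hp.ne').inv (Real.sqrt_pos.2 hp).ne'
  refine h2.congr_deriv ?_
  have h3 := Real.sq_sqrt hp.le
  have h4 := Real.sqrt_pos.2 hp
  rw [h3, cpk, wt]
  field_simp

theorem hasDerivAt_inv_wt (x : ℝ) : HasDerivAt (fun x => (wt x)⁻¹) (x * wt x) x := by
  have h := (hasDerivAt_wt x).inv (wt_pos x).ne'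
  refine h.congr_deriv ?_
  have := wt_pos x
  rw [neg_neg, wt_sq, cpk_eq]
  have := pk_pos x
  field_simp

theorem isPrim_wt : IsPrim wt fun x => -(cpk x * wt x) :=
  .of_hasDerivAt hasDerivAt_wt (continuous_cpk.mul continuous_wt).neg

theorem isPrim_inv_wt : IsPrim (fun x => (wt x)⁻¹) fun x => x * wt x :=
  .of_hasDerivAt hasDerivAt_inv_wt (continuous_id.mul continuous_wt)

/-- Cauchy–Schwarz against the indicator of the interval, which supplies √|x|. -/
theorem abs_intervalIntegral_le {g m : ℝ → ℝ} {K x : ℝ} (hK : 0 < K)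
    (hg : MemLp g 2)     (hm : ∀ t ∈ Set.uIoc 0 x, |m t| ≤ K * |g t|) :
    |∫ t in (0:ℝ)..x, m t| ≤ K * (√|x| * nrm g) := by
  have hli : LocallyIntegrable fun t => |g t| := (hg.abs).locallyIntegrable (by norm_num)
  have h1 : |∫ t in (0:ℝ)..x, m t| ≤ |∫ t in (0:ℝ)..x, (K * |g t|)| :=
    intervalIntegral.norm_integral_le_abs_of_norm_le (f := m)
      ((ae_restrict_iff' measurableSet_uIoc).2 (.of_forall hm))
      ((hli.intervalIntegrable' 0 x).const_mul K)
  refine h1.trans ?_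
  rw [intervalIntegral.integral_const_mul, abs_mul, abs_of_pos hK]
  refine mul_le_mul_of_nonneg_left ?_ hK.le
  set s : ℝ → ℝ := (Set.uIoc 0 x).indicator 1
  have hs : MemLp s 2 := memLp_indicator_const 2 measurableSet_uIoc 1 (.inr (by
    rw [Set.uIoc, Real.volume_Ioc]; exact ENNReal.ofReal_ne_top))
  have h2 : |∫ t in (0:ℝ)..x, (|g t|)| = |∫ t, (s t * |g t|)| := by
    rw [intervalIntegral.abs_integral_eq_abs_integral_uIoc, ← integral_indicator measurableSet_uIoc]
    congr 2
    funext t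
    by_cases ht : t ∈ Set.uIoc 0 x <;> simp [s, ht]
  rw [h2]
  refine (abs_integral_mul_le hs hg.abs).trans_eq ?_
  have h3 : nrm (fun t => |g t|) = nrm g := by simp [nrm]
  have h4 : nrm s = √|x| := by
    unfold nrm
    congr 1
    have : ∀ t, s t ^ 2 = (Set.uIoc 0 x).indicator 1 t := fun t => by
      by_cases ht : t ∈ Set.uIoc 0 x <;> simp [s, ht]
    simp_rw [this]
    rw [integral_indicator_one measurableSet_uIoc, Set.uIoc, Measure.real, Real.volume_Ioc,
      ENNReal.toReal_ofReal (by simp)]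
    rcases le_total 0 x with h | h
    · simp [h, abs_of_nonneg h]
    · simp [h, abs_of_nonpos h]
  rw [h4]
  exact congrArg _ h3

/-- Growth of a primitive of a function controlled by `(1 + x²) g`, `g ∈ L²`. -/
theorem IsPrim.abs_sub_le {f m g : ℝ → ℝ} (h : IsPrim f m) (hg : MemLp g 2)
    (hm : ∀ t, |m t| ≤ (1 + t ^ 2) * |g t|) (x : ℝ) :
    |f x - f 0| ≤ (wt x ^ 3)⁻¹ * nrm g := by
  have h1 := abs_intervalIntegral_le (m := m) (K := 1 + x ^ 2) (x := x) (by positivity) hg fun t ht => by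
    refine (hm t).trans (mul_le_mul_of_nonneg_right ?_ (abs_nonneg _))
    have : |t| ≤ |x| := by
      rcases Set.mem_uIoc.1 ht with h | h
      · rw [abs_of_pos h.1, abs_of_pos (h.1.trans_le h.2)]; exact h.2
      · rw [abs_of_nonpos h.2, abs_of_neg (h.1.trans_le h.2)]; linarith [h.1]
    have := sq_le_sq.2 this
    linarith
  rw [h.sub_eq]
  refine h1.trans ?_
  have e : (wt x ^ 3)⁻¹ = (1 + x ^ 2) * (wt x)⁻¹ := by
    rw [← one_div_wt_sq, ← mul_inv]
    congr 1
  rw [e, mul_assoc]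
  exact mul_le_mul_of_nonneg_left (mul_le_mul_of_nonneg_right (sqrt_abs_le_inv_wt x)
    (nrm_nonneg _)) (by positivity)

/-! ### Upper and lower bounds for integrals against the cut-off -/

namespace IsCutoff

variable {χ : ℝ → ℝ}

theorem eq_zero (h : IsCutoff χ) {x : ℝ} (hx : x ∉ Set.Icc (-2 : ℝ) 2) : χ x = 0 :=
  image_eq_zero_of_notMem_tsupport fun h' => hx (h.tsupport_subset h')

theorem hasCompactSupport (h : IsCutoff χ) : HasCompactSupport χ :=
  isCompact_Icc.of_isClosed_subset (isClosed_tsupport χ) h.tsupport_subset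

theorem integrable_mul (h : IsCutoff χ) {u : ℝ → ℝ} (hu : Continuous u) :
    Integrable fun x => u x * χ x :=
  (hu.mul h.contDiff.continuous).integrable_of_hasCompactSupport h.hasCompactSupport.mul_left

/-- The factor 4 is the length of [-2, 2]. -/
theorem abs_integral_le (h : IsCutoff χ) {u : ℝ → ℝ} {C : ℝ}
    (hC : ∀ x ∈ Set.Icc (-2 : ℝ) 2, |u x| ≤ C) : |∫ x, u x * χ x| ≤ 4 * C := by
  have hC0 : 0 ≤ C := (abs_nonneg _).trans (hC 0 (by norm_num))
  have h1 : ∫ x, u x * χ x = ∫ x in Set.Icc (-2 : ℝ) 2, u x * χ x := by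
    rw [setIntegral_eq_integral_of_forall_compl_eq_zero]
    intro x hx
    rw [h.eq_zero hx, mul_zero]
  rw [h1]
  have h2 := norm_setIntegral_le_of_norm_le_const (μ := volume) (s := Set.Icc (-2 : ℝ) 2)
    (f := fun x => u x * χ x) (C := C) (by simp) fun x hx => by
      rw [norm_mul, Real.norm_eq_abs, Real.norm_eq_abs, abs_of_nonneg (h.nonneg x)]
      exact (mul_le_of_le_one_right (abs_nonneg _) (h.le_one x)).trans (hC x hx)
  refine h2.trans_eq ?_
  rw [Measure.real, Real.volume_Icc, ENNReal.toReal_ofReal (by norm_num)]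
  ring

theorem le_integral (h : IsCutoff χ) {u : ℝ → ℝ} (hu : Continuous u) (h0 : ∀ x, 0 ≤ u x) :
    ∫ x in (-1 : ℝ)..1, u x ≤ ∫ x, u x * χ x := by
  rw [intervalIntegral.integral_of_le (by norm_num)]
  refine le_trans (le_of_eq ?_) (setIntegral_le_integral (s := Set.Ioc (-1 : ℝ) 1)
    (h.integrable_mul hu) (.of_forall fun x => mul_nonneg (h0 x) (h.nonneg x)))
  refine setIntegral_congr_fun measurableSet_Ioc fun x hx => ?_
  simp only [h.eq_one x (Set.Ioc_subset_Icc_self hx), mul_one]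

end IsCutoff

/-- Coercivity for the imaginary part of the linearized operator. -/
theorem abs_le_of_imag_orthogonal {χ b b' : ℝ → ℝ} (hχ : IsCutoff χ) (hb : IsPrim b b')
    (mb : MemLp b 2) (mb' : MemLp b' 2) (orth : ∫ x, b x * (wt x * χ x) = 0) (x : ℝ) :
    |b x| ≤ 13 * nrm (fun x => wt x * (b' x + cpk x * b x)) * (wt x ^ 2)⁻¹ := by
  set δ := nrm (fun x => wt x * (b' x + cpk x * b x)) with hδ
  have hδ0 : 0 ≤ δ := nrm_nonneg _
  -- Integrating factor: (⟨x⟩b)' = ⟨x⟩(b' + x/(1+x²) b). The kernel is spanned by ⟨x⟩⁻¹, that is, by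
  -- the phase direction iQ.
  set g : ℝ → ℝ := fun x => b x * (wt x)⁻¹ with hg
  have m1 : MemLp (fun x => wt x * (b' x + cpk x * b x)) 2 :=
    memLp_wt_mul (mb'.add (memLp_cpk_mul mb))
  have hp := hb.mul isPrim_inv_wt
  have hgr : ∀ x, |g x - g 0| ≤ (wt x ^ 3)⁻¹ * δ := hp.abs_sub_le m1 fun t => by
    have : b' t * (wt t)⁻¹ + b t * (t * wt t) =
        (1 + t ^ 2) * (wt t * (b' t + cpk t * b t)) := by
      rw [← one_div_wt_sq, cpk_eq, ← wt_sq]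
      have := wt_pos t
      field_simp
    rw [this, abs_mul, abs_of_pos (by positivity)]
  have hgc : Continuous g := hp.continuous
  have o2 : ∫ x, g x * pk x * χ x = 0 := by
    rw [← orth]
    refine integral_congr_ae (.of_forall fun x => ?_)
    have := wt_pos x
    simp only [hg, ← wt_sq]
    field_simp
  -- Orthogonality determines the constant of integration: the weighted average of `g` vanishes, so
  -- `g 0` is controlled by the oscillation of `g`.
  have e1 : g 0 * ∫ x, pk x * χ x = -∫ x, ((g x - g 0) * pk x) * χ x := by
    have : ∀ x, (g x - g 0) * pk x * χ x = g x * pk x * χ x - g 0 * (pk x * χ x) := fun x => by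
      ring
    simp_rw [this]
    rw [integral_sub (hχ.integrable_mul (u := fun x => g x * pk x) (hgc.mul continuous_pk))
      ((hχ.integrable_mul continuous_pk).const_mul _), o2, integral_const_mul]
    ring
  have e2 : |∫ x, ((g x - g 0) * pk x) * χ x| ≤ 4 * (3 * δ) := hχ.abs_integral_le fun x hx => by
    rw [abs_mul, abs_of_pos (pk_pos x), ← wt_sq]
    calc |g x - g 0| * wt x ^ 2 ≤ (wt x ^ 3)⁻¹ * δ * wt x ^ 2 := by gcongr; exact hgr x
      _ = (wt x)⁻¹ * δ := by have := wt_pos x; field_simp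
      _ ≤ 3 * δ := by gcongr; exact inv_wt_le hx
  have e3 : 1 ≤ ∫ x, pk x * χ x := by
    refine le_trans ?_ (hχ.le_integral continuous_pk fun x => (pk_pos x).le)
    have : ∫ x in (-1:ℝ)..1, (1/2 : ℝ) ≤ ∫ x in (-1:ℝ)..1, pk x := by
      refine intervalIntegral.integral_mono_on (by norm_num) (by simp)
        (continuous_pk.intervalIntegrable _ _) fun x hx => ?_
      unfold pk
      rw [div_le_div_iff₀ (by norm_num) (by positivity)]
      nlinarith [hx.1, hx.2]
    refine le_trans (le_of_eq ?_) this
    rw [intervalIntegral.integral_const]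
    norm_num
  have e4 : |g 0| ≤ 12 * δ := by
    have h1 := congrArg abs e1
    rw [abs_mul, abs_neg, abs_of_pos (by linarith : 0 < ∫ x, pk x * χ x)] at h1
    nlinarith [abs_nonneg (g 0)]
  -- 13 = 12 + 1: the bound for `g 0` plus the growth of `g - g 0`. The 12 is the length 4 of [-2,
  -- 2] times the bound 3 for ⟨x⟩ there.
  have e5 : |g x| ≤ 13 * δ * (wt x ^ 3)⁻¹ := by
    have h1 := abs_sub_abs_le_abs_sub (g x) (g 0)
    have h2 := hgr x
    have h3 : 1 ≤ (wt x ^ 3)⁻¹ := by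
      rw [← inv_pow]; exact one_le_pow₀ (one_le_inv_wt x)
    nlinarith [mul_le_mul_of_nonneg_left h3 hδ0]
  have e6 : b x = g x * wt x := by
    have := wt_pos x
    simp only [hg]
    field_simp
  rw [e6, abs_mul, abs_of_pos (wt_pos x)]
  calc |g x| * wt x ≤ 13 * δ * (wt x ^ 3)⁻¹ * wt x := by
        gcongr
        exact (wt_pos x).le
    _ = _ := by have := wt_pos x; field_simp

/-- Coercivity for the real part of the linearized operator. -/
theorem abs_le_of_real_orthogonal {χ w w' : ℝ → ℝ} (hχ : IsCutoff χ) (hw : IsPrim w w')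
    (mw : MemLp w 2) (mw' : MemLp w' 2)
    (orth₁ : ∫ x, w x * ((x ^ 2 - 1) * pk x * χ x) = 0)
    (orth₂ : ∫ x, w x * (x * pk x * χ x) = 0) (x : ℝ) :
    |w x| ≤ 772 * nrm (fun x => w' x + 2 * (cpk x * w x + pk x * hR w x)) * (wt x)⁻¹ := by
  set f : ℝ → ℝ := fun x => w' x + 2 * (cpk x * w x + pk x * hR w x) with hf
  set δ := nrm f with hδ
  have hδ0 : 0 ≤ δ := nrm_nonneg _
  have m1 : MemLp (fun x => cpk x * w x + pk x * hR w x) 2 :=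
    (memLp_cpk_mul mw).add (memLp_pk_mul memLp_hR)
  have mf : MemLp f 2 := mw'.add (m1.const_mul 2)
  obtain ⟨G, hG, hGe⟩ := hw.exists_hR mw mw'
  have hHf : hR f =ᵐ[volume] fun x => hR w' x + 2 * (cpk x * hR w x - pk x * w x) := by
    filter_upwards [hR_add mw' (m1.const_mul 2), hR_const_mul 2 m1,
      hR_cpk_mul_add_pk_mul_hR mw] with x h1 h2 h3
    rw [hf, h1, h2, h3]
  have p1 : IsPrim (fun x : ℝ => x ^ 2 - 1) fun x => 2 * x :=
    .of_hasDerivAt (fun x => by simpa using (hasDerivAt_pow 2 x).sub_const 1) (by fun_prop)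
  have p2 : IsPrim (fun x : ℝ => 2 * x) fun _ => 2 :=
    .of_hasDerivAt (fun x => by simpa using (hasDerivAt_id x).const_mul 2) (by fun_prop)
  -- `Ψ₁` + i`Ψ₂` = (x+i)²(w + iℋw), with `G` the continuous version of ℋw. Since f + iℋf = F' +
  -- 2F/(x+i) for F = w + iℋw, its derivative is (x+i)²(f + iℋf).
  set Ψ₁ : ℝ → ℝ := fun x => (x ^ 2 - 1) * w x - 2 * x * G x with hΨ₁
  set Ψ₂ : ℝ → ℝ := fun x => (x ^ 2 - 1) * G x + 2 * x * w x with hΨ₂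
  have q1 : IsPrim Ψ₁ fun x => (x ^ 2 - 1) * f x - 2 * x * hR f x := by
    refine ((p1.mul hw).sub (p2.mul hG)).congr_deriv ?_
    filter_upwards [hHf, hGe] with x h1 h2
    rw [h1, ← h2, hf]
    simp only [cpk_eq]
    have := pk_mul x
    linear_combination (2 * hR w x - 2 * x * w x) * this
  have q2 : IsPrim Ψ₂ fun x => (x ^ 2 - 1) * hR f x + 2 * x * f x := by
    refine ((p1.mul hG).add (p2.mul hw)).congr_deriv ?_
    filter_upwards [hHf, hGe] with x h1 h2
    rw [h1, ← h2, hf]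
    simp only [cpk_eq]
    have := pk_mul x
    linear_combination (-2 * w x - 2 * x * hR w x) * this
  have mf1 : MemLp (fun x => |f x|) 2 := mf.abs
  have mf2 : MemLp (fun x => |hR f x|) 2 := memLp_hR.abs
  have mfa : MemLp (fun x => |f x| + |hR f x|) 2 := mf1.add mf2
  have nfa : nrm (fun x => |f x| + |hR f x|) ≤ 2 * δ := by
    refine (nrm_add_le mf1 mf2).trans_eq ?_
    have : ∀ g : ℝ → ℝ, nrm (fun x => |g x|) = nrm g := fun g => by simp [nrm]
    rw [this, this, nrm_hR mf]
    ring
  have bnd : ∀ t : ℝ, |t ^ 2 - 1| ≤ 1 + t ^ 2 ∧ |2 * t| ≤ 1 + t ^ 2 := fun t =>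
    ⟨abs_le.2 ⟨by nlinarith [sq_nonneg t], by nlinarith [sq_nonneg t]⟩,
      abs_le.2 ⟨by nlinarith [sq_nonneg (t + 1)], by nlinarith [sq_nonneg (t - 1)]⟩⟩
  have g1 : ∀ x, |Ψ₁ x - Ψ₁ 0| ≤ (wt x ^ 3)⁻¹ * (2 * δ) := fun x =>
    (q1.abs_sub_le mfa (fun t => by
      rw [abs_of_nonneg (by positivity : 0 ≤ |f t| + |hR f t|), mul_add (1 + t ^ 2) |f t| |hR f t|]
      refine (abs_sub _ _).trans (add_le_add ?_ ?_)
      · rw [abs_mul]; exact mul_le_mul_of_nonneg_right (bnd t).1 (abs_nonneg _)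
      · rw [abs_mul]; exact mul_le_mul_of_nonneg_right (bnd t).2 (abs_nonneg _)) x).trans
      (mul_le_mul_of_nonneg_left nfa (by have := wt_pos x; positivity))
  have g2 : ∀ x, |Ψ₂ x - Ψ₂ 0| ≤ (wt x ^ 3)⁻¹ * (2 * δ) := fun x =>
    (q2.abs_sub_le mfa (fun t => by
      rw [abs_of_nonneg (by positivity : 0 ≤ |f t| + |hR f t|), mul_add (1 + t ^ 2) |f t| |hR f t|,
        add_comm (_ * |f t|)]
      refine (abs_add_le _ _).trans (add_le_add ?_ ?_)
      · rw [abs_mul]; exact mul_le_mul_of_nonneg_right (bnd t).1 (abs_nonneg _)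
      · rw [abs_mul]; exact mul_le_mul_of_nonneg_right (bnd t).2 (abs_nonneg _)) x).trans
      (mul_le_mul_of_nonneg_left nfa (by have := wt_pos x; positivity))
  set α := Ψ₁ 0
  set β := Ψ₂ 0
  -- With γ = α + iβ the value at the origin, Re(γ/(x+i)²) = `L x * pk x ^ 2` is the kernel
  -- component of `w`; what remains is governed by `f`.
  set L : ℝ → ℝ := fun x => (x ^ 2 - 1) * α + 2 * x * β with hL
  have hLc : Continuous L := by simp only [hL]; fun_prop
  have hLb : ∀ x, |L x| ≤ (1 + x ^ 2) * (|α| + |β|) := fun x => by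
    rw [mul_add]
    refine (abs_add_le _ _).trans (add_le_add ?_ ?_)
    · rw [abs_mul]; exact mul_le_mul_of_nonneg_right (bnd x).1 (abs_nonneg _)
    · rw [abs_mul]; exact mul_le_mul_of_nonneg_right (bnd x).2 (abs_nonneg _)
  have hwe : ∀ x, w x - L x * pk x ^ 2 =
      ((x ^ 2 - 1) * (Ψ₁ x - α) + 2 * x * (Ψ₂ x - β)) * pk x ^ 2 := fun x => by
    have := pk_mul x
    simp only [hL, hΨ₁, hΨ₂]
    linear_combination (-(w x * (pk x * (1 + x ^ 2) + 1))) * this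
  have hE : ∀ x, |w x - L x * pk x ^ 2| ≤ 4 * δ * (wt x)⁻¹ := fun x => by
    have hwp := wt_pos x
    rw [hwe, abs_mul, abs_of_pos (pow_pos (pk_pos x) 2)]
    have h1 : |(x ^ 2 - 1) * (Ψ₁ x - α) + 2 * x * (Ψ₂ x - β)| ≤
        (1 + x ^ 2) * ((wt x ^ 3)⁻¹ * (2 * δ)) + (1 + x ^ 2) * ((wt x ^ 3)⁻¹ * (2 * δ)) := by
      refine (abs_add_le _ _).trans (add_le_add ?_ ?_)
      · rw [abs_mul]
        exact mul_le_mul (bnd x).1 (g1 x) (abs_nonneg _) (by positivity)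
      · rw [abs_mul]
        exact mul_le_mul (bnd x).2 (g2 x) (abs_nonneg _) (by positivity)
    refine (mul_le_mul_of_nonneg_right h1 (sq_nonneg _)).trans_eq ?_
    rw [← one_div_wt_sq, ← wt_sq]
    field_simp
    ring
  -- The two orthogonality conditions combine into one test function adapted to the kernel
  -- component, which makes the form in (α, β) below definite.
  have o3 : ∫ x, w x * (L x * pk x) * χ x = 0 := by
    have i1 : Integrable fun x => w x * ((x ^ 2 - 1) * pk x * χ x) := by
      have := hχ.integrable_mul (u := fun x => w x * ((x ^ 2 - 1) * pk x))
        (hw.continuous.mul ((by fun_prop : Continuous fun x : ℝ => x ^ 2 - 1).mul continuous_pk))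
      simpa only [mul_assoc] using this
    have i2 : Integrable fun x => w x * (x * pk x * χ x) := by
      have := hχ.integrable_mul (u := fun x => w x * (x * pk x))
        (hw.continuous.mul (continuous_id.mul continuous_pk))
      simpa only [mul_assoc] using this
    have : ∀ x, w x * (L x * pk x) * χ x = α * (w x * ((x ^ 2 - 1) * pk x * χ x)) +
        2 * β * (w x * (x * pk x * χ x)) := fun x => by simp only [hL]; ring
    simp_rw [this]
    rw [integral_add (i1.const_mul _) (i2.const_mul _), integral_const_mul, integral_const_mul,
      orth₁, orth₂, mul_zero, mul_zero, add_zero]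
  have e1 : ∫ x, (L x ^ 2 * pk x ^ 3) * χ x =
      -∫ x, ((w x - L x * pk x ^ 2) * (L x * pk x)) * χ x := by
    have : ∀ x, (w x - L x * pk x ^ 2) * (L x * pk x) * χ x =
        w x * (L x * pk x) * χ x - (L x ^ 2 * pk x ^ 3) * χ x := fun x => by ring
    simp_rw [this]
    rw [integral_sub (hχ.integrable_mul (u := fun x => w x * (L x * pk x))
        (hw.continuous.mul (hLc.mul continuous_pk)))
      (hχ.integrable_mul (u := fun x => L x ^ 2 * pk x ^ 3) ((hLc.pow 2).mul (continuous_pk.pow 3))), o3]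
    ring
  set s := |α| + |β| with hs
  have hs0 : 0 ≤ s := by positivity
  have e2 : |∫ x, ((w x - L x * pk x ^ 2) * (L x * pk x)) * χ x| ≤ 4 * (4 * δ * 3 * s) :=
    hχ.abs_integral_le fun x hx => by
      rw [abs_mul]
      have h1 : |L x * pk x| ≤ s := by
        rw [abs_mul, abs_of_pos (pk_pos x)]
        calc |L x| * pk x ≤ (1 + x ^ 2) * s * pk x :=
              mul_le_mul_of_nonneg_right (hLb x) (pk_pos x).le
          _ = s := by linear_combination s * pk_mul x
      have h2 : |w x - L x * pk x ^ 2| ≤ 4 * δ * 3 :=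
        (hE x).trans (mul_le_mul_of_nonneg_left (inv_wt_le hx) (by positivity))
      exact mul_le_mul h2 h1 (abs_nonneg _) (by positivity)
  have e3 : s ^ 2 / 16 ≤ ∫ x, (L x ^ 2 * pk x ^ 3) * χ x := by
    refine le_trans ?_ (hχ.le_integral ((hLc.pow 2).mul (continuous_pk.pow 3)) fun x => by
      have := pk_pos x; positivity)
    have h1 : ∫ x in (-1:ℝ)..1, L x ^ 2 / 8 ≤ ∫ x in (-1:ℝ)..1, L x ^ 2 * pk x ^ 3 := by
      refine intervalIntegral.integral_mono_on (by norm_num)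
        (((hLc.pow 2).div_const 8).intervalIntegrable _ _)
        (((hLc.pow 2).mul (continuous_pk.pow 3)).intervalIntegrable _ _) fun x hx => ?_
      have h2 : 1 / 2 ≤ pk x := by
        unfold pk
        rw [div_le_div_iff₀ (by norm_num) (by positivity)]
        nlinarith [hx.1, hx.2]
      have h3 : (1 / 2 : ℝ) ^ 3 ≤ pk x ^ 3 := pow_le_pow_left₀ (by norm_num) h2 3
      nlinarith [mul_le_mul_of_nonneg_left h3 (sq_nonneg (L x))]
    have h2 : ∫ x in (-1:ℝ)..1, L x ^ 2 / 8 = (16 / 15 * α ^ 2 + 8 / 3 * β ^ 2) / 8 := by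
      have hd : ∀ x : ℝ, HasDerivAt (fun x : ℝ => (α ^ 2 * (x ^ 5 / 5 - 2 * x ^ 3 / 3 + x) +
          4 * α * β * (x ^ 4 / 4 - x ^ 2 / 2) + 4 * β ^ 2 * (x ^ 3 / 3)) / 8) (L x ^ 2 / 8) x :=
        fun x => by
          have k5 := hasDerivAt_pow 5 x
          have k4 := hasDerivAt_pow 4 x
          have k3 := hasDerivAt_pow 3 x
          have k2 := hasDerivAt_pow 2 x
          have k1 := hasDerivAt_id x
          have := ((((((k5.div_const 5).sub ((k3.const_mul 2).div_const 3)).add k1).const_mul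
            (α ^ 2)).add (((k4.div_const 4).sub (k2.div_const 2)).const_mul (4 * α * β))).add
            ((k3.div_const 3).const_mul (4 * β ^ 2))).div_const 8
          refine this.congr_deriv ?_
          simp only [hL]
          push_cast
          ring
      rw [intervalIntegral.integral_eq_sub_of_hasDerivAt (fun x _ => hd x)
        (((hLc.pow 2).div_const 8).intervalIntegrable _ _)]
      ring
    rw [h2] at h1
    refine le_trans ?_ h1
    rw [hs]
    nlinarith [sq_abs α, sq_abs β, sq_nonneg (|α| - |β|), sq_nonneg α, sq_nonneg β]
  -- 768 = 16 · 48, from s²/16 ≤ 48δs. Adding the 4 of `hE` gives the 772 of the statement.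
  have e4 : s ≤ 768 * δ := by
    have h1 : s ^ 2 / 16 ≤ 4 * (4 * δ * 3 * s) := by
      refine e3.trans (le_trans ?_ e2)
      rw [e1]
      exact neg_le_abs _
    by_contra hlt
    push Not at hlt
    have : 0 < s := lt_of_le_of_lt (by positivity) hlt
    nlinarith
  have h1 := abs_sub_abs_le_abs_sub (w x) (L x * pk x ^ 2)
  have h2 : |L x * pk x ^ 2| ≤ s * (wt x)⁻¹ := by
    rw [abs_mul, abs_of_pos (pow_pos (pk_pos x) 2)]
    calc |L x| * pk x ^ 2 ≤ (1 + x ^ 2) * s * pk x ^ 2 :=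
          mul_le_mul_of_nonneg_right (hLb x) (sq_nonneg _)
      _ = s * pk x := by linear_combination s * pk x * pk_mul x
      _ ≤ s * (wt x)⁻¹ :=
          mul_le_mul_of_nonneg_left ((pk_le_one x).trans (one_le_inv_wt x)) hs0
  have h3 := hE x
  have h4 : s * (wt x)⁻¹ ≤ 768 * δ * (wt x)⁻¹ :=
    mul_le_mul_of_nonneg_right e4 (inv_nonneg.2 (wt_pos x).le)
  linarith

/-! ### Coercivity of the Bogomol'nyi residual -/

theorem nrm_le_add {f g₁ g₂ : ℝ → ℝ} {c₁ c₂ : ℝ} (h₁ : 0 ≤ c₁) (h₂ : 0 ≤ c₂)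
    (m₁ : MemLp g₁ 2) (m₂ : MemLp g₂ 2) (h : ∀ᵐ x, |f x| ≤ c₁ * |g₁ x| + c₂ * |g₂ x|) :
    nrm f ≤ c₁ * nrm g₁ + c₂ * nrm g₂ := by
  have n₁ : MemLp (fun x => c₁ * |g₁ x|) 2 := m₁.abs.const_mul c₁
  have n₂ : MemLp (fun x => c₂ * |g₂ x|) 2 := m₂.abs.const_mul c₂
  have e : ∀ (c : ℝ) (g : ℝ → ℝ), 0 ≤ c → nrm (fun x => c * |g x|) = c * nrm g := by
    intro c g hc
    rw [nrm_const_mul, abs_of_nonneg hc]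
    simp [nrm]
  have := nrm_mono (f := f) zero_le_one (n₁.add n₂) (by
    filter_upwards [h] with x hx
    rw [one_mul]
    exact hx.trans (le_abs_self _))
  rw [one_mul] at this
  refine this.trans ((nrm_add_le n₁ n₂).trans_eq ?_)
  rw [e _ _ h₁, e _ _ h₂]

theorem nrm_le_add₃ {f g₁ g₂ g₃ : ℝ → ℝ} {c₁ c₂ c₃ : ℝ} (h₁ : 0 ≤ c₁) (h₂ : 0 ≤ c₂) (h₃ : 0 ≤ c₃)
    (m₁ : MemLp g₁ 2) (m₂ : MemLp g₂ 2) (m₃ : MemLp g₃ 2)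
    (h : ∀ᵐ x, |f x| ≤ c₁ * |g₁ x| + c₂ * |g₂ x| + c₃ * |g₃ x|) :
    nrm f ≤ c₁ * nrm g₁ + c₂ * nrm g₂ + c₃ * nrm g₃ := by
  have n₁ : MemLp (fun x => c₁ * |g₁ x| + c₂ * |g₂ x|) 2 :=
    (m₁.abs.const_mul c₁).add (m₂.abs.const_mul c₂)
  have e := nrm_le_add (f := fun x => c₁ * |g₁ x| + c₂ * |g₂ x|) h₁ h₂ m₁ m₂
    (.of_forall fun x => by rw [abs_of_nonneg (by positivity)])
  have := nrm_le_add (f := f) zero_le_one h₃ n₁ m₃ (by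
    filter_upwards [h] with x hx
    rwa [one_mul, abs_of_nonneg (by positivity : 0 ≤ c₁ * |g₁ x| + c₂ * |g₂ x|)])
  linarith

theorem nrm_le_add₄ {f g₁ g₂ g₃ g₄ : ℝ → ℝ} {c₁ c₂ c₃ c₄ : ℝ} (h₁ : 0 ≤ c₁) (h₂ : 0 ≤ c₂)
    (h₃ : 0 ≤ c₃) (h₄ : 0 ≤ c₄) (m₁ : MemLp g₁ 2) (m₂ : MemLp g₂ 2) (m₃ : MemLp g₃ 2)
    (m₄ : MemLp g₄ 2)
    (h : ∀ᵐ x, |f x| ≤ c₁ * |g₁ x| + c₂ * |g₂ x| + c₃ * |g₃ x| + c₄ * |g₄ x|) :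
    nrm f ≤ c₁ * nrm g₁ + c₂ * nrm g₂ + c₃ * nrm g₃ + c₄ * nrm g₄ := by
  have n₁ : MemLp (fun x => c₁ * |g₁ x| + c₂ * |g₂ x|) 2 :=
    (m₁.abs.const_mul c₁).add (m₂.abs.const_mul c₂)
  have e := nrm_le_add (f := fun x => c₁ * |g₁ x| + c₂ * |g₂ x|) h₁ h₂ m₁ m₂
    (.of_forall fun x => by rw [abs_of_nonneg (by positivity)])
  have := nrm_le_add₃ (f := f) zero_le_one h₃ h₄ n₁ m₃ m₄ (by
    filter_upwards [h] with x hx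
    rwa [one_mul, abs_of_nonneg (by positivity : 0 ≤ c₁ * |g₁ x| + c₂ * |g₂ x|)])
  linarith

theorem integral_comb₅ {f₁ f₂ f₃ f₄ f₅ : ℝ → ℝ} {c₁ c₂ c₃ c₄ c₅ : ℝ} (i₁ : Integrable f₁)
    (i₂ : Integrable f₂) (i₃ : Integrable f₃) (i₄ : Integrable f₄) (i₅ : Integrable f₅) :
    ∫ x, (c₁ * f₁ x + c₂ * f₂ x + c₃ * f₃ x + c₄ * f₄ x + c₅ * f₅ x) =
      c₁ * (∫ x, f₁ x) + c₂ * (∫ x, f₂ x) + c₃ * (∫ x, f₃ x) + c₄ * (∫ x, f₄ x) +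
        c₅ * ∫ x, f₅ x := by
  have j₂ : Integrable fun x => c₁ * f₁ x + c₂ * f₂ x := (i₁.const_mul _).add (i₂.const_mul _)
  have j₃ : Integrable fun x => c₁ * f₁ x + c₂ * f₂ x + c₃ * f₃ x := j₂.add (i₃.const_mul _)
  have j₄ : Integrable fun x => c₁ * f₁ x + c₂ * f₂ x + c₃ * f₃ x + c₄ * f₄ x :=
    j₃.add (i₄.const_mul _)
  rw [integral_add j₄ (i₅.const_mul _), integral_add j₃ (i₄.const_mul _),
    integral_add j₂ (i₃.const_mul _), integral_add (i₁.const_mul _) (i₂.const_mul _)]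
  simp only [integral_const_mul]

/-- The density `|a + i b|²`. -/
noncomputable def dens (a b : ℝ → ℝ) (x : ℝ) : ℝ := a x ^ 2 + b x ^ 2

/-- The perturbation `√2 w a + (a² + b²) / 2` of the density `|Q|² / 2`, where `w = ⟨x⟩⁻¹`. -/
noncomputable def densPert (a b : ℝ → ℝ) (x : ℝ) : ℝ := √2 * (wt x * a x) + 1 / 2 * dens a b x

/-- Real part of `𝐃_v v` at `v = Q + a + i b`. -/
noncomputable def resRe (a a' b : ℝ → ℝ) (x : ℝ) : ℝ :=
  a' x + cpk x * a x + a x * hR (densPert a b) x + √2 * (wt x * hR (densPert a b) x)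

/-- Imaginary part of `𝐃_v v` at `v = Q + a + i b`. -/
noncomputable def resIm (a b b' : ℝ → ℝ) (x : ℝ) : ℝ :=
  b' x + cpk x * b x + b x * hR (densPert a b) x

/-- A perturbation `a + i b` of `Q` in `H¹` with sup norm at most `A` and weighted norm `l`. -/
structure IsPert (a a' b b' : ℝ → ℝ) (A l : ℝ) : Prop where
  ha : IsPrim a a'
  hb : IsPrim b b'
  ma : MemLp a 2
  ma' : MemLp a' 2
  mb : MemLp b 2
  mb' : MemLp b' 2
  abs_a_le : ∀ x, |a x| ≤ A
  abs_b_le : ∀ x, |b x| ≤ A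
  A_le : A ≤ 1
  l_nonneg : 0 ≤ l
  l_sq : nrm (fun x => wt x * a x) ^ 2 + nrm (fun x => wt x * b x) ^ 2 = l ^ 2

theorem sqrt_two_bounds : √2 * √2 = 2 ∧ 1 ≤ √2 ∧ √2 ≤ 3 / 2 := by
  have h := Real.mul_self_sqrt (show (0:ℝ) ≤ 2 by norm_num)
  have h0 := Real.sqrt_nonneg 2
  exact ⟨h, by nlinarith, by nlinarith⟩

namespace IsPert

variable {a a' b b' : ℝ → ℝ} {A l : ℝ}

theorem A_nonneg (h : IsPert a a' b b' A l) : 0 ≤ A := (abs_nonneg _).trans (h.abs_a_le 0)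

theorem nrm_wt_a_le (h : IsPert a a' b b' A l) : nrm (fun x => wt x * a x) ≤ l :=
  le_of_sq_le_sq (by nlinarith [h.l_sq, sq_nonneg (nrm fun x => wt x * b x)]) h.l_nonneg

theorem nrm_wt_b_le (h : IsPert a a' b b' A l) : nrm (fun x => wt x * b x) ≤ l :=
  le_of_sq_le_sq (by nlinarith [h.l_sq, sq_nonneg (nrm fun x => wt x * a x)]) h.l_nonneg

theorem memLp_w (h : IsPert a a' b b' A l) : MemLp (fun x => wt x * a x) 2 := memLp_wt_mul h.ma

theorem memLp_dens (h : IsPert a a' b b' A l) : MemLp (dens a b) 2 := by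
  have h1 := memLp_bdd_mul h.ma.1 h.abs_a_le h.ma
  have h2 := memLp_bdd_mul h.mb.1 h.abs_b_le h.mb
  refine (h1.add h2).ae_eq (.of_forall fun x => ?_)
  simp only [Pi.add_apply, dens]
  ring

theorem memLp_densPert (h : IsPert a a' b b' A l) : MemLp (densPert a b) 2 :=
  (h.memLp_w.const_mul _).add (h.memLp_dens.const_mul _)

theorem hR_densPert (h : IsPert a a' b b' A l) :
    hR (densPert a b) =ᵐ[volume]
      fun x => √2 * hR (fun x => wt x * a x) x + 1 / 2 * hR (dens a b) x := by
  filter_upwards [hR_add (h.memLp_w.const_mul (√2)) (h.memLp_dens.const_mul (1 / 2)),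
    hR_const_mul (√2) h.memLp_w, hR_const_mul (1 / 2) h.memLp_dens] with x h1 h2 h3
  rw [← h2, ← h3, ← h1]
  rfl

theorem memLp_a_mul_hR (h : IsPert a a' b b' A l) {f : ℝ → ℝ} :
    MemLp (fun x => a x * hR f x) 2 := memLp_bdd_mul h.ma.1 h.abs_a_le memLp_hR

theorem memLp_b_mul_hR (h : IsPert a a' b b' A l) {f : ℝ → ℝ} :
    MemLp (fun x => b x * hR f x) 2 := memLp_bdd_mul h.mb.1 h.abs_b_le memLp_hR

theorem memLp_resRe (h : IsPert a a' b b' A l) : MemLp (resRe a a' b) 2 :=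
  ((h.ma'.add (memLp_cpk_mul h.ma)).add h.memLp_a_mul_hR).add
    ((memLp_wt_mul memLp_hR).const_mul (√2))

theorem memLp_resIm (h : IsPert a a' b b' A l) : MemLp (resIm a b b') 2 :=
  (h.mb'.add (memLp_cpk_mul h.mb)).add h.memLp_b_mul_hR

theorem isPrim_w (h : IsPert a a' b b' A l) :
    IsPrim (fun x => wt x * a x) fun x => wt x * a' x - cpk x * (wt x * a x) :=
  (isPrim_wt.mul h.ha).congr_deriv (.of_forall fun x => by ring)

theorem memLp_w' (h : IsPert a a' b b' A l) :
    MemLp (fun x => wt x * a' x - cpk x * (wt x * a x)) 2 :=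
  (memLp_wt_mul h.ma').sub (memLp_cpk_mul h.memLp_w)

theorem integral_pk_dens (h : IsPert a a' b b' A l) : ∫ x, pk x * dens a b x = l ^ 2 := by
  rw [← h.l_sq, nrm_wt_mul_sq, nrm_wt_mul_sq, ← integral_add]
  · exact integral_congr_ae (.of_forall fun x => by simp only [dens]; ring)
  · exact (integrable_sq (memLp_wt_mul h.ma)).congr (.of_forall fun x => by
      simp only [mul_pow, wt_sq])
  · exact (integrable_sq (memLp_wt_mul h.mb)).congr (.of_forall fun x => by
      simp only [mul_pow, wt_sq])

/-- One factor of ε is taken in sup norm, so the weighted density is quadratically small. The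
unweighted density is not controlled by `l`, as mass may sit far away. -/
theorem nrm_wt_dens_le (h : IsPert a a' b b' A l) :
    nrm (fun x => wt x * dens a b x) ≤ 2 * A * l := by
  have h1 := nrm_le_add (f := fun x => wt x * dens a b x) h.A_nonneg h.A_nonneg
    (memLp_wt_mul h.ma) (memLp_wt_mul h.mb) (.of_forall fun x => by
      have hw := wt_pos x
      have e : wt x * dens a b x = a x * (wt x * a x) + b x * (wt x * b x) := by
        unfold dens; ring
      rw [e]
      refine (abs_add_le _ _).trans (add_le_add ?_ ?_) <;> rw [abs_mul]
      · exact mul_le_mul_of_nonneg_right (h.abs_a_le x) (abs_nonneg _)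
      · exact mul_le_mul_of_nonneg_right (h.abs_b_le x) (abs_nonneg _))
  nlinarith [h.nrm_wt_a_le, h.nrm_wt_b_le, h.A_nonneg]

theorem nrm_wt_hR_dens_le (h : IsPert a a' b b' A l) :
    nrm (fun x => wt x * hR (dens a b) x) ≤ 2 * A * l + |∫ x, cpk x * dens a b x| :=
  (nrm_wt_mul_hR_le h.memLp_dens).trans (by linarith [h.nrm_wt_dens_le])

/-- Pairing the residual with `Q`. -/
theorem integral_wt_mul_resRe (h : IsPert a a' b b' A l) :
    ∫ x, wt x * resRe a a' b x = 1 / 2 * (∫ x, wt x * a x * hR (dens a b) x) -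
      √2 / 2 * ∫ x, cpk x * dens a b x := by
  obtain ⟨s2, -, -⟩ := sqrt_two_bounds
  have i1 : Integrable fun x => wt x * a' x - cpk x * (wt x * a x) :=
    (integrable_mul memLp_wt h.ma').sub (integrable_mul memLp_cpk h.memLp_w)
  have h0 := h.isPrim_w.integral_eq_zero (integrable_mul memLp_wt h.ma) i1
  have i2 : Integrable fun x => cpk x * (wt x * a x) := integrable_mul memLp_cpk h.memLp_w
  have i3 : Integrable fun x => wt x * a x * hR (fun x => wt x * a x) x :=
    integrable_mul h.memLp_w memLp_hR
  have i4 : Integrable fun x => wt x * a x * hR (dens a b) x := integrable_mul h.memLp_w memLp_hR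
  have i5 : Integrable fun x => pk x * hR (densPert a b) x := integrable_mul memLp_pk memLp_hR
  have i6 : Integrable fun x => cpk x * dens a b x := integrable_mul memLp_cpk h.memLp_dens
  have e1 : ∫ x, wt x * a x * hR (fun x => wt x * a x) x = 0 := by
    have := integral_mul_hR h.memLp_w h.memLp_w
    linarith
  have e2 : ∫ x, pk x * hR (densPert a b) x =
      -(√2 * (∫ x, cpk x * (wt x * a x)) + 1 / 2 * ∫ x, cpk x * dens a b x) := by
    rw [integral_pk_mul_hR h.memLp_densPert, ← integral_const_mul, ← integral_const_mul,
      ← integral_add (i2.const_mul _) (i6.const_mul _)]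
    congr 1
    exact integral_congr_ae (.of_forall fun x => by simp only [densPert]; ring)
  have e3 : ∫ x, wt x * resRe a a' b x = ∫ x, (1 * (wt x * a' x - cpk x * (wt x * a x)) +
      2 * (cpk x * (wt x * a x)) + √2 * (wt x * a x * hR (fun x => wt x * a x) x) +
        1 / 2 * (wt x * a x * hR (dens a b) x) + √2 * (pk x * hR (densPert a b) x)) := by
    refine integral_congr_ae ?_
    filter_upwards [h.hR_densPert] with x hx
    simp only [resRe]
    rw [← wt_sq]
    linear_combination (wt x * a x) * hx
  rw [e3, integral_comb₅ i1 i2 i3 i4 i5, h0, e1, e2]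
  -- The linear terms cancel: the local part contributes 2∫cpk·w, and the nonlocal part, through
  -- ℋ(1/(1+x²)) = x/(1+x²), contributes its negative.
  linear_combination -(∫ x, cpk x * (wt x * a x)) * s2

/-- Cauchy–Schwarz would require the unweighted norm of the density. The splitting 1 = x·`cpk` +
`pk` instead provides a kernel in each piece; commuting ℋ past `cpk` costs two scalar moments and
puts a weight on the density, at the price of a factor `M`. -/
theorem abs_integral_w_mul_hR_dens_le (h : IsPert a a' b b' A l) {M B : ℝ} (hM : nrm a ≤ M)
    (hB : ∫ x, wt x * |a x| ≤ B) :
    |∫ x, wt x * a x * hR (dens a b) x| ≤ 2 * A * l * M +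
      B * (|∫ x, cpk x * dens a b x| + l ^ 2) + l * (2 * A * l + |∫ x, cpk x * dens a b x|) := by
  set α := ∫ x, cpk x * dens a b x with hα
  set v : ℝ → ℝ := fun x => x * wt x * a x with hv
  have hxw : ∀ x, |x * wt x| ≤ 1 := fun x => by
    rw [← sq_le_one_iff_abs_le_one, mul_pow, wt_sq]
    nlinarith [pk_mul x, pk_pos x]
  have mv : MemLp v 2 := memLp_bdd_mul
    (continuous_id.mul continuous_wt).aestronglyMeasurable hxw h.ma
  have nv : nrm v ≤ M := by
    refine le_trans ?_ hM
    have := nrm_mono (f := v) zero_le_one h.ma (.of_forall fun x => by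
      rw [hv, abs_mul]; exact mul_le_mul_of_nonneg_right (hxw x) (abs_nonneg _))
    rwa [one_mul] at this
  have iB : Integrable fun x => wt x * |a x| := integrable_mul memLp_wt h.ma.abs
  have b1 : |∫ x, cpk x * v x| ≤ B := by
    refine le_trans ?_ hB
    refine abs_integral_le_integral_abs.trans
      (integral_mono (integrable_mul memLp_cpk mv).abs iB fun x => ?_)
    simp only [hv, abs_mul]
    have h1 := hxw x
    rw [abs_mul] at h1
    have h2 := mul_le_mul_of_nonneg_right (mul_le_mul (abs_cpk_le_wt x) h1 (by positivity)
      (wt_pos x).le) (abs_nonneg (a x))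
    linarith
  have b2 : |∫ x, pk x * v x| ≤ B := by
    refine le_trans ?_ hB
    refine abs_integral_le_integral_abs.trans
      (integral_mono (integrable_mul memLp_pk mv).abs iB fun x => ?_)
    simp only [hv, abs_mul]
    have h1 := hxw x
    rw [abs_mul] at h1
    have h2 := mul_le_mul_of_nonneg_right (mul_le_mul ((abs_of_pos (pk_pos x)).trans_le
      (pk_le_wt x)) h1 (by positivity) (wt_pos x).le) (abs_nonneg (a x))
    linarith
  have hB0 : 0 ≤ B := (abs_nonneg _).trans b1
  have e1 : ∫ x, wt x * a x * hR (dens a b) x =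
      (∫ x, cpk x * v x * hR (dens a b) x) + ∫ x, wt x * a x * (pk x * hR (dens a b) x) := by
    rw [← integral_add (integrable_mul (memLp_cpk_mul mv) memLp_hR)
      (integrable_mul h.memLp_w (memLp_pk_mul memLp_hR))]
    refine integral_congr_ae (.of_forall fun x => ?_)
    simp only [hv, cpk_eq]
    linear_combination (-(wt x * a x * hR (dens a b) x)) * pk_mul x
  have bil := integral_cpk_bilinear mv h.memLp_dens
  rw [h.integral_pk_dens, ← hα] at bil
  have b3 : |∫ x, dens a b x * (cpk x * hR v x)| ≤ 2 * A * l * M := by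
    -- `cpk` = ⟨x⟩⁻¹ · (x⟨x⟩⁻¹): one factor weights the density, the other is bounded and stays with
    -- ℋv, for which only the mass bound is available.
    have e : ∫ x, dens a b x * (cpk x * hR v x) =
        ∫ x, wt x * dens a b x * (x * wt x * hR v x) := integral_congr_ae (.of_forall fun x => by
      simp only [cpk_eq, ← wt_sq]; ring)
    rw [e]
    refine (abs_integral_mul_le (memLp_wt_mul h.memLp_dens) (memLp_bdd_mul
      (continuous_id.mul continuous_wt).aestronglyMeasurable hxw memLp_hR)).trans ?_
    have h1 : nrm (fun x => x * wt x * hR v x) ≤ M := by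
      refine le_trans ?_ nv
      have := nrm_mono (f := fun x => x * wt x * hR v x) zero_le_one (memLp_hR (f := v))
        (.of_forall fun x => by
        rw [abs_mul]; exact mul_le_mul_of_nonneg_right (hxw x) (abs_nonneg _))
      rwa [one_mul, nrm_hR mv] at this
    exact mul_le_mul h.nrm_wt_dens_le h1 (nrm_nonneg _) ((nrm_nonneg _).trans h.nrm_wt_dens_le)
  have b4 : |∫ x, wt x * a x * (pk x * hR (dens a b) x)| ≤ l * (2 * A * l + |α|) := by
    refine (abs_integral_mul_le h.memLp_w (memLp_pk_mul memLp_hR)).trans ?_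
    refine mul_le_mul h.nrm_wt_a_le ?_ (nrm_nonneg _) h.l_nonneg
    refine le_trans ?_ h.nrm_wt_hR_dens_le
    have := nrm_mono (f := fun x => pk x * hR (dens a b) x) zero_le_one
      (memLp_wt_mul (memLp_hR (f := dens a b))) (.of_forall fun x => by
      rw [abs_mul, abs_mul, one_mul, abs_of_pos (pk_pos x), abs_of_pos (wt_pos x)]
      exact mul_le_mul_of_nonneg_right (pk_le_wt x) (abs_nonneg _))
    rwa [one_mul] at this
  have b5 : |-(1 / Real.pi) * ((∫ x, cpk x * v x) * α - (∫ x, pk x * v x) * l ^ 2)| ≤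
      B * (|α| + l ^ 2) := by
    rw [abs_mul, abs_neg, abs_of_pos (by have := Real.pi_pos; positivity)]
    have h1 : |(∫ x, cpk x * v x) * α - (∫ x, pk x * v x) * l ^ 2| ≤ B * (|α| + l ^ 2) := by
      refine (abs_sub _ _).trans ?_
      rw [abs_mul, abs_mul, abs_of_nonneg (sq_nonneg l), mul_add]
      exact add_le_add (mul_le_mul_of_nonneg_right b1 (abs_nonneg _))
        (mul_le_mul_of_nonneg_right b2 (sq_nonneg _))
    have h2 : 1 / Real.pi ≤ 1 := by
      rw [div_le_one Real.pi_pos]; linarith [Real.pi_gt_three]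
    exact (mul_le_of_le_one_left (abs_nonneg _) h2).trans h1
  rw [e1, eq_sub_of_add_eq bil]
  refine (abs_add_le _ _).trans (add_le_add ((abs_sub _ _).trans ?_) b4)
  linarith

/-- The pairing with Q expresses α through the residual and ∫ w ℋ(|ε|²). The latter again contains
α, but with a coefficient small enough to absorb. -/
theorem abs_integral_cpk_dens_le (h : IsPert a a' b b' A l) {M k κ θ : ℝ} (hM : nrm a ≤ M)
    (hB : ∫ x, wt x * |a x| ≤ θ) (hA : A ≤ θ) (hl : l ≤ θ) (hθ : θ ≤ 1 / 4)
    (hκ : (M + 2) * θ ≤ κ) (hk : nrm (resRe a a' b) ≤ k) :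
    |∫ x, cpk x * dens a b x| ≤ 6 * k + 4 * κ * l := by
  obtain ⟨s2, s3, s4⟩ := sqrt_two_bounds
  have h1 := h.abs_integral_w_mul_hR_dens_le hM hB
  have h2 := h.integral_wt_mul_resRe
  have h3 := abs_integral_mul_le memLp_wt h.memLp_resRe
  set α := ∫ x, cpk x * dens a b x
  set J := ∫ x, wt x * a x * hR (dens a b) x
  set I := ∫ x, wt x * resRe a a' b x
  have hk0 : 0 ≤ k := (nrm_nonneg _).trans hk
  have hM0 : 0 ≤ M := (nrm_nonneg _).trans hM
  have hI : |I| ≤ 2 * k := by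
    refine h3.trans (mul_le_mul ?_ hk (nrm_nonneg _) (by norm_num))
    rw [nrm_wt, Real.sqrt_le_iff]
    exact ⟨by norm_num, by linarith [Real.pi_le_four]⟩
  have e : α = √2 * (1 / 2 * J - I) := by rw [h2]; linear_combination (-α / 2) * s2
  have hα : |α| ≤ 3 / 2 * (1 / 2 * |J| + 2 * k) := by
    rw [e, abs_mul, abs_of_nonneg (Real.sqrt_nonneg 2)]
    refine mul_le_mul s4 ((abs_sub _ _).trans ?_) (abs_nonneg _) (by norm_num)
    rw [abs_mul, abs_of_pos (by norm_num : (0:ℝ) < 1 / 2)]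
    linarith
  have hl0 := h.l_nonneg
  have hA0 := h.A_nonneg
  have hα0 := abs_nonneg α
  have t1 : A * l ≤ θ * l := mul_le_mul_of_nonneg_right hA hl0
  have t2 : A * l * M ≤ θ * l * M := mul_le_mul_of_nonneg_right t1 hM0
  -- θ ≤ 1/4 leaves at most |α|/2 inside |J|, hence 3|α|/8 inside the bound `hα`.
  have t3 : θ * (|α| + l ^ 2) ≤ 1 / 4 * |α| + 1 / 4 * (θ * l) := by nlinarith
  have t4 : l * (2 * A * l + |α|) ≤ 1 / 4 * |α| + 1 / 2 * (θ * l) := by nlinarith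
  have t5 : θ * l * (M + 2) ≤ κ * l := by nlinarith
  have t6 : 0 ≤ θ * l := mul_nonneg (hA0.trans hA) hl0
  have t7 : 0 ≤ θ * l * M := mul_nonneg t6 hM0
  linarith

end IsPert

/-! ### The multiplier estimate for the weighted norm -/

theorem hasDerivAt_cpk (x : ℝ) : HasDerivAt cpk (2 * pk x ^ 2 - pk x) x := by
  have hp : (0:ℝ) < 1 + x ^ 2 := by positivity
  have h1 : HasDerivAt (fun x : ℝ => 1 + x ^ 2) (2 * x) x := by
    simpa using (hasDerivAt_pow 2 x).const_add 1
  refine ((hasDerivAt_id x).div h1 hp.ne').congr_deriv ?_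
  unfold pk
  simp only [id]
  field_simp
  ring

theorem isPrim_cpk : IsPrim cpk fun x => 2 * pk x ^ 2 - pk x :=
  .of_hasDerivAt hasDerivAt_cpk (by have := continuous_pk; fun_prop)

/-- Bookkeeping of the absorption. Apart from negligible terms the right side carries l²/2 from
Young's inequality and twice l²/8, against 3l²/2 on the left. The resulting constant in front of k²
is below 10¹⁵, hence below (10⁸)². -/
theorem absorb_of_small {l A k α Z : ℝ} (hl : 0 ≤ l) (hk : 0 ≤ k)
    (hl' : l ≤ 1 / 10 ^ 9) (hA' : A ≤ 1 / 10 ^ 9) (hα : 0 ≤ α) (hα' : α ≤ 6 * k + 4 / 10 ^ 9 * l)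
    (hZ : 450 * Z ≤ l ^ 2 / 8 + 450 * 900 * (2 * 772 ^ 2 * 4) * (13 * k + 14 / 10 ^ 9 * l) ^ 2)
    (main : 3 / 2 * l ^ 2 ≤ 2 * (l * k) + 2 * Z + (l ^ 2 / 8 + 450 * Z + α ^ 2 + l ^ 4 +
      2 * A * l ^ 2)) : l ≤ 10 ^ 8 * k := by
  have y1 : (13 * k + 14 / 10 ^ 9 * l) ^ 2 ≤ 338 * k ^ 2 + 392 / 10 ^ 18 * l ^ 2 := by
    have := sq_nonneg (13 * k - 14 / 10 ^ 9 * l)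
    ring_nf at this ⊢
    linarith
  have y2 : α ^ 2 ≤ 72 * k ^ 2 + 32 / 10 ^ 18 * l ^ 2 := by
    have h1 := pow_le_pow_left₀ hα hα' 2
    have h2 := sq_nonneg (6 * k - 4 / 10 ^ 9 * l)
    ring_nf at h1 h2 ⊢
    linarith
  have y3 : l ^ 4 ≤ 1 / 10 ^ 9 * l ^ 2 := by
    have h1 : l * l ≤ 1 / 10 ^ 9 * 1 := mul_le_mul hl' (hl'.trans (by norm_num)) hl (by norm_num)
    have h2 := mul_le_mul_of_nonneg_right h1 (sq_nonneg l)
    ring_nf at h2 ⊢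
    linarith
  have y4 : A * l ^ 2 ≤ 1 / 10 ^ 9 * l ^ 2 := mul_le_mul_of_nonneg_right hA' (sq_nonneg l)
  have y5 : 2 * (l * k) ≤ l ^ 2 / 2 + 2 * k ^ 2 := by
    have := sq_nonneg (l - 2 * k)
    ring_nf at this ⊢
    linarith
  have k2 := sq_nonneg k
  have l2 := sq_nonneg l
  refine le_of_sq_le_sq ?_ (by positivity)
  norm_num at hZ y1 y2 y3 y4 ⊢
  linarith

namespace IsPert

variable {a a' b b' : ℝ → ℝ} {A l : ℝ}

theorem isPrim_dens (h : IsPert a a' b b' A l) :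
    IsPrim (dens a b) fun x => 2 * (a x * a' x + b x * b' x) := by
  have h1 := ((h.ha.mul h.ha).add (h.hb.mul h.hb)).congr_deriv
    (g₁ := fun x => 2 * (a x * a' x + b x * b' x)) (.of_forall fun x => by ring)
  have e : dens a b = fun x => a x * a x + b x * b x := funext fun x => by unfold dens; ring
  rwa [e]

/-- Pairing the residual with `x (1 + x²)⁻¹ (a + i b)`. -/
theorem integral_cpk_mul_residual (h : IsPert a a' b b' A l) :
    ∫ x, cpk x * (a x * resRe a a' b x + b x * resIm a b b' x) =
      3 / 2 * l ^ 2 - 2 * (∫ x, pk x ^ 2 * dens a b x) +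
        (∫ x, cpk x * densPert a b x * hR (densPert a b) x) +
        √2 / 2 * (∫ x, cpk x * dens a b x * hR (fun x => wt x * a x) x) +
        1 / 4 * ∫ x, cpk x * dens a b x * hR (dens a b) x := by
  obtain ⟨s2, -, -⟩ := sqrt_two_bounds
  have mn := h.memLp_dens
  have bp : ∀ x, |pk x| ≤ 1 := fun x => by rw [abs_of_pos (pk_pos x)]; exact pk_le_one x
  have i1 : Integrable fun x => (2 * pk x ^ 2 - pk x) * dens a b x +
      cpk x * (2 * (a x * a' x + b x * b' x)) := by
    refine .add ?_ ?_
    · refine integrable_mul (.sub (.const_mul ?_ 2) memLp_pk) mn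
      simpa only [sq] using memLp_pk_mul memLp_pk
    · refine (((integrable_mul (memLp_cpk_mul h.ma) h.ma').add
        (integrable_mul (memLp_cpk_mul h.mb) h.mb')).const_mul 2).congr (.of_forall fun x => ?_)
      simp only [Pi.add_apply]
      ring
  have h0 := (isPrim_cpk.mul h.isPrim_dens).integral_eq_zero (integrable_mul memLp_cpk mn) i1
  have i2 : Integrable fun x => pk x * dens a b x := integrable_mul memLp_pk mn
  have i2' : Integrable fun x => pk x ^ 2 * dens a b x := by
    refine integrable_mul ?_ mn
    simpa only [sq] using memLp_pk_mul memLp_pk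
  have i3 : Integrable fun x => cpk x * densPert a b x * hR (densPert a b) x :=
    integrable_mul (memLp_cpk_mul h.memLp_densPert) memLp_hR
  have i4 : Integrable fun x => cpk x * dens a b x * hR (densPert a b) x :=
    integrable_mul (memLp_cpk_mul mn) memLp_hR
  have i5 : Integrable fun x => cpk x * dens a b x * hR (fun x => wt x * a x) x :=
    integrable_mul (memLp_cpk_mul mn) memLp_hR
  have i6 : Integrable fun x => cpk x * dens a b x * hR (dens a b) x :=
    integrable_mul (memLp_cpk_mul mn) memLp_hR
  have e1 : ∫ x, cpk x * dens a b x * hR (densPert a b) x =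
      √2 * (∫ x, cpk x * dens a b x * hR (fun x => wt x * a x) x) +
        1 / 2 * ∫ x, cpk x * dens a b x * hR (dens a b) x := by
    rw [← integral_const_mul, ← integral_const_mul,
      ← integral_add (i5.const_mul _) (i6.const_mul _)]
    refine integral_congr_ae ?_
    filter_upwards [h.hR_densPert] with x hx
    rw [hx]; ring
  -- The weight 3/2 `pk` - 2 `pk`² is -`cpk`'/2 + `cpk`². The nonlocal part regroups because dens +
  -- √2 w = densPert + dens/2.
  have e2 : ∫ x, cpk x * (a x * resRe a a' b x + b x * resIm a b b' x) =
      ∫ x, (1 / 2 * ((2 * pk x ^ 2 - pk x) * dens a b x +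
          cpk x * (2 * (a x * a' x + b x * b' x))) + 3 / 2 * (pk x * dens a b x) +
        (-2) * (pk x ^ 2 * dens a b x) + 1 * (cpk x * densPert a b x * hR (densPert a b) x) +
        1 / 2 * (cpk x * dens a b x * hR (densPert a b) x)) := by
    refine integral_congr_ae (.of_forall fun x => ?_)
    simp only [resRe, resIm, cpk_eq]
    have hp := pk_mul x
    have e : x ^ 2 * pk x ^ 2 = pk x - pk x ^ 2 := by linear_combination pk x * hp
    have e3 : densPert a b x = √2 * (wt x * a x) + 1 / 2 * dens a b x := rfl
    have e4 : dens a b x = a x ^ 2 + b x ^ 2 := rfl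
    linear_combination dens a b x * e - (x * pk x * hR (densPert a b) x) * e3 -
      (x ^ 2 * pk x ^ 2 + x * pk x * hR (densPert a b) x) * e4
  rw [e2, integral_comb₅ i1 i2 i2' i3 i4, h0, h.integral_pk_dens, e1]
  ring

/-- Removing the quadratic terms from the residual: real part. -/
theorem nrm_wt_linRe_le (h : IsPert a a' b b' A l) {k : ℝ} (hk : nrm (resRe a a' b) ≤ k) :
    nrm (fun x => (wt x * a' x - cpk x * (wt x * a x)) +
      2 * (cpk x * (wt x * a x) + pk x * hR (fun x => wt x * a x) x)) ≤
      k + 6 * A * l + 2 * |∫ x, cpk x * dens a b x| := by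
  obtain ⟨s2, s3, s4⟩ := sqrt_two_bounds
  have hA := h.A_le
  have hA0 := h.A_nonneg
  have h1 := nrm_le_add₃ (f := fun x => (wt x * a' x - cpk x * (wt x * a x)) +
      2 * (cpk x * (wt x * a x) + pk x * hR (fun x => wt x * a x) x)) zero_le_one
      (by positivity : 0 ≤ 2 * A) zero_le_two h.memLp_resRe
      (memLp_hR (f := fun x => wt x * a x)) (memLp_wt_mul (memLp_hR (f := dens a b))) (by
    filter_upwards [h.hR_densPert] with x hx
    have hw := wt_pos x
    have hw1 := wt_le_one x
    have e : (wt x * a' x - cpk x * (wt x * a x)) +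
        2 * (cpk x * (wt x * a x) + pk x * hR (fun x => wt x * a x) x) =
        wt x * resRe a a' b x - (wt x * √2 * a x) * hR (fun x => wt x * a x) x -
          1 / 2 * (a x + √2 * wt x) * (wt x * hR (dens a b) x) := by
      simp only [resRe, hx, ← wt_sq]
      linear_combination (-(wt x ^ 2 * hR (fun x => wt x * a x) x)) * s2
    rw [e]
    refine (abs_sub _ _).trans (add_le_add ((abs_sub _ _).trans (add_le_add ?_ ?_)) ?_)
    · rw [abs_mul, abs_of_pos hw]
      exact mul_le_mul_of_nonneg_right hw1 (abs_nonneg _)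
    · rw [abs_mul, abs_mul, abs_mul, abs_of_pos hw, abs_of_pos (by positivity : 0 < √2)]
      refine mul_le_mul_of_nonneg_right ?_ (abs_nonneg _)
      have : wt x * √2 ≤ 2 := by nlinarith
      exact mul_le_mul this (h.abs_a_le x) (abs_nonneg _) zero_le_two
    · rw [abs_mul]
      refine mul_le_mul_of_nonneg_right ?_ (abs_nonneg _)
      rw [abs_mul, abs_of_pos (by norm_num : (0:ℝ) < 1 / 2)]
      have h3 := abs_add_le (a x) (√2 * wt x)
      rw [abs_of_pos (by positivity : 0 < √2 * wt x)] at h3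
      have h4 := h.abs_a_le x
      have : √2 * wt x ≤ 3 / 2 := by nlinarith
      linarith)
  rw [nrm_hR h.memLp_w] at h1
  have h2 := mul_le_mul_of_nonneg_left h.nrm_wt_a_le (by positivity : 0 ≤ 2 * A)
  have h3 := h.nrm_wt_hR_dens_le
  linarith

/-- Removing the quadratic terms from the residual: imaginary part. -/
theorem nrm_wt_linIm_le (h : IsPert a a' b b' A l) {k : ℝ} (hk : nrm (resIm a b b') ≤ k) :
    nrm (fun x => wt x * (b' x + cpk x * b x)) ≤
      k + 6 * A * l + 2 * |∫ x, cpk x * dens a b x| := by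
  obtain ⟨s2, s3, s4⟩ := sqrt_two_bounds
  have hA := h.A_le
  have hA0 := h.A_nonneg
  have h1 := nrm_le_add₃ (f := fun x => wt x * (b' x + cpk x * b x)) zero_le_one
      (by positivity : 0 ≤ 2 * A) zero_le_two h.memLp_resIm
      (memLp_hR (f := fun x => wt x * a x)) (memLp_wt_mul (memLp_hR (f := dens a b))) (by
    filter_upwards [h.hR_densPert] with x hx
    have hw := wt_pos x
    have hw1 := wt_le_one x
    have e : wt x * (b' x + cpk x * b x) =
        wt x * resIm a b b' x - (wt x * √2 * b x) * hR (fun x => wt x * a x) x -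
          1 / 2 * b x * (wt x * hR (dens a b) x) := by
      simp only [resIm, hx]
      ring
    rw [e]
    refine (abs_sub _ _).trans (add_le_add ((abs_sub _ _).trans (add_le_add ?_ ?_)) ?_)
    · rw [abs_mul, abs_of_pos hw]
      exact mul_le_mul_of_nonneg_right hw1 (abs_nonneg _)
    · rw [abs_mul, abs_mul, abs_mul, abs_of_pos hw, abs_of_pos (by positivity : 0 < √2)]
      refine mul_le_mul_of_nonneg_right ?_ (abs_nonneg _)
      have : wt x * √2 ≤ 2 := by nlinarith
      exact mul_le_mul this (h.abs_b_le x) (abs_nonneg _) zero_le_two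
    · rw [abs_mul]
      refine mul_le_mul_of_nonneg_right ?_ (abs_nonneg _)
      rw [abs_mul, abs_of_pos (by norm_num : (0:ℝ) < 1 / 2)]
      have h4 := h.abs_b_le x
      linarith)
  rw [nrm_hR h.memLp_w] at h1
  have h2 := mul_le_mul_of_nonneg_left h.nrm_wt_a_le (by positivity : 0 ≤ 2 * A)
  have h3 := h.nrm_wt_hR_dens_le
  linarith

/-- The bilinear terms produced by the multiplier `x (1 + x²)⁻¹` are controlled. -/
theorem abs_bilinear_le (h : IsPert a a' b b' A l) :
    |∫ x, cpk x * densPert a b x * hR (densPert a b) x| +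
      |√2 / 2 * ∫ x, cpk x * dens a b x * hR (fun x => wt x * a x) x| +
      |1 / 4 * ∫ x, cpk x * dens a b x * hR (dens a b) x| ≤
      l ^ 2 / 8 + 450 * (∫ x, pk x ^ 2 * dens a b x) + |∫ x, cpk x * dens a b x| ^ 2 + l ^ 4 +
        2 * A * l ^ 2 := by
  obtain ⟨s2, s3, s4⟩ := sqrt_two_bounds
  have hπ := Real.pi_gt_three
  have hπ' := Real.pi_le_four
  have mn := h.memLp_dens
  set w : ℝ → ℝ := fun x => wt x * a x with hw
  have mw : MemLp w 2 := h.memLp_w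
  set α := ∫ x, cpk x * dens a b x with hα
  set Z := ∫ x, pk x ^ 2 * dens a b x with hZ
  set D := ∫ x, wt x * |w x| with hD
  have iD : Integrable fun x => wt x * |w x| := integrable_mul memLp_wt mw.abs
  have i2' : Integrable fun x => pk x ^ 2 * dens a b x := by
    refine integrable_mul ?_ mn
    simpa only [sq] using memLp_pk_mul memLp_pk
  have d1 : |∫ x, cpk x * w x| ≤ D := abs_integral_le_integral_abs.trans
    (integral_mono (integrable_mul memLp_cpk mw).abs iD fun x => by
      simp only [abs_mul (cpk x)]
      exact mul_le_mul_of_nonneg_right (abs_cpk_le_wt x) (abs_nonneg _))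
  have d2 : |∫ x, pk x * w x| ≤ D := abs_integral_le_integral_abs.trans
    (integral_mono (integrable_mul memLp_pk mw).abs iD fun x => by
      simp only [abs_mul (pk x), abs_of_pos (pk_pos x)]
      exact mul_le_mul_of_nonneg_right (pk_le_wt x) (abs_nonneg _))
  have hnw : nrm w ≤ l := h.nrm_wt_a_le
  -- Interpolation at τ = 1/64, with π ≤ 4, leaves a fraction of l² small enough to absorb; the rest
  -- goes to the localized quantity `Z`.
  have hDD : D ^ 2 ≤ l ^ 2 / 16 + 256 * Z := by
    have h1 := integral_wt_mul_sq_le mw (show (0:ℝ) < 1 / 64 by norm_num)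
    have h2 : nrm (fun x => wt x * w x) ^ 2 ≤ Z := by
      rw [nrm_sq]
      refine integral_mono (integrable_sq (memLp_wt_mul mw)) i2' fun x => ?_
      simp only [hw, dens, ← wt_sq]
      nlinarith [mul_nonneg (sq_nonneg (wt x ^ 2)) (sq_nonneg (b x))]
    have h3 : nrm w ^ 2 ≤ l ^ 2 := pow_le_pow_left₀ (nrm_nonneg _) hnw 2
    have h4 : (1 / 64 * nrm w ^ 2 + (1 / 64 : ℝ)⁻¹ * nrm (fun x => wt x * w x) ^ 2) ≤
        1 / 64 * l ^ 2 + 64 * Z := by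
      norm_num
      linarith
    have h5 : 0 ≤ 1 / 64 * l ^ 2 + 64 * Z := le_trans (by positivity) h4
    refine h1.trans ((mul_le_mul_of_nonneg_left h4 (by positivity)).trans ?_)
    nlinarith
  have c1 : ∀ g : ℝ → ℝ, Continuous g → (∀ x, |g x| ≤ wt x) →
      ∫ x, g x * densPert a b x = √2 * (∫ x, g x * w x) + 1 / 2 * ∫ x, g x * dens a b x := by
    intro g hg hb
    have mg : MemLp g 2 := memLp_mono (c := 1) hg.aestronglyMeasurable memLp_wt
      (.of_forall fun x => by rw [one_mul, abs_of_pos (wt_pos x)]; exact hb x)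
    rw [← integral_const_mul, ← integral_const_mul, ← integral_add
      ((integrable_mul mg mw).const_mul _) ((integrable_mul mg mn).const_mul _)]
    exact integral_congr_ae (.of_forall fun x => by simp only [densPert, hw]; ring)
  have c2 := c1 cpk continuous_cpk abs_cpk_le_wt
  have c3 := c1 pk continuous_pk fun x => by rw [abs_of_pos (pk_pos x)]; exact pk_le_wt x
  rw [h.integral_pk_dens] at c3
  have q : ∀ u D t : ℝ, |u| ≤ D → (√2 * u + 1 / 2 * t) ^ 2 ≤ 4 * D ^ 2 + 1 / 2 * t ^ 2 := by
    intro u D t hu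
    have h1 : u ^ 2 ≤ D ^ 2 := sq_le_sq' (by linarith [neg_abs_le u]) ((le_abs_self u).trans hu)
    have h2 : (√2 * u) ^ 2 = 2 * u ^ 2 := by rw [mul_pow, sq √2, s2]
    nlinarith [sq_nonneg (√2 * u - 1 / 2 * t)]
  have q1 := q _ _ α d1
  have q2 := q _ _ (l ^ 2) d2
  rw [← c2] at q1
  rw [← c3] at q2
  have diff : ∀ s t : ℝ, |-(1 / (2 * Real.pi)) * (s ^ 2 - t ^ 2)| ≤ 1 / 6 * (s ^ 2 + t ^ 2) := by
    intro s t
    rw [abs_mul, abs_neg, abs_of_pos (by positivity)]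
    refine mul_le_mul ?_ ?_ (abs_nonneg _) (by norm_num)
    · exact one_div_le_one_div_of_le (by norm_num) (by linarith)
    · exact abs_le.2 ⟨by nlinarith [sq_nonneg s], by nlinarith [sq_nonneg t]⟩
  have t1 : |∫ x, cpk x * densPert a b x * hR (densPert a b) x| ≤
      1 / 6 * (8 * D ^ 2 + 1 / 2 * α ^ 2 + 1 / 2 * l ^ 4) := by
    rw [integral_cpk_mul_self h.memLp_densPert]
    refine (diff _ _).trans ?_
    linarith
  have t3 : |1 / 4 * ∫ x, cpk x * dens a b x * hR (dens a b) x| ≤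
      1 / 24 * (α ^ 2 + l ^ 4) := by
    rw [integral_cpk_mul_self mn, h.integral_pk_dens, ← hα, abs_mul,
      abs_of_pos (by norm_num : (0:ℝ) < 1 / 4)]
    have := diff α (l ^ 2)
    linarith
  have t2 : |√2 / 2 * ∫ x, cpk x * dens a b x * hR w x| ≤ 2 * A * l ^ 2 := by
    rw [abs_mul, abs_of_pos (by positivity)]
    have h1 : |∫ x, cpk x * dens a b x * hR w x| ≤ 2 * A * l * l := by
      refine (abs_integral_mul_le (memLp_cpk_mul mn) memLp_hR).trans ?_
      rw [nrm_hR mw]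
      have h2 := nrm_mono (f := fun x => cpk x * dens a b x) zero_le_one (memLp_wt_mul mn)
        (.of_forall fun x => by
          rw [abs_mul, abs_mul, one_mul, abs_of_pos (wt_pos x)]
          exact mul_le_mul_of_nonneg_right (abs_cpk_le_wt x) (abs_nonneg _))
      rw [one_mul] at h2
      have h3 := h2.trans h.nrm_wt_dens_le
      exact mul_le_mul h3 hnw (nrm_nonneg _) ((nrm_nonneg _).trans h3)
    have h2 : √2 / 2 * |∫ x, cpk x * dens a b x * hR w x| ≤ 1 * (2 * A * l * l) :=
      mul_le_mul (by linarith) h1 (abs_nonneg _) zero_le_one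
    linarith
  rw [sq_abs]
  have := sq_nonneg α
  have : 0 ≤ l ^ 4 := by have := h.l_nonneg; positivity
  nlinarith

/-- The pointwise bounds from the linearized equations grow like 1 + x², so they are integrable only
against `pk`³. A quadratic inequality trades `pk`² for that and a small multiple of `pk`, whose
integral is l². -/
theorem integral_pk_sq_dens_le (h : IsPert a a' b b' A l) {χ : ℝ → ℝ} (hχ : IsCutoff χ)
    (orth₁ : ∫ x, wt x * a x * ((x ^ 2 - 1) * pk x * χ x) = 0)
    (orth₂ : ∫ x, b x * (wt x * χ x) = 0)
    (orth₃ : ∫ x, wt x * a x * (x * pk x * χ x) = 0) {δ : ℝ}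
    (h₁ : nrm (fun x => (wt x * a' x - cpk x * (wt x * a x)) +
      2 * (cpk x * (wt x * a x) + pk x * hR (fun x => wt x * a x) x)) ≤ δ)
    (h₂ : nrm (fun x => wt x * (b' x + cpk x * b x)) ≤ δ) :
    450 * (∫ x, pk x ^ 2 * dens a b x) ≤ l ^ 2 / 8 + 450 * 900 * (2 * 772 ^ 2 * 4) * δ ^ 2 := by
  have mn := h.memLp_dens
  have hδ : 0 ≤ δ := (nrm_nonneg _).trans h₁
  have p1 : ∀ x, |a x| ≤ 772 * δ * (pk x)⁻¹ := fun x => by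
    have h1 := abs_le_of_real_orthogonal hχ h.isPrim_w h.memLp_w h.memLp_w' orth₁ orth₃ x
    have hw := wt_pos x
    rw [abs_mul, abs_of_pos hw] at h1
    rw [← wt_sq]
    have h2 : wt x * |a x| ≤ wt x * (772 * δ * (wt x ^ 2)⁻¹) :=
      h1.trans (by
        have e : wt x * (772 * δ * (wt x ^ 2)⁻¹) = 772 * δ * (wt x)⁻¹ := by field_simp
        rw [e]; gcongr)
    exact le_of_mul_le_mul_left h2 hw
  have p2 : ∀ x, |b x| ≤ 772 * δ * (pk x)⁻¹ := fun x => by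
    have h1 := abs_le_of_imag_orthogonal hχ h.hb h.mb h.mb' orth₂ x
    have hp := inv_nonneg.2 (pk_pos x).le
    rw [wt_sq] at h1
    refine h1.trans (mul_le_mul_of_nonneg_right ?_ hp)
    nlinarith
  have sqb : ∀ x (c : ℝ), |c| ≤ 772 * δ * (pk x)⁻¹ →
      pk x ^ 3 * c ^ 2 ≤ 772 ^ 2 * δ ^ 2 * pk x := by
    intro x c hc
    have hp := pk_pos x
    have h1 : c ^ 2 ≤ (772 * δ * (pk x)⁻¹) ^ 2 := by
      rw [← sq_abs c]; exact pow_le_pow_left₀ (abs_nonneg _) hc 2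
    calc pk x ^ 3 * c ^ 2 ≤ pk x ^ 3 * (772 * δ * (pk x)⁻¹) ^ 2 := by gcongr
      _ = _ := by field_simp
  have key : ∀ x, pk x ^ 2 * dens a b x ≤
      1 / 3600 * (pk x * dens a b x) + 900 * (2 * 772 ^ 2 * δ ^ 2) * pk x := fun x => by
    have hp := pk_pos x
    have hd : 0 ≤ dens a b x := by unfold dens; positivity
    have h1 := sqb x _ (p1 x)
    have h2 := sqb x _ (p2 x)
    have h3 : pk x ^ 3 * dens a b x ≤ 2 * 772 ^ 2 * δ ^ 2 * pk x := by
      unfold dens; linarith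
    -- (1/60 - 30 `pk`)² ≥ 0, scaled so that 450/3600 = 1/8.
    have h4 : pk x ^ 2 ≤ 1 / 3600 * pk x + 900 * pk x ^ 3 := by
      nlinarith [mul_nonneg hp.le (sq_nonneg (1 / 60 - 30 * pk x))]
    have h5 := mul_le_mul_of_nonneg_right h4 hd
    linarith
  have i1 : Integrable fun x => pk x * dens a b x := integrable_mul memLp_pk mn
  have i2' : Integrable fun x => pk x ^ 2 * dens a b x := by
    refine integrable_mul ?_ mn
    simpa only [sq] using memLp_pk_mul memLp_pk
  have j1 : Integrable fun x => 1 / 3600 * (pk x * dens a b x) := i1.const_mul _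
  have j2 : Integrable fun x => 900 * (2 * 772 ^ 2 * δ ^ 2) * pk x := integrable_pk.const_mul _
  have h1 := integral_mono i2' (j1.add j2) key
  have e : ∫ x, (1 / 3600 * (pk x * dens a b x) + 900 * (2 * 772 ^ 2 * δ ^ 2) * pk x) =
      1 / 3600 * l ^ 2 + 900 * (2 * 772 ^ 2 * δ ^ 2) * Real.pi := by
    rw [integral_add j1 j2, integral_const_mul, integral_const_mul, h.integral_pk_dens,
      integral_pk]
  simp only [Pi.add_apply] at h1
  rw [e] at h1
  have h2 : 900 * (2 * 772 ^ 2 * δ ^ 2) * Real.pi ≤ 900 * (2 * 772 ^ 2 * δ ^ 2) * 4 :=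
    mul_le_mul_of_nonneg_left Real.pi_le_four (by positivity)
  linarith

/-- The weighted norm of a small orthogonal perturbation is controlled by the residual. -/
theorem l_le (h : IsPert a a' b b' A l) {χ : ℝ → ℝ} (hχ : IsCutoff χ)
    (orth₁ : ∫ x, wt x * a x * ((x ^ 2 - 1) * pk x * χ x) = 0)
    (orth₂ : ∫ x, b x * (wt x * χ x) = 0)
    (orth₃ : ∫ x, wt x * a x * (x * pk x * χ x) = 0) {M k θ : ℝ} (hM : nrm a ≤ M)
    (hB : ∫ x, wt x * |a x| ≤ θ) (hA : A ≤ θ) (hl : l ≤ θ)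
    (hκ : (M + 2) * θ ≤ 1 / 10 ^ 9) (hk₁ : nrm (resRe a a' b) ≤ k) (hk₂ : nrm (resIm a b b') ≤ k) :
    l ≤ 10 ^ 8 * k ∧ |∫ x, cpk x * dens a b x| ≤ 6 * k + l := by
  have hM0 : 0 ≤ M := (nrm_nonneg _).trans hM
  have hk0 : 0 ≤ k := (nrm_nonneg _).trans hk₁
  have hl0 := h.l_nonneg
  have hA0 := h.A_nonneg
  have hθ0 : 0 ≤ θ := hl0.trans hl
  have hθ : θ ≤ 1 / 10 ^ 9 := by nlinarith
  have hα := h.abs_integral_cpk_dens_le hM hB hA hl (by linarith) hκ hk₁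
  have n1 := h.nrm_wt_linRe_le hk₁
  have n2 := h.nrm_wt_linIm_le hk₂
  have b1 := h.abs_bilinear_le
  have e1 := h.integral_cpk_mul_residual
  set α := ∫ x, cpk x * dens a b x
  -- The linearized residual exceeds the true one only by terms of size 10⁻⁹ l and multiples of k,
  -- by the bound on α.
  have hδ : k + 6 * A * l + 2 * |α| ≤ 13 * k + 14 / 10 ^ 9 * l := by
    have : A * l ≤ 1 / 10 ^ 9 * l := mul_le_mul_of_nonneg_right (hA.trans hθ) hl0
    linarith
  have z := h.integral_pk_sq_dens_le hχ orth₁ orth₂ orth₃ (n1.trans hδ) (n2.trans hδ)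
  have lhs : |∫ x, cpk x * (a x * resRe a a' b x + b x * resIm a b b' x)| ≤ 2 * (l * k) := by
    have g : ∀ f r : ℝ → ℝ, MemLp f 2 → MemLp r 2 → nrm (fun x => wt x * f x) ≤ l → nrm r ≤ k →
        |∫ x, cpk x * f x * r x| ≤ l * k := fun f r mf mr hf hr => by
      refine (abs_integral_mul_le (memLp_cpk_mul mf) mr).trans
        (mul_le_mul (le_trans ?_ hf) hr (nrm_nonneg _) hl0)
      have := nrm_mono (f := fun x => cpk x * f x) zero_le_one (memLp_wt_mul mf)
        (.of_forall fun x => by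
          rw [abs_mul, abs_mul, one_mul, abs_of_pos (wt_pos x)]
          exact mul_le_mul_of_nonneg_right (abs_cpk_le_wt x) (abs_nonneg _))
      rwa [one_mul] at this
    have g1 := g a _ h.ma h.memLp_resRe h.nrm_wt_a_le hk₁
    have g2 := g b _ h.mb h.memLp_resIm h.nrm_wt_b_le hk₂
    have e : ∫ x, cpk x * (a x * resRe a a' b x + b x * resIm a b b' x) =
        (∫ x, cpk x * a x * resRe a a' b x) + ∫ x, cpk x * b x * resIm a b b' x := by
      rw [← integral_add (integrable_mul (memLp_cpk_mul h.ma) h.memLp_resRe)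
        (integrable_mul (memLp_cpk_mul h.mb) h.memLp_resIm)]
      exact integral_congr_ae (.of_forall fun x => by simp only; ring)
    rw [e]
    exact (abs_add_le _ _).trans (by linarith)
  set Z := ∫ x, pk x ^ 2 * dens a b x
  have main : 3 / 2 * l ^ 2 ≤ 2 * (l * k) + 2 * Z + (l ^ 2 / 8 + 450 * Z + |α| ^ 2 + l ^ 4 +
      2 * A * l ^ 2) := by
    have h1 := le_abs_self (∫ x, cpk x * (a x * resRe a a' b x + b x * resIm a b b' x))
    have h2 := neg_abs_le (∫ x, cpk x * densPert a b x * hR (densPert a b) x)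
    have h3 := neg_abs_le (√2 / 2 * ∫ x, cpk x * dens a b x * hR (fun x => wt x * a x) x)
    have h4 := neg_abs_le (1 / 4 * ∫ x, cpk x * dens a b x * hR (dens a b) x)
    linarith
  have fin := absorb_of_small hl0 hk0 (hl.trans hθ) (hA.trans hθ) (abs_nonneg α) (by linarith)
    z main
  exact ⟨fin, by linarith⟩

end IsPert

/-- A cut-off `X` with derivative `X'`, both controlled by the weight `⟨x⟩⁻¹`. -/
structure IsWeightedCutoff (X X' : ℝ → ℝ) (C : ℝ) : Prop where
  isPrim : IsPrim X X'
  continuous_deriv : Continuous X'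
  nonneg : ∀ x, 0 ≤ X x
  le_one : ∀ x, X x ≤ 1
  le_wt : ∀ x, X x ≤ 5 * wt x
  abs_deriv_le : ∀ x, |X' x| ≤ C * wt x

/-- The cut-off at R = 2 lives in [-4, 4], where ⟨x⟩ ≤ √17 ≤ 5. On a fixed compact set any bounded
function is dominated by the weight. -/
theorem IsCutoff.exists_isWeightedCutoff {χ : ℝ → ℝ} (h : IsCutoff χ) :
    ∃ X' : ℝ → ℝ, ∃ C, 0 ≤ C ∧ IsWeightedCutoff (fun x => χ (x / 2)) X' C := by
  have hc : Continuous (deriv χ) := h.contDiff.continuous_deriv (by simp)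
  obtain ⟨C, hC⟩ := h.hasCompactSupport.deriv.exists_bound_of_continuous hc
  have hC0 : 0 ≤ C := (norm_nonneg _).trans (hC 0)
  have hw : ∀ x : ℝ, x / 2 ∈ Set.Icc (-2 : ℝ) 2 → 1 ≤ 5 * wt x := fun x hx => by
    have h1 : (wt x)⁻¹ ≤ 5 := by
      rw [wt, inv_inv]
      refine Real.sqrt_le_iff.2 ⟨by norm_num, ?_⟩
      nlinarith [hx.1, hx.2]
    have := wt_pos x
    rwa [inv_le_iff_one_le_mul₀ this] at h1
  refine ⟨fun x => deriv χ (x / 2) / 2, 5 * C, by positivity, ?_, by fun_prop,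
    fun x => h.nonneg _, fun x => h.le_one _, fun x => ?_, fun x => ?_⟩
  · refine .of_hasDerivAt (fun x => ?_) (by fun_prop)
    have h1 := (h.contDiff.differentiable (by simp) (x / 2)).hasDerivAt
    exact (h1.comp x ((hasDerivAt_id x).div_const 2)).congr_deriv (by ring)
  · by_cases hx : x / 2 ∈ Set.Icc (-2 : ℝ) 2
    · exact (h.le_one _).trans (hw x hx)
    · simp only [h.eq_zero hx]
      have := wt_pos x
      positivity
  · by_cases hx : x / 2 ∈ Set.Icc (-2 : ℝ) 2
    · have h1 := hC (x / 2)
      have h2 := hw x hx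
      rw [Real.norm_eq_abs] at h1
      rw [abs_div, abs_of_pos (by norm_num : (0:ℝ) < 2)]
      nlinarith [abs_nonneg (deriv χ (x / 2))]
    · have h1 : deriv χ (x / 2) = 0 := image_eq_zero_of_notMem_tsupport fun h' =>
        hx (h.tsupport_subset (tsupport_deriv_subset h'))
      have := wt_pos x
      simp only [h1]
      norm_num
      positivity

/-! ### From the weighted norm and the residual to the inner derivative and the outer residual -/

namespace IsPert

variable {a a' b b' X X' : ℝ → ℝ} {A l C : ℝ}

theorem nrm_wt_hR_densPert_le (h : IsPert a a' b b' A l) :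
    nrm (fun x => wt x * hR (densPert a b) x) ≤ 3 * l + |∫ x, cpk x * dens a b x| := by
  obtain ⟨-, s3, s4⟩ := sqrt_two_bounds
  have h1 := nrm_le_add (f := fun x => wt x * hR (densPert a b) x)
    (by norm_num : (0:ℝ) ≤ 3 / 2) (by norm_num : (0:ℝ) ≤ 1 / 2)
    (memLp_hR (f := fun x => wt x * a x)) (memLp_wt_mul (memLp_hR (f := dens a b))) (by
    filter_upwards [h.hR_densPert] with x hx
    have hw := wt_pos x
    have hw1 := wt_le_one x
    have e : wt x * hR (densPert a b) x = wt x * √2 * hR (fun x => wt x * a x) x +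
        1 / 2 * (wt x * hR (dens a b) x) := by rw [hx]; ring
    rw [e]
    refine (abs_add_le _ _).trans (add_le_add ?_ (by rw [abs_mul (1 / 2)]; norm_num))
    rw [abs_mul, abs_of_pos (by positivity)]
    exact mul_le_mul_of_nonneg_right (by nlinarith) (abs_nonneg _))
  rw [nrm_hR h.memLp_w] at h1
  have h2 := h.nrm_wt_a_le
  have h3 := h.nrm_wt_hR_dens_le
  have h4 : A * l ≤ 1 * l := mul_le_mul_of_nonneg_right h.A_le h.l_nonneg
  have := h.l_nonneg
  have := abs_nonneg (∫ x, cpk x * dens a b x)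
  linarith

/-- The residual is solved for the derivative. On the support of the cut-off every remaining term
carries a weight, so the weighted norm of ℋ(densPert) is enough. -/
theorem nrm_deriv_inner_re_le (h : IsPert a a' b b' A l) (hX : IsWeightedCutoff X X' C) (hC : 0 ≤ C)
    {k : ℝ} (hk : nrm (resRe a a' b) ≤ k) (hα : |∫ x, cpk x * dens a b x| ≤ 6 * k + l) :
    nrm (fun x => X' x * a x + X x * a' x) ≤ (C + 29) * l + 43 * k := by
  obtain ⟨-, s3, s4⟩ := sqrt_two_bounds
  have h1 := nrm_le_add₃ (f := fun x => X' x * a x + X x * a' x)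
    (by positivity : 0 ≤ C + 1) zero_le_one (by norm_num : (0:ℝ) ≤ 7)
    h.memLp_w h.memLp_resRe (memLp_wt_mul (memLp_hR (f := densPert a b))) (.of_forall fun x => by
    have hw := wt_pos x
    have e : X' x * a x + X x * a' x = (X' x - X x * cpk x) * a x + X x * resRe a a' b x -
        (X x * a x * hR (densPert a b) x + X x * √2 * (wt x * hR (densPert a b) x)) := by
      simp only [resRe]; ring
    rw [e]
    have x0 := hX.nonneg x
    have x1 := hX.le_one x
    have x2 := hX.le_wt x
    refine (abs_sub _ _).trans (add_le_add ((abs_add_le _ _).trans (add_le_add ?_ ?_)) ?_)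
    · rw [abs_mul, abs_mul (wt x), abs_of_pos hw, ← mul_assoc]
      refine mul_le_mul_of_nonneg_right ((abs_sub _ _).trans ?_) (abs_nonneg _)
      rw [abs_mul, abs_of_nonneg x0]
      nlinarith [hX.abs_deriv_le x, abs_cpk_le_wt x, abs_nonneg (cpk x)]
    · rw [abs_mul, abs_of_nonneg x0]
      exact mul_le_mul_of_nonneg_right x1 (abs_nonneg _)
    · have g1 : |X x * a x * hR (densPert a b) x| ≤ 5 * |wt x * hR (densPert a b) x| := by
        rw [abs_mul, abs_mul, abs_mul, abs_of_nonneg x0, abs_of_pos hw, ← mul_assoc]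
        refine mul_le_mul_of_nonneg_right ?_ (abs_nonneg _)
        have := (h.abs_a_le x).trans h.A_le
        nlinarith [abs_nonneg (a x)]
      have g2 : |X x * √2 * (wt x * hR (densPert a b) x)| ≤
          3 / 2 * |wt x * hR (densPert a b) x| := by
        rw [abs_mul, abs_of_nonneg (by positivity : 0 ≤ X x * √2)]
        exact mul_le_mul_of_nonneg_right (by nlinarith) (abs_nonneg _)
      refine (abs_add_le _ _).trans ?_
      have := abs_nonneg (wt x * hR (densPert a b) x)
      linarith)
  have h2 := h.nrm_wt_hR_densPert_le
  have h3 := mul_le_mul_of_nonneg_left h.nrm_wt_a_le (by positivity : 0 ≤ C + 1)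
  linarith

theorem nrm_deriv_inner_im_le (h : IsPert a a' b b' A l) (hX : IsWeightedCutoff X X' C) (hC : 0 ≤ C)
    {k : ℝ} (hk : nrm (resIm a b b') ≤ k) (hα : |∫ x, cpk x * dens a b x| ≤ 6 * k + l) :
    nrm (fun x => X' x * b x + X x * b' x) ≤ (C + 29) * l + 43 * k := by
  have h1 := nrm_le_add₃ (f := fun x => X' x * b x + X x * b' x)
    (by positivity : 0 ≤ C + 1) zero_le_one (by norm_num : (0:ℝ) ≤ 5)
    (memLp_wt_mul h.mb) h.memLp_resIm (memLp_wt_mul (memLp_hR (f := densPert a b)))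
    (.of_forall fun x => by
    have hw := wt_pos x
    have e : X' x * b x + X x * b' x = (X' x - X x * cpk x) * b x + X x * resIm a b b' x -
        X x * b x * hR (densPert a b) x := by
      simp only [resIm]; ring
    rw [e]
    have x0 := hX.nonneg x
    have x1 := hX.le_one x
    have x2 := hX.le_wt x
    refine (abs_sub _ _).trans (add_le_add ((abs_add_le _ _).trans (add_le_add ?_ ?_)) ?_)
    · rw [abs_mul, abs_mul (wt x), abs_of_pos hw, ← mul_assoc]
      refine mul_le_mul_of_nonneg_right ((abs_sub _ _).trans ?_) (abs_nonneg _)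
      rw [abs_mul, abs_of_nonneg x0]
      nlinarith [hX.abs_deriv_le x, abs_cpk_le_wt x, abs_nonneg (cpk x)]
    · rw [abs_mul, abs_of_nonneg x0]
      exact mul_le_mul_of_nonneg_right x1 (abs_nonneg _)
    · rw [abs_mul, abs_mul, abs_mul, abs_of_nonneg x0, abs_of_pos hw, ← mul_assoc]
      refine mul_le_mul_of_nonneg_right ?_ (abs_nonneg _)
      have := (h.abs_b_le x).trans h.A_le
      nlinarith [abs_nonneg (b x)])
  have h2 := h.nrm_wt_hR_densPert_le
  have h3 := mul_le_mul_of_nonneg_left h.nrm_wt_b_le (by positivity : 0 ≤ C + 1)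
  have := h.l_nonneg
  have := (nrm_nonneg _).trans hk
  linarith

theorem memLp_outer_dens (h : IsPert a a' b b' A l) (hX : IsWeightedCutoff X X' C) :
    MemLp (fun x => (1 - X x) ^ 2 * dens a b x) 2 :=
  memLp_bdd_mul (c := 1) ((continuous_const.sub hX.isPrim.continuous).pow 2).aestronglyMeasurable
    (fun x => by
      have x0 := hX.nonneg x
      have x1 := hX.le_one x
      rw [abs_of_nonneg (sq_nonneg _)]
      nlinarith) h.memLp_dens

/-- Although ℋ(densPert) is not small in unweighted L², its difference from the potential of the
outer part is: before ℋ is applied it equals √2 w plus a compactly supported multiple of |ε|². -/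
theorem nrm_hR_densPert_sub_le (h : IsPert a a' b b' A l) (hX : IsWeightedCutoff X X' C) :
    nrm (fun x => hR (densPert a b) x - 1 / 2 * hR (fun x => (1 - X x) ^ 2 * dens a b x) x) ≤
      12 * l := by
  obtain ⟨-, s3, s4⟩ := sqrt_two_bounds
  set m : ℝ → ℝ := fun x => (1 - X x) ^ 2 * dens a b x
  have mm : MemLp m 2 := h.memLp_outer_dens hX
  set r : ℝ → ℝ := fun x => dens a b x + (-1) * m x with hr
  have mr : MemLp r 2 := h.memLp_dens.add (mm.const_mul (-1))
  have nr : nrm r ≤ 10 * nrm (fun x => wt x * dens a b x) :=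
    nrm_mono (by norm_num) (memLp_wt_mul h.memLp_dens) (.of_forall fun x => by
      have x0 := hX.nonneg x
      have x1 := hX.le_one x
      have x2 := hX.le_wt x
      have hd : 0 ≤ dens a b x := by unfold dens; positivity
      have e : r x = X x * (2 - X x) * dens a b x := by simp only [hr, m]; ring
      rw [e, abs_mul _ (dens a b x), abs_mul (wt x), abs_of_pos (wt_pos x), abs_of_nonneg hd,
        abs_of_nonneg (mul_nonneg x0 (by linarith)), ← mul_assoc]
      exact mul_le_mul_of_nonneg_right (by nlinarith) hd)
  have h1 := nrm_le_add
    (f := fun x => hR (densPert a b) x - 1 / 2 * hR m x)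
    (by norm_num : (0:ℝ) ≤ 3 / 2) (by norm_num : (0:ℝ) ≤ 1 / 2)
    (memLp_hR (f := fun x => wt x * a x)) (memLp_hR (f := r)) (by
    filter_upwards [h.hR_densPert, hR_add h.memLp_dens (mm.const_mul (-1)),
      hR_const_mul (-1) mm] with x hx h2 h3
    have h4 : hR r x = hR (dens a b) x - hR m x := by rw [hr, h2, h3]; ring
    have e : hR (densPert a b) x - 1 / 2 * hR m x = √2 * hR (fun x => wt x * a x) x +
        1 / 2 * hR r x := by rw [hx, h4]; ring
    rw [e]
    refine (abs_add_le _ _).trans (add_le_add ?_ (by rw [abs_mul (1 / 2)]; norm_num))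
    rw [abs_mul, abs_of_pos (by positivity)]
    exact mul_le_mul_of_nonneg_right s4 (abs_nonneg _))
  rw [nrm_hR h.memLp_w, nrm_hR mr] at h1
  have h2 := h.nrm_wt_a_le
  have h3 := h.nrm_wt_dens_le
  have h4 : A * l ≤ 1 * l := mul_le_mul_of_nonneg_right h.A_le h.l_nonneg
  have := h.l_nonneg
  linarith

/-- The residual of the outer part is the cut-off residual up to weighted terms, the difference of
potentials, and the interaction with Q. Only the last needs the weighted bound for ℋ(densPert), as Q
itself decays like the weight. -/
theorem nrm_outer_re_le (h : IsPert a a' b b' A l) (hX : IsWeightedCutoff X X' C) (hC : 0 ≤ C)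
    {k : ℝ} (hk : nrm (resRe a a' b) ≤ k) (hα : |∫ x, cpk x * dens a b x| ≤ 6 * k + l) :
    nrm (fun x => -X' x * a x + (1 - X x) * a' x +
      1 / 2 * hR (fun x => (1 - X x) ^ 2 * dens a b x) x * ((1 - X x) * a x)) ≤
      (C + 29) * l + 43 * k := by
  obtain ⟨-, s3, s4⟩ := sqrt_two_bounds
  have hV := h.nrm_hR_densPert_sub_le hX
  have mm := h.memLp_outer_dens hX
  set m : ℝ → ℝ := fun x => (1 - X x) ^ 2 * dens a b x
  set V : ℝ → ℝ := fun x => hR (densPert a b) x - 1 / 2 * hR m x with hVd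
  have mV : MemLp V 2 := memLp_hR.sub (memLp_hR.const_mul _)
  have h1 := nrm_le_add₄ (f := fun x => -X' x * a x + (1 - X x) * a' x +
      1 / 2 * hR m x * ((1 - X x) * a x))
    (by positivity : 0 ≤ C + 1) zero_le_one zero_le_one (by norm_num : (0:ℝ) ≤ 3 / 2)
    h.memLp_w h.memLp_resRe mV (memLp_wt_mul (memLp_hR (f := densPert a b)))
    (.of_forall fun x => by
    have hw := wt_pos x
    have e : -X' x * a x + (1 - X x) * a' x + 1 / 2 * hR m x * ((1 - X x) * a x) =
        -(X' x + (1 - X x) * cpk x) * a x + (1 - X x) * resRe a a' b x -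
        (1 - X x) * a x * V x - (1 - X x) * √2 * (wt x * hR (densPert a b) x) := by
      simp only [resRe, hVd]; ring
    rw [e]
    have x0 : 0 ≤ 1 - X x := by linarith [hX.le_one x]
    have x1 : 1 - X x ≤ 1 := by linarith [hX.nonneg x]
    refine (abs_sub _ _).trans (add_le_add ((abs_sub _ _).trans (add_le_add
      ((abs_add_le _ _).trans (add_le_add ?_ ?_)) ?_)) ?_)
    · rw [abs_mul, abs_mul (wt x), abs_of_pos hw, ← mul_assoc, abs_neg]
      refine mul_le_mul_of_nonneg_right ((abs_add_le _ _).trans ?_) (abs_nonneg _)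
      rw [abs_mul, abs_of_nonneg x0]
      nlinarith [hX.abs_deriv_le x, abs_cpk_le_wt x, abs_nonneg (cpk x)]
    · rw [abs_mul, abs_of_nonneg x0]
      exact mul_le_mul_of_nonneg_right x1 (abs_nonneg _)
    · rw [abs_mul, abs_mul, abs_of_nonneg x0]
      refine mul_le_mul_of_nonneg_right ?_ (abs_nonneg _)
      exact mul_le_one₀ x1 (abs_nonneg _) ((h.abs_a_le x).trans h.A_le)
    · rw [abs_mul, abs_of_nonneg (by positivity : 0 ≤ (1 - X x) * √2)]
      exact mul_le_mul_of_nonneg_right (by nlinarith) (abs_nonneg _))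
  have h2 := h.nrm_wt_hR_densPert_le
  have h3 := mul_le_mul_of_nonneg_left h.nrm_wt_a_le (by positivity : 0 ≤ C + 1)
  have := h.l_nonneg
  have := (nrm_nonneg _).trans hk
  linarith

/-- As for the real part, but Q is real and contributes no interaction term, so no bound on α is
needed. -/
theorem nrm_outer_im_le (h : IsPert a a' b b' A l) (hX : IsWeightedCutoff X X' C) (hC : 0 ≤ C)
    {k : ℝ} (hk : nrm (resIm a b b') ≤ k) :
    nrm (fun x => -X' x * b x + (1 - X x) * b' x +
      1 / 2 * hR (fun x => (1 - X x) ^ 2 * dens a b x) x * ((1 - X x) * b x)) ≤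
      (C + 29) * l + 43 * k := by
  have hV := h.nrm_hR_densPert_sub_le hX
  have mm := h.memLp_outer_dens hX
  set m : ℝ → ℝ := fun x => (1 - X x) ^ 2 * dens a b x
  set V : ℝ → ℝ := fun x => hR (densPert a b) x - 1 / 2 * hR m x with hVd
  have mV : MemLp V 2 := memLp_hR.sub (memLp_hR.const_mul _)
  have h1 := nrm_le_add₃ (f := fun x => -X' x * b x + (1 - X x) * b' x +
      1 / 2 * hR m x * ((1 - X x) * b x))
    (by positivity : 0 ≤ C + 1) zero_le_one zero_le_one
    (memLp_wt_mul h.mb) h.memLp_resIm mV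
    (.of_forall fun x => by
    have hw := wt_pos x
    have e : -X' x * b x + (1 - X x) * b' x + 1 / 2 * hR m x * ((1 - X x) * b x) =
        -(X' x + (1 - X x) * cpk x) * b x + (1 - X x) * resIm a b b' x -
        (1 - X x) * b x * V x := by
      simp only [resIm, hVd]; ring
    rw [e]
    have x0 : 0 ≤ 1 - X x := by linarith [hX.le_one x]
    have x1 : 1 - X x ≤ 1 := by linarith [hX.nonneg x]
    refine (abs_sub _ _).trans (add_le_add
      ((abs_add_le _ _).trans (add_le_add ?_ ?_)) ?_)
    · rw [abs_mul, abs_mul (wt x), abs_of_pos hw, ← mul_assoc, abs_neg]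
      refine mul_le_mul_of_nonneg_right ((abs_add_le _ _).trans ?_) (abs_nonneg _)
      rw [abs_mul, abs_of_nonneg x0]
      nlinarith [hX.abs_deriv_le x, abs_cpk_le_wt x, abs_nonneg (cpk x)]
    · rw [abs_mul, abs_of_nonneg x0]
      exact mul_le_mul_of_nonneg_right x1 (abs_nonneg _)
    · rw [abs_mul, abs_mul, abs_of_nonneg x0]
      refine mul_le_mul_of_nonneg_right ?_ (abs_nonneg _)
      exact mul_le_one₀ x1 (abs_nonneg _) ((h.abs_b_le x).trans h.A_le))
  have h3 := mul_le_mul_of_nonneg_left h.nrm_wt_b_le (by positivity : 0 ≤ C + 1)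
  have := h.l_nonneg
  have := (nrm_nonneg _).trans hk
  linarith

end IsPert

/-! ### Weak derivatives and real and imaginary parts -/

/-- The complex-valued function `a + i b`. -/
noncomputable def cx (a b : ℝ → ℝ) (x : ℝ) : ℂ := (a x : ℂ) + (b x : ℂ) * Complex.I

theorem cx_re (a b : ℝ → ℝ) (x : ℝ) : (cx a b x).re = a x := by simp [cx]

theorem cx_im (a b : ℝ → ℝ) (x : ℝ) : (cx a b x).im = b x := by simp [cx]

theorem norm_cx_sq (a b : ℝ → ℝ) (x : ℝ) : ‖cx a b x‖ ^ 2 = a x ^ 2 + b x ^ 2 := by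
  rw [← Complex.normSq_eq_norm_sq, Complex.normSq_apply, cx_re, cx_im]
  ring

theorem memLp_cx {a b : ℝ → ℝ} (ha : MemLp a 2) (hb : MemLp b 2) : MemLp (cx a b) 2 := by
  have h1 : MemLp (fun x => (a x : ℂ)) 2 := ha.ofReal
  have h2 : MemLp (fun x => (b x : ℂ)) 2 := hb.ofReal
  have h3 : MemLp (fun x => (b x : ℂ) * Complex.I) 2 := by
    simpa only [mul_comm] using h2.const_mul Complex.I
  exact h1.add h3

theorem locallyIntegrable_cx {a b : ℝ → ℝ} (ha : LocallyIntegrable a) (hb : LocallyIntegrable b) :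
    LocallyIntegrable (cx a b) := by
  intro x
  obtain ⟨s, hs, hi⟩ := ha x
  obtain ⟨t, ht, hj⟩ := hb x
  have h1 : Integrable (fun x => (a x : ℂ)) (volume.restrict (s ∩ t)) :=
    Integrable.ofReal (hi.mono_set Set.inter_subset_left)
  have h2 : Integrable (fun x => (b x : ℂ)) (volume.restrict (s ∩ t)) :=
    Integrable.ofReal (hj.mono_set Set.inter_subset_right)
  exact ⟨s ∩ t, Filter.inter_mem hs ht, h1.add (h2.mul_const Complex.I)⟩

theorem integrable_test_mul {φ : ℝ → ℝ} (hφ : Continuous φ) (hc : HasCompactSupport φ)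
    {f : ℝ → ℂ} (hf : LocallyIntegrable f) : Integrable fun x => (φ x : ℂ) * f x :=
  (hf.integrable_smul_left_of_hasCompactSupport hφ hc).congr (.of_forall fun x => by simp)

theorem integral_test_mul_eq {φ : ℝ → ℝ} (hφ : Continuous φ) (hc : HasCompactSupport φ)
    {f : ℝ → ℂ} (hf : LocallyIntegrable f) : ∫ x, (φ x : ℂ) * f x =
      ((∫ x, φ x * (f x).re : ℝ) : ℂ) + ((∫ x, φ x * (f x).im : ℝ) : ℂ) * Complex.I := by
  rw [← integral_re_add_im (𝕜 := ℂ) (integrable_test_mul hφ hc hf)]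
  simp

theorem hasWeakDeriv_cx {a a' b b' : ℝ → ℝ} (ha : IsPrim a a') (hb : IsPrim b b') :
    HasWeakDeriv (cx a b) (cx a' b') := by
  have h1 := locallyIntegrable_cx ha.continuous.locallyIntegrable hb.continuous.locallyIntegrable
  have h2 := locallyIntegrable_cx ha.locInt hb.locInt
  refine ⟨h1, h2, fun φ hφ hc => ?_⟩
  rw [integral_test_mul_eq (hφ.continuous_deriv (by simp)) hc.deriv h1,
    integral_test_mul_eq hφ.continuous hc h2]
  simp only [cx_re, cx_im]
  rw [ha.integral_deriv_test_mul hφ hc, hb.integral_deriv_test_mul hφ hc]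
  push_cast
  ring

theorem HasWeakDeriv.congr {f f₁ g : ℝ → ℂ} (h : HasWeakDeriv f g) (e : f =ᵐ[volume] f₁) :
    HasWeakDeriv f₁ g := by
  refine ⟨h.1.congr e, h.2.1, fun φ hφ hc => ?_⟩
  rw [← h.2.2 φ hφ hc]
  refine integral_congr_ae ?_
  filter_upwards [e] with x hx
  rw [hx]

theorem HasWeakDeriv.unique {f g g₁ : ℝ → ℂ} (h : HasWeakDeriv f g) (h₁ : HasWeakDeriv f g₁) :
    g =ᵐ[volume] g₁ := by
  refine ae_eq_of_integral_contDiff_smul_eq h.2.1 h₁.2.1 fun φ hφ hc => ?_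
  have := (h.2.2 φ hφ hc).symm.trans (h₁.2.2 φ hφ hc)
  simpa using this

theorem weakDeriv_ae_eq {f g : ℝ → ℂ} (h : HasWeakDeriv f g) : weakDeriv f =ᵐ[volume] g := by
  have hex : ∃ g, HasWeakDeriv f g := ⟨g, h⟩
  rw [weakDeriv, dif_pos hex]
  exact hex.choose_spec.unique h

theorem weakDeriv_cx_ae {f : ℝ → ℂ} {a a' b b' : ℝ → ℝ} (ha : IsPrim a a') (hb : IsPrim b b')
    (e : f =ᵐ[volume] cx a b) : weakDeriv f =ᵐ[volume] cx a' b' :=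
  weakDeriv_ae_eq ((hasWeakDeriv_cx ha hb).congr e.symm)

/-- An `H¹` function has absolutely continuous real and imaginary parts. -/
theorem MemH1.exists_isPrim {f : ℝ → ℂ} (h : MemH1 f) : ∃ a a' b b' : ℝ → ℝ,
    IsPrim a a' ∧ IsPrim b b' ∧ MemLp a 2 ∧ MemLp a' 2 ∧ MemLp b 2 ∧ MemLp b' 2 ∧
      f =ᵐ[volume] cx a b := by
  obtain ⟨mf, g, mg, hf, hg, hw⟩ := h
  have mre : ∀ u : ℝ → ℂ, MemLp u 2 → MemLp (fun x => (u x).re) 2 := fun u hu => hu.re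
  have mim : ∀ u : ℝ → ℂ, MemLp u 2 → MemLp (fun x => (u x).im) 2 := fun u hu => hu.im
  have li : ∀ u : ℝ → ℝ, MemLp u 2 → LocallyIntegrable u := fun u hu =>
    hu.locallyIntegrable (by norm_num)
  have key : ∀ φ : ℝ → ℝ, ContDiff ℝ ∞ φ → HasCompactSupport φ →
      (∫ x, deriv φ x * (f x).re) = -(∫ x, φ x * (g x).re) ∧
      (∫ x, deriv φ x * (f x).im) = -∫ x, φ x * (g x).im := by
    intro φ hφ hc
    have h1 := hw φ hφ hc
    rw [integral_test_mul_eq (hφ.continuous_deriv (by simp)) hc.deriv hf,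
      integral_test_mul_eq hφ.continuous hc hg] at h1
    have h2 := congrArg Complex.re h1
    have h3 := congrArg Complex.im h1
    simp at h2 h3
    exact ⟨h2, h3⟩
  obtain ⟨a, ha, ea⟩ := exists_isPrim_of_weak (li _ (mre f mf)) (li _ (mre g mg))
    fun φ hφ hc => (key φ hφ hc).1
  obtain ⟨b, hb, eb⟩ := exists_isPrim_of_weak (li _ (mim f mf)) (li _ (mim g mg))
    fun φ hφ hc => (key φ hφ hc).2
  refine ⟨a, _, b, _, ha, hb, (mre f mf).ae_eq ea, mre g mg, (mim f mf).ae_eq eb, mim g mg, ?_⟩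
  filter_upwards [ea, eb] with x h1 h2
  rw [cx, ← h1, ← h2]
  exact (Complex.re_add_im _).symm

theorem integral_norm_sq_cx {f : ℝ → ℂ} {a b : ℝ → ℝ} (ha : MemLp a 2) (hb : MemLp b 2)
    (e : f =ᵐ[volume] cx a b) : ∫ x, ‖f x‖ ^ 2 = nrm a ^ 2 + nrm b ^ 2 := by
  rw [nrm_sq, nrm_sq, ← integral_add (integrable_sq ha) (integrable_sq hb)]
  refine integral_congr_ae ?_
  filter_upwards [e] with x hx
  rw [hx, norm_cx_sq]

theorem normL2_sq_cx {f : ℝ → ℂ} {a b : ℝ → ℝ} (ha : MemLp a 2) (hb : MemLp b 2)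
    (e : f =ᵐ[volume] cx a b) : normL2 f ^ 2 = nrm a ^ 2 + nrm b ^ 2 := by
  have hf : MemLp f 2 := (memLp_cx ha hb).ae_eq e.symm
  rw [← integral_norm_sq_cx ha hb e, normL2, hf.eLpNorm_eq_integral_rpow_norm (by norm_num)
    (by norm_num), ENNReal.toReal_ofReal (by positivity), ENNReal.toReal_ofNat,
    ← Real.rpow_natCast, ← Real.rpow_mul (integral_nonneg fun x => by positivity)]
  norm_num

theorem weighted_cx {f : ℝ → ℂ} {a b : ℝ → ℝ} (e : f =ᵐ[volume] cx a b) :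
    weighted f =ᵐ[volume] cx (fun x => wt x * a x) (fun x => wt x * b x) := by
  filter_upwards [e] with x hx
  rw [weighted, hx, cx, cx, wt]
  push_cast
  ring

/-- The energy in terms of real and imaginary parts. -/
theorem energy_cx {v : ℝ → ℂ} {p p' r r' ρ u₁ u₂ : ℝ → ℝ} (hp : IsPrim p p') (hr : IsPrim r r')
    (e : v =ᵐ[volume] cx p r) (hρ : MemLp ρ 2) (eρ : ∀ x, ρ x = p x ^ 2 + r x ^ 2)
    (m₁ : MemLp u₁ 2) (m₂ : MemLp u₂ 2)
    (h₁ : u₁ =ᵐ[volume] fun x => p' x + 1 / 2 * hR ρ x * p x)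
    (h₂ : u₂ =ᵐ[volume] fun x => r' x + 1 / 2 * hR ρ x * r x) :
    energy v = 1 / 2 * (nrm u₁ ^ 2 + nrm u₂ ^ 2) := by
  rw [energy, integral_norm_sq_cx m₁ m₂]
  have eh : hilbert (fun y => ((‖v y‖ ^ 2 : ℝ) : ℂ)) = hilbert fun y => (ρ y : ℂ) := by
    refine hilbert_congr ?_
    filter_upwards [e] with x hx
    rw [hx, norm_cx_sq, eρ]
  filter_upwards [e, weakDeriv_cx_ae hp hr e, hilbert_ofReal_ae hρ, h₁, h₂] with x h1 h2 h3 h4 h5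
  rw [bogomolnyi, h2, eh, h3, h1, cx, cx, cx, h4, h5]
  push_cast
  ring

/-! ### The soliton and the orthogonality conditions -/

theorem Q_eq (x : ℝ) : Q x = ((√2 * wt x : ℝ) : ℂ) := by
  rw [Q, wt, div_eq_mul_inv]

theorem deriv_Q (x : ℝ) : deriv Q x = ((-(√2 * (cpk x * wt x)) : ℝ) : ℂ) := by
  have h := (((hasDerivAt_wt x).const_mul (√2)).ofReal_comp).deriv
  rw [show Q = fun x => ((√2 * wt x : ℝ) : ℂ) from funext Q_eq, h]
  congr 1
  ring

theorem LambdaQ_eq (x : ℝ) : LambdaQ x = ((√2 / 2 * (wt x * ((1 - x ^ 2) * pk x)) : ℝ) : ℂ) := by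
  have h : (√2 * wt x) / 2 + x * (-(√2 * (cpk x * wt x))) =
      √2 / 2 * (wt x * ((1 - x ^ 2) * pk x)) := by
    rw [cpk_eq]
    linear_combination (-(√2 / 2 * wt x)) * pk_mul x
  rw [LambdaQ, Q_eq, deriv_Q, ← h]
  push_cast
  ring

section Orthogonality

variable {ε : ℝ → ℂ} {a b χ : ℝ → ℝ}

/-- Q, ΛQ and Q' are real, so the conditions with ΛQ and Q' involve only `a` and the one with iQ
only `b`. Up to nonzero constants they are the orthogonality hypotheses of the coercivity lemmas. -/
theorem integral_eq_zero_of_Z1 (e : ε =ᵐ[volume] cx a b) (h : innerR ε (Z1 χ) = 0) :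
    ∫ x, wt x * a x * ((x ^ 2 - 1) * pk x * χ x) = 0 := by
  have h1 : innerR ε (Z1 χ) = -(√2 / 2) * ∫ x, wt x * a x * ((x ^ 2 - 1) * pk x * χ x) := by
    rw [innerR, ← integral_const_mul]
    refine integral_congr_ae ?_
    filter_upwards [e] with x hx
    rw [hx, Z1, LambdaQ_eq, ← Complex.ofReal_mul, Complex.re_mul_ofReal, Complex.conj_re, cx_re]
    ring
  rw [h1] at h
  exact (mul_eq_zero.1 h).resolve_left (by simp)

theorem integral_eq_zero_of_Z2 (e : ε =ᵐ[volume] cx a b) (h : innerR ε (Z2 χ) = 0) :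
    ∫ x, b x * (wt x * χ x) = 0 := by
  have h1 : innerR ε (Z2 χ) = √2 * ∫ x, b x * (wt x * χ x) := by
    rw [innerR, ← integral_const_mul]
    refine integral_congr_ae ?_
    filter_upwards [e] with x hx
    rw [hx, Z2, Q_eq, mul_assoc Complex.I, ← Complex.ofReal_mul, ← mul_assoc,
      Complex.re_mul_ofReal, Complex.mul_I_re, Complex.conj_im, cx_im]
    ring
  rw [h1] at h
  exact (mul_eq_zero.1 h).resolve_left (by simp)

theorem integral_eq_zero_of_Z3 (e : ε =ᵐ[volume] cx a b) (h : innerR ε (Z3 χ) = 0) :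
    ∫ x, wt x * a x * (x * pk x * χ x) = 0 := by
  have h1 : innerR ε (Z3 χ) = -√2 * ∫ x, wt x * a x * (x * pk x * χ x) := by
    rw [innerR, ← integral_const_mul]
    refine integral_congr_ae ?_
    filter_upwards [e] with x hx
    rw [hx, Z3, deriv_Q, ← Complex.ofReal_mul, Complex.re_mul_ofReal, Complex.conj_re, cx_re,
      cpk_eq]
    ring
  rw [h1] at h
  exact (mul_eq_zero.1 h).resolve_left (by simp)

end Orthogonality

/-! ### Energies and norms in terms of the real and imaginary parts -/

namespace IsPert

variable {a a' b b' X X' : ℝ → ℝ} {A l C : ℝ} {ε : ℝ → ℂ}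

/-- Here |Q+ε|² = 2(`pk` + densPert) and ℋ`pk` = `cpk`. Since Q' = -`cpk` Q, the terms of order zero
cancel. -/
theorem energy_Q_add (h : IsPert a a' b b' A l) (e : ε =ᵐ[volume] cx a b) :
    energy (fun x => Q x + ε x) =
      1 / 2 * (nrm (resRe a a' b) ^ 2 + nrm (resIm a b b') ^ 2) := by
  obtain ⟨s2, -, -⟩ := sqrt_two_bounds
  have hp : IsPrim (fun x => √2 * wt x + a x) fun x => -(√2 * (cpk x * wt x)) + a' x :=
    (((isPrim_const (√2)).mul isPrim_wt).add h.ha).congr_deriv (.of_forall fun x => by ring)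
  have mρ : MemLp (fun x => 2 * (pk x + densPert a b x)) 2 :=
    (memLp_pk.add h.memLp_densPert).const_mul 2
  have hH : hR (fun x => 2 * (pk x + densPert a b x)) =ᵐ[volume]
      fun x => 2 * (cpk x + hR (densPert a b) x) := by
    filter_upwards [hR_const_mul 2 (memLp_pk.add h.memLp_densPert),
      hR_add memLp_pk h.memLp_densPert, hR_pk] with x h1 h2 h3
    rw [← h3, ← h2]
    exact h1
  refine energy_cx hp h.hb ?_ mρ (fun x => ?_) h.memLp_resRe h.memLp_resIm ?_ ?_
  · filter_upwards [e] with x hx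
    rw [hx, Q_eq, cx, cx]
    push_cast
    ring
  · simp only [densPert, dens, ← wt_sq]
    linear_combination (-(wt x ^ 2)) * s2
  · filter_upwards [hH] with x hx
    rw [hx, resRe]
    ring
  · filter_upwards [hH] with x hx
    rw [hx, resIm]
    ring

theorem energy_outerPart (h : IsPert a a' b b' A l) {χ : ℝ → ℝ} {R : ℝ}
    (hX : IsWeightedCutoff (fun x => χ (x / R)) X' C) (e : ε =ᵐ[volume] cx a b) :
    energy (outerPart χ R ε) = 1 / 2 *
      (nrm (fun x => -X' x * a x + (1 - χ (x / R)) * a' x +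
        1 / 2 * hR (fun x => (1 - χ (x / R)) ^ 2 * dens a b x) x * ((1 - χ (x / R)) * a x)) ^ 2 +
      nrm (fun x => -X' x * b x + (1 - χ (x / R)) * b' x +
        1 / 2 * hR (fun x => (1 - χ (x / R)) ^ 2 * dens a b x) x *
          ((1 - χ (x / R)) * b x)) ^ 2) := by
  have prim : ∀ {f f' : ℝ → ℝ}, IsPrim f f' →
      IsPrim (fun x => (1 - χ (x / R)) * f x) fun x => -X' x * f x + (1 - χ (x / R)) * f' x :=
    fun hf => (((isPrim_const 1).sub hX.isPrim).mul hf).congr_deriv (.of_forall fun x => by ring)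
  have cX : Continuous fun x => 1 - χ (x / R) := continuous_const.sub hX.isPrim.continuous
  have bX : ∀ x, |1 - χ (x / R)| ≤ 1 := fun x =>
    abs_le.2 ⟨by linarith [hX.le_one x], by linarith [hX.nonneg x]⟩
  have bX' : ∀ x, |-X' x| ≤ |C| := fun x => by
    rw [abs_neg]
    refine (hX.abs_deriv_le x).trans ?_
    have := wt_pos x
    nlinarith [wt_le_one x, le_abs_self C, abs_nonneg C]
  have mem : ∀ {f f' : ℝ → ℝ} (g : ℝ → ℝ), MemLp f 2 → MemLp f' 2 → (∀ x, |f x| ≤ A) →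
      MemLp (fun x => -X' x * f x + (1 - χ (x / R)) * f' x +
        1 / 2 * hR g x * ((1 - χ (x / R)) * f x)) 2 := fun g mf mf' hf => by
    refine ((memLp_bdd_mul hX.continuous_deriv.neg.aestronglyMeasurable bX' mf).add
      (memLp_bdd_mul cX.aestronglyMeasurable bX mf')).add ?_
    have h1 := memLp_bdd_mul cX.aestronglyMeasurable bX (memLp_bdd_mul mf.1 hf (memLp_hR (f := g)))
    exact (h1.const_mul (1 / 2)).ae_eq (.of_forall fun x => by ring)
  refine energy_cx (prim h.ha) (prim h.hb) ?_ (h.memLp_outer_dens hX) (fun x => ?_)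
    (mem _ h.ma h.ma' h.abs_a_le) (mem _ h.mb h.mb' h.abs_b_le) (.of_forall fun x => rfl)
    (.of_forall fun x => rfl)
  · filter_upwards [e] with x hx
    rw [outerPart, hx, cx, cx]
    push_cast
    ring
  · simp only [dens]
    ring

theorem normL2_weakDeriv_innerPart_sq (h : IsPert a a' b b' A l) {χ : ℝ → ℝ} {R : ℝ}
    (hX : IsWeightedCutoff (fun x => χ (x / R)) X' C) (e : ε =ᵐ[volume] cx a b) :
    normL2 (weakDeriv (innerPart χ R ε)) ^ 2 =
      nrm (fun x => X' x * a x + χ (x / R) * a' x) ^ 2 +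
        nrm (fun x => X' x * b x + χ (x / R) * b' x) ^ 2 := by
  have bX : ∀ x, |χ (x / R)| ≤ 1 := fun x =>
    abs_le.2 ⟨by linarith [hX.nonneg x], hX.le_one x⟩
  have bX' : ∀ x, |X' x| ≤ |C| := fun x => by
    refine (hX.abs_deriv_le x).trans ?_
    have := wt_pos x
    nlinarith [wt_le_one x, le_abs_self C, abs_nonneg C]
  have mem : ∀ {f f' : ℝ → ℝ}, MemLp f 2 → MemLp f' 2 →
      MemLp (fun x => X' x * f x + χ (x / R) * f' x) 2 := fun mf mf' =>
    (memLp_bdd_mul hX.continuous_deriv.aestronglyMeasurable bX' mf).add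
      (memLp_bdd_mul hX.isPrim.continuous.aestronglyMeasurable bX mf')
  refine normL2_sq_cx (mem h.ma h.ma') (mem h.mb h.mb')
    (weakDeriv_cx_ae (hX.isPrim.mul h.ha) (hX.isPrim.mul h.hb) ?_)
  filter_upwards [e] with x hx
  rw [innerPart, hx, cx, cx]
  push_cast
  ring

end IsPert

/-- Uniform bound for a small `H¹` perturbation. -/
theorem dens_le {a a' b b' : ℝ → ℝ} (ha : IsPrim a a') (hb : IsPrim b b') (ma : MemLp a 2)
    (ma' : MemLp a' 2) (mb : MemLp b 2) (mb' : MemLp b' 2) {M η : ℝ} (hM : 0 ≤ M)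
    (na : nrm a ≤ M) (nb : nrm b ≤ M) (na' : nrm a' ≤ η) (nb' : nrm b' ≤ η) (x : ℝ) :
    a x ^ 2 + b x ^ 2 ≤ 4 * M * η := by
  have key : ∀ {f f' : ℝ → ℝ}, IsPrim f f' → MemLp f 2 → MemLp f' 2 → nrm f ≤ M → nrm f' ≤ η →
      f x ^ 2 ≤ 2 * M * η := fun {f f'} hf mf mf' nf nf' => by
    -- One-dimensional Agmon inequality: f² is a primitive of 2ff' and vanishes at infinity.
    have h1 := (hf.mul hf).abs_le_integral (integrable_mul mf mf)
      ((integrable_mul mf' mf).add (integrable_mul mf mf')) x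
    have h2 : ∫ t, |f' t * f t + f t * f' t| = 2 * ∫ t, |f t * f' t| := by
      rw [← integral_const_mul]
      refine integral_congr_ae (.of_forall fun t => ?_)
      simp only
      rw [show f' t * f t + f t * f' t = 2 * (f t * f' t) by ring, abs_mul 2, abs_two]
    have h3 := (integral_mul_le mf mf').trans (mul_le_mul nf nf' (nrm_nonneg _) hM)
    have h4 := le_abs_self (f x * f x)
    nlinarith
  linarith [key ha ma ma' na na', key hb mb mb' nb nb']

/-- Interpolation at τ = η: both contributions are O(η) for bounded mass, and the relation between η
and θ makes their sum at most θ². -/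
theorem integral_wt_mul_abs_le {a : ℝ → ℝ} (ma : MemLp a 2) {M η θ : ℝ} (hM : 0 ≤ M) (hη : 0 < η)
    (hθ : 0 ≤ θ) (h : η * (4 * (M + 1) ^ 2) = θ ^ 2) (na : nrm a ≤ M)
    (nw : nrm (fun x => wt x * a x) ≤ η) : ∫ x, wt x * |a x| ≤ θ := by
  have g1 := integral_wt_mul_sq_le ma hη
  have g2 : η⁻¹ * nrm (fun x => wt x * a x) ^ 2 ≤ η := by
    have := pow_le_pow_left₀ (nrm_nonneg _) nw 2
    rw [inv_mul_le_iff₀ hη]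
    linarith
  have g3 : η * nrm a ^ 2 ≤ η * M ^ 2 :=
    mul_le_mul_of_nonneg_left (pow_le_pow_left₀ (nrm_nonneg _) na 2) hη.le
  have g4 : Real.pi * (η * nrm a ^ 2 + η⁻¹ * nrm (fun x => wt x * a x) ^ 2) ≤
      4 * (η * M ^ 2 + η) :=
    mul_le_mul Real.pi_le_four (add_le_add g3 g2) (by positivity) (by norm_num)
  have g5 : 0 ≤ η * M := by positivity
  have g6 : η * (4 * (M + 1) ^ 2) = 4 * (η * M ^ 2 + η) + 8 * (η * M) := by ring
  exact le_of_sq_le_sq (by linarith) hθ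

end CMDNLS

/-! ### Choice of the constants and conclusion -/

open CMDNLS in
theorem lemma3p4 (χ : ℝ → ℝ) (hχ : CMDNLS.IsCutoff χ) (M : ℝ) (hM : 0 < M) :
    ∃ R η c : ℝ, 1 < R ∧ 0 < η ∧ 0 < c ∧
      ∀ ε : ℝ → ℂ, CMDNLS.MemH1 ε →
        CMDNLS.normL2 ε ≤ M →
        CMDNLS.innerR ε (CMDNLS.Z1 χ) = 0 →
        CMDNLS.innerR ε (CMDNLS.Z2 χ) = 0 →
        CMDNLS.innerR ε (CMDNLS.Z3 χ) = 0 →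
        CMDNLS.normAdapted ε ≤ η →
        c * (CMDNLS.normAdaptedTrunc χ R ε ^ 2 + CMDNLS.energy (CMDNLS.outerPart χ R ε)) ≤
          CMDNLS.energy (fun x => CMDNLS.Q x + ε x) := by
  obtain ⟨X', C, hC, hX⟩ := hχ.exists_isWeightedCutoff
  obtain ⟨θ, hθ0, hθM⟩ : ∃ θ : ℝ, 0 < θ ∧ (M + 2) * θ ≤ 1 / 10 ^ 9 :=
    ⟨1 / 10 ^ 9 / (M + 2), by positivity, (mul_div_cancel₀ _ (by positivity)).le⟩
  have hθ1 : θ ≤ 1 := by nlinarith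
  -- This η makes the sup norm of ε, the integral ∫⟨x⟩⁻¹|a| and l all at most θ.
  obtain ⟨η, hη0, hηe⟩ : ∃ η : ℝ, 0 < η ∧ η * (4 * (M + 1) ^ 2) = θ ^ 2 :=
    ⟨θ ^ 2 / (4 * (M + 1) ^ 2), by positivity, div_mul_cancel₀ _ (by positivity)⟩
  obtain ⟨K, hK⟩ : ∃ K : ℝ, K = (C + 29) * 10 ^ 8 + 43 := ⟨_, rfl⟩
  have hK0 : 0 < K := by rw [hK]; positivity
  -- Each squared norm below is at most K²k². The truncated norm uses three of them and the outer
  -- energy half of two more, so the sum is at most 4K²k²; the factor 8 accounts for E(Q+ε) = k²/2.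
  refine ⟨2, η, 1 / (8 * K ^ 2), by norm_num, hη0, by positivity, ?_⟩
  intro ε hε hεM h₁ h₂ h₃ hεη
  obtain ⟨a, a', b, b', ha, hb, ma, ma', mb, mb', e⟩ := hε.exists_isPrim
  have n2 : ∀ f : ℝ → ℂ, 0 ≤ normL2 f := fun f => ENNReal.toReal_nonneg
  have q0 := normL2_sq_cx ma mb e
  have q1 := normL2_sq_cx ma' mb' (weakDeriv_cx_ae ha hb e)
  have q2 := normL2_sq_cx (memLp_wt_mul ma) (memLp_wt_mul mb) (weighted_cx e)
  have q3 := Real.sqrt_le_left hη0.le |>.1 hεη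
  set l := normL2 (weighted ε) with hl
  have hl0 : 0 ≤ l := n2 _
  have part : ∀ s t u : ℝ, 0 ≤ u → s ^ 2 + t ^ 2 ≤ u ^ 2 → s ≤ u ∧ t ≤ u := fun s t u hu h =>
    ⟨abs_le_of_sq_le_sq' (by nlinarith [sq_nonneg t]) hu |>.2,
      abs_le_of_sq_le_sq' (by nlinarith [sq_nonneg s]) hu |>.2⟩
  obtain ⟨na, nb⟩ := part _ _ M hM.le (q0.symm.trans_le (pow_le_pow_left₀ (n2 _) hεM 2))
  obtain ⟨na', nb'⟩ := part _ _ η hη0.le (q1.symm.trans_le (by nlinarith [sq_nonneg l]))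
  have hlη : l ≤ η := (part _ _ η hη0.le q3).2
  have hM1 : 1 ≤ (M + 1) ^ 2 := by nlinarith
  have hηθ : η ≤ θ := by nlinarith
  have hd := dens_le ha hb ma ma' mb mb' hM.le na nb na' nb'
  -- 4Mη ≤ 4(M+1)²η = θ², so the Agmon bound gives |a|, |b| ≤ θ.
  have hAB := fun x => part (|a x|) (|b x|) θ hθ0.le (by
    rw [sq_abs, sq_abs]
    refine (hd x).trans ?_
    nlinarith)
  have h : IsPert a a' b b' θ l :=
    ⟨ha, hb, ma, ma', mb, mb', fun x => (hAB x).1, fun x => (hAB x).2, hθ1, hl0, q2.symm⟩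
  have hB : ∫ x, wt x * |a x| ≤ θ :=
    integral_wt_mul_abs_le ma hM.le hη0 hθ0.le hηe na (h.nrm_wt_a_le.trans hlη)
  set k : ℝ := √(nrm (resRe a a' b) ^ 2 + nrm (resIm a b b') ^ 2) with hk
  have hk0 : 0 ≤ k := Real.sqrt_nonneg _
  have hk2 : k ^ 2 = nrm (resRe a a' b) ^ 2 + nrm (resIm a b b') ^ 2 :=
    Real.sq_sqrt (by positivity)
  obtain ⟨k1, k2⟩ := part _ _ k hk0 hk2.ge
  obtain ⟨hlk, hα⟩ := h.l_le hχ (integral_eq_zero_of_Z1 e h₁) (integral_eq_zero_of_Z2 e h₂)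
    (integral_eq_zero_of_Z3 e h₃) na hB le_rfl (hlη.trans hηθ) hθM k1 k2
  have hS : (C + 29) * l + 43 * k ≤ K * k := by
    have := mul_le_mul_of_nonneg_left hlk (by positivity : 0 ≤ C + 29)
    rw [hK]
    linarith
  have sqle : ∀ {f : ℝ → ℝ}, nrm f ≤ (C + 29) * l + 43 * k → nrm f ^ 2 ≤ K ^ 2 * k ^ 2 :=
    fun hf => by
      rw [← mul_pow]
      exact pow_le_pow_left₀ (nrm_nonneg _) (hf.trans hS) 2
  have i1 := sqle (h.nrm_deriv_inner_re_le hX hC k1 hα)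
  have i2 := sqle (h.nrm_deriv_inner_im_le hX hC k2 hα)
  have o1 := sqle (h.nrm_outer_re_le hX hC k1 hα)
  have o2 := sqle (h.nrm_outer_im_le hX hC k2)
  have l2 : l ^ 2 ≤ K ^ 2 * k ^ 2 := by
    rw [← mul_pow]
    refine pow_le_pow_left₀ hl0 (hlk.trans (mul_le_mul_of_nonneg_right ?_ hk0)) 2
    rw [hK]
    linarith
  rw [h.energy_Q_add e, h.energy_outerPart hX e, normAdaptedTrunc, Real.sq_sqrt (by positivity),
    h.normL2_weakDeriv_innerPart_sq hX e, ← hl, ← hk2, div_mul_eq_mul_div, div_le_iff₀ (by positivity)]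
  linarith
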